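/- **Notation.** Write $e(x)=e^{2\pi i x}$ and let $m\ge 2$ be an integer. An *(unrestricted) Jacobi form* of weight $k\in\mathbb Z$ and index $m$ is a holomorphic function $\phi:\mathbb H\times\mathbb C\to\mathbb C$ with $$e\!\left(-m\tfrac{cz^2}{c\tau+d}\right)(c\tau+d)^{-k}\,\phi\!\left(\tfrac{a\tau+b}{c\tau+d},\tfrac{z}{c\tau+d}\right)=\phi(\tau,z),\qquad e\big(m(\lambda^2\tau+2\lambda z)\big)\,\phi(\tau,z+\lambda\tau+\mu)=\phi(\tau,z)$$ for all $\left(\begin{smallmatrix}a&b\\c&d\end{smallmatrix}\right)\in SL_2(\mathbb Z)$ and all $\lambda,\mu\in\mathbb Z$ (no growth condition). For $r\in\mathbb Z/2m\mathbb Z$ put $\theta_{m,r}(\tau,z)=\sum_{n\equiv r\,(2m)}e\!\left(\tfrac{n^2}{4m}\tau+nz\right)$. For $\tilde h_m=(\tilde h_{m,r})_{r\in\mathbb Z/2m\mathbb Z}$, with $\tilde h_{m,r}:\mathbb H\to\mathbb C$, and a complex $2m\times 2m$ matrix $\Omega$ put $\tilde h_m^T\cdot\Omega\cdot\theta_m=\sum_{r,r'}\tilde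 h_{m,r}\,\Omega_{r,r'}\,\theta_{m,r'}$. Say that $\tilde h_m$ is *admissible of weight $k$* if $\tilde h_m^T\cdot\theta_m$ is a Jacobi form of weight $k$ and index $m$ (then $\tilde h_m$ is automatically a holomorphic vector-valued modular form of weight $k-\frac12$). For $n\mid m$ let $\Omega_m(n)$ be the $2m\times 2m$ matrix with $\Omega_m(n)_{r,r'}=1$ if $r+r'\equiv 0\ (2n)$ and $r-r'\equiv 0\ (2m/n)$, and $\Omega_m(n)_{r,r'}=0$ otherwise, and let $$(f|\mathcal W_m(n))(\tau,z)=\frac1n\sum_{a,b=0}^{n-1}e\!\left(m\left(\tfrac{a^2}{n^2}\tau+2\tfrac anz+\tfrac{ab}{n^2}\right)\right)f\!\left(\tau,z+\tfrac an\tau+\tfrac bn\right)$$ be the Eichler–Zagier operator. For an irreducible simply-laced root system $X$ with Coxeter number $m$, define $\Omega^X$ by - $A_{m-1}$ ($m\ge2$): $\Omega_m(1)$; - $D_{m/2+1}$ ($m\ge 6$ even): $\Omega_m(1)+\Omega_m(m/2)$; - $E_6$ ($m=12$): $\Omega_{12}(1)+\Omega_{12}(4)+\Omega_{12}(6)$;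 - $E_7$ ($m=18$): $\Omega_{18}(1)+\Omega_{18}(6)+\Omega_{18}(9)$; - $E_8$ ($m=30$): $\Omega_{30}(1)+\Omega_{30}(6)+\Omega_{30}(10)+\Omega_{30}(15)$; and let $\mathcal W^X$ be the operator obtained by replacing each $\Omega_m(n)$ in $\Omega^X$ with $\mathcal W_m(n)$. **Theorem.** (1) Let $X$ be an irreducible simply-laced root system with Coxeter number $m$. There are $c_{r,r'}\in\mathbb Z_{\ge0}$ $(1\le r,r'\le m-1)$ with $c_{1,1}=1$ such that, for every odd $k$ and every $\tilde h_m$ admissible of weight $k$, the function $\tilde h_m^T\cdot\Omega^X\cdot\theta_m$ is again a Jacobi form of weight $k$ and index $m$, and $$\tilde h_m^T\cdot\Omega^X\cdot\theta_m=\sum_{r,r'=1}^{m-1}c_{r,r'}\,\tilde h_{m,r}\,(\theta_{m,r'}-\theta_{m,-r'}),\qquad \tilde h_m^T\cdot\Omega^X\cdot\theta_m=(\tilde h_m^T\cdot\theta_m)\,|\,\mathcal W^X .$$ (2) Conversely, let $k$ be odd and let $\Omega$ be a complex $2m\times2m$ matrix such that, for every $\tilde h_m$ admissible of weight $k$ whose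 components grow at most exponentially in $\operatorname{Im}\tau$ as $\operatorname{Im}\tau\to\infty$, the function $\tilde h_m^T\cdot\Omega\cdot\theta_m$ is a Jacobi form of weight $k$ and index $m$ of the form $\sum_{r,r'=1}^{m-1}c_{r,r'}\tilde h_{m,r}(\theta_{m,r'}-\theta_{m,-r'})$ for some $c_{r,r'}\in\mathbb Z_{\ge0}$ with $c_{1,1}=1$. Then there is an irreducible simply-laced root system $X$ with Coxeter number $m$ such that $\Omega$ coincides with $\Omega^X$ on odd vectors, that is, $$\Omega_{r,r'}-\Omega_{-r,r'}=\Omega^X_{r,r'}-\Omega^X_{-r,r'}\qquad\text{for all } r,r'\in\mathbb Z/2m\mathbb Z,$$ and consequently $\tilde h_m^T\cdot\Omega\cdot\theta_m=\tilde h_m^T\cdot\Omega^X\cdot\theta_m=(\tilde h_m^T\cdot\theta_m)\,|\,\mathcal W^X$ for every $\tilde h_m$ admissible of weight $k$. -/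

import Mathlib

open scoped UpperHalfPlane MatrixGroups

noncomputable section

namespace JacobiADE

/-! ### Jacobi forms -/

/-- `e(x) = exp(2πi x)`. -/
def e (x : ℂ) : ℂ := Complex.exp (2 * Real.pi * Complex.I * x)

/-- An unrestricted Jacobi form of weight `k` and index `m` for `SL₂(ℤ) ⋉ ℤ²`: a (jointly)
holomorphic function on `ℍ × ℂ`, invariant under the weight `k`, index `m` action of `SL₂(ℤ)` and
under the index `m` action of `ℤ²`.  There is no growth condition. -/
structure IsJacobiForm (k : ℤ) (m : ℕ) (φ : ℍ → ℂ → ℂ) : Prop where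
  holomorphic : DifferentiableOn ℂ (fun p : ℂ × ℂ => φ (UpperHalfPlane.ofComplex p.1) p.2)
    {p : ℂ × ℂ | 0 < p.1.im}
  modular : ∀ (γ : SL(2, ℤ)) (τ : ℍ) (z : ℂ),
    e (-(m * ((γ 1 0 : ℤ) * z ^ 2 / ((γ 1 0 : ℤ) * (τ : ℂ) + (γ 1 1 : ℤ))))) *
      (((γ 1 0 : ℤ) * (τ : ℂ) + (γ 1 1 : ℤ))⁻¹) ^ k *
      φ (γ • τ) (z / ((γ 1 0 : ℤ) * (τ : ℂ) + (γ 1 1 : ℤ))) = φ τ z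
  elliptic : ∀ (l u : ℤ) (τ : ℍ) (z : ℂ),
    e (m * (l ^ 2 * (τ : ℂ) + 2 * l * z)) * φ τ (z + l * (τ : ℂ) + u) = φ τ z

/-- The index `m` theta function `θ_{m,r}(τ,z) = ∑_{n ≡ r mod 2m} q^{n²/4m} y^n`, where
`q = e(τ)` and `y = e(z)`. -/
def theta (m : ℕ) (r : ZMod (2 * m)) (τ : ℍ) (z : ℂ) : ℂ :=
  ∑' n : {n : ℤ // (n : ZMod (2 * m)) = r},
    e (((n : ℤ) : ℂ) ^ 2 / (4 * m) * (τ : ℂ) + ((n : ℤ) : ℂ) * z)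

/-- The combination `hᵀ · Ω · θ_m = ∑_{r,r' mod 2m} h_r Ω_{r,r'} θ_{m,r'}`. -/
def thetaSum (m : ℕ) [NeZero m] (h : ZMod (2 * m) → ℍ → ℂ)
    (Ω : Matrix (ZMod (2 * m)) (ZMod (2 * m)) ℂ) (τ : ℍ) (z : ℂ) : ℂ :=
  ∑ r : ZMod (2 * m), ∑ r' : ZMod (2 * m), h r τ * Ω r r' * theta m r' τ z

/-- At most exponential growth, in `Im τ`, of the components of `h` at the cusp `i∞`. -/
def HasExponentialGrowth {ι : Type*} (h : ι → ℍ → ℂ) : Prop :=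
  ∀ r, ∃ A B C : ℝ, ∀ τ : ℍ, B ≤ τ.im → ‖h r τ‖ ≤ C * Real.exp (A * τ.im)

/-- `φ = ∑_{r,r'=1}^{m-1} c_{r,r'} h_r (θ_{m,r'} - θ_{m,-r'})`. -/
def HasThetaCoefficients (m : ℕ) (h : ZMod (2 * m) → ℍ → ℂ) (c : ℕ → ℕ → ℕ)
    (φ : ℍ → ℂ → ℂ) : Prop :=
  ∀ (τ : ℍ) (z : ℂ), φ τ z =
    ∑ r ∈ Finset.Icc 1 (m - 1), ∑ r' ∈ Finset.Icc 1 (m - 1),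
      (c r r' : ℂ) * h (r : ZMod (2 * m)) τ *
        (theta m (r' : ZMod (2 * m)) τ z - theta m (-(r' : ZMod (2 * m))) τ z)

/-! ### The matrices `Ω_m(n)` and the Eichler–Zagier operators -/

/-- The matrix `Ω_m(n)`, for `n ∣ m`: its `(r,r')` entry is `1` if `r + r' ≡ 0 mod 2n` and
`r - r' ≡ 0 mod 2m/n`, and `0` otherwise. -/
def omega (m n : ℕ) : Matrix (ZMod (2 * m)) (ZMod (2 * m)) ℂ :=
  Matrix.of fun r r' => if 2 * n ∣ (r + r').val ∧ 2 * m / n ∣ (r - r').val then 1 else 0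

/-- The Eichler–Zagier operator `f ↦ f | W_m(n)`. -/
def eichlerZagier (m n : ℕ) (f : ℍ → ℂ → ℂ) (τ : ℍ) (z : ℂ) : ℂ :=
  1 / n * ∑ a ∈ Finset.range n, ∑ b ∈ Finset.range n,
    e (m * ((a : ℂ) ^ 2 / (n : ℂ) ^ 2 * (τ : ℂ) + 2 * ((a : ℂ) / n) * z +
      (a : ℂ) * b / (n : ℂ) ^ 2)) * f τ (z + (a : ℂ) / n * (τ : ℂ) + (b : ℂ) / n)

/-! ### Irreducible simply-laced root systems -/

/-- The irreducible simply-laced root systems (up to isomorphism), given by their Dynkin diagrams: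
`A_n` for `n ≥ 1`, `D_n` for `n ≥ 4`, `E_6`, `E_7`, `E_8`.  The roots are constructed below. -/
inductive ADE : Type
  | A (n : ℕ) (hn : 1 ≤ n) : ADE
  | D (n : ℕ) (hn : 4 ≤ n) : ADE
  | E6 : ADE
  | E7 : ADE
  | E8 : ADE

namespace ADE

def rank : ADE → ℕ
  | A n _ => n
  | D n _ => n
  | E6 => 6
  | E7 => 7
  | E8 => 8

/-- The Cartan matrix; since `X` is simply laced it is also the Gram matrix `⟨f_i, f_j⟩` of the
simple roots, normalised to have square length `2`. -/
def cartan : (X : ADE) → Matrix (Fin X.rank) (Fin X.rank) ℤ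
  | A n _ => CartanMatrix.A n
  | D n _ => CartanMatrix.D n
  | E6 => CartanMatrix.E₆
  | E7 => CartanMatrix.E₇
  | E8 => CartanMatrix.E₈

/-- The roots of `X`, in coordinates with respect to the simple roots: the vectors `∑ v_i f_i` of
square length `2` in the root lattice. -/
def roots (X : ADE) : Set (Fin X.rank → ℤ) :=
  {v | v ⬝ᵥ X.cartan.mulVec v = 2}

/-- The height `∑ v_i` of a root `∑ v_i f_i`. -/
def height (X : ADE) (v : Fin X.rank → ℤ) : ℤ := ∑ i, v i

/-- `X` has Coxeter number `m`: we have `m = 1 + ∑ a_i`, where `∑ a_i f_i` is the root of largest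
height. -/
def HasCoxeterNumber (X : ADE) (m : ℕ) : Prop :=
  ∃ a ∈ X.roots, (∀ v ∈ X.roots, X.height v ≤ X.height a) ∧ (m : ℤ) = 1 + ∑ i, a i

/-- The set of divisors `n` of the Coxeter number `m` of `X` such that `Ω_m(n)` occurs (with
coefficient one) in the table that defines `Ω^X`. -/
def levels (m : ℕ) : ADE → Finset ℕ
  | A _ _ => {1}
  | D _ _ => {1, m / 2}
  | E6 => {1, 4, 6}
  | E7 => {1, 6, 9}
  | E8 => {1, 6, 10, 15}

/-- The `2m × 2m` matrix `Ω^X`, where `m` is the Coxeter number of `X`. -/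
def omegaX (m : ℕ) (X : ADE) : Matrix (ZMod (2 * m)) (ZMod (2 * m)) ℂ :=
  ∑ n ∈ X.levels m, omega m n

/-- The Eichler–Zagier operator `f ↦ f | W^X`, where `W^X` is obtained by replacing `Ω_m(n)` with
`W_m(n)` in `Ω^X`. -/
def eichlerZagierX (m : ℕ) (X : ADE) (f : ℍ → ℂ → ℂ) (τ : ℍ) (z : ℂ) : ℂ :=
  ∑ n ∈ X.levels m, eichlerZagier m n f τ z

end ADE

end JacobiADE

end

open JacobiADE

/-!
Jacobi forms of index `m` are handled through their theta decomposition `φ = ∑ h_r θ_{m,r}`.  In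
odd weight the vector `h` is odd (`coeff_neg`), so a matrix `Ω` acts only through its odd part
`Ω_{r,r'} - Ω_{-r,r'}`, which is determined by its entries with `1 ≤ r, r' ≤ m - 1`.

Part one.  A torsion translate of `θ_{m,r}` is a multiple of some `θ_{m,r'}`, and orthogonality of
characters turns the average over translates in `W_m(n)` into the matrix `Ω_m(n)`
(`eichlerZagier_theta`, `thetaSum_omega`).  As `SL₂(ℤ)` permutes the translates, `W_m(n)` preserves
Jacobi forms (`IsJacobiForm.eichlerZagier`).  The entries of the odd part of `Ω^X` are computed
explicitly and are non-negative (`ADE.oddEntry_A`, `ADE.oddEntry_D`, `ADE.oddEntry_E6`, …), once the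
Coxeter number of `X` has been determined from its Cartan matrix (`ADE.hasCoxeterNumber_A`, …).

Part two.  The converse has three ingredients.

* There are enough Jacobi forms.  With `φ₁₁` of weight `11` and index `2`, `φ₁₀` and `φ₄` of index
  `1`, and weakly holomorphic modular forms `g_i` of level one, the `m - 1` forms
  `g_i φ₁₁ φ₁₀^i φ₄^(m-2-i)` have weight `k` and index `m`, grow at most exponentially, and are
  independent at a suitable `τ` (`exists_independent_jacobiForms`), so that their coefficient
  vectors span all odd vectors (`exists_spanning_family`).
* The coefficients `c_{r,r'}` may depend on `h`.  But along a family `∑ tⁱ h_i` with `t ∈ ℂ` they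
  range over a countable set, so one `c` serves infinitely many `t`; a polynomial identity in `t`
  then identifies the odd part of `Ω` with `c`.  Since `Ω` preserves Jacobi forms, `c` commutes with
  the finite Fourier transform and with the quadratic character `r ↦ e(r²/4m)`: it is a modular
  invariant in the sense of conformal field theory for `SU(2)`, at level `m - 2`
  (`IsModularInvariant`, `exists_modularInvariant`).
* The classification of these invariants by Cappelli, Itzykson and Zuber, along the lines of
  Gannon's proof.  The Galois action on roots of unity shows that `c 1 b ≠ 0` forces `b` and `1` to
  have multiples `l b`, `l` with the same sign modulo `2m`, for all units `l`.  An elementary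
  argument restricts `b` to `1` or `m - 1`, apart from exceptions at `m = 12` and `m = 30`
  (`galoisPositive_classification`, `IsModularInvariant.row_one`).  The first row determines the
  sums of the columns weighted by the positive vector `sin(πx/m)`
  (`IsModularInvariant.column_sum`), and non-negativity and integrality bound the entries as in
  Perron–Frobenius theory.  The possible first rows lead to type `A` and to type `D` with `4 ∣ m`
  (`IsModularInvariant.eq_of_delta`), to type `D` with `m ≡ 2 mod 4` and `E₇`
  (`IsFoldedInvariant`), to `E₆` (`IsModularInvariant.eq_E6`) and to `E₈`
  (`IsModularInvariant.eq_E8`); together, `IsModularInvariant.exists_ADE`.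
-/

noncomputable section

namespace JacobiADE

/-! ### Jacobi forms -/

lemma e_add (x y : ℂ) : e (x + y) = e x * e y := by
  rw [e, e, e, ← Complex.exp_add]; ring_nf

lemma e_zero : e 0 = 1 := by simp [e]

lemma e_ne_zero (x : ℂ) : e x ≠ 0 := Complex.exp_ne_zero _

lemma e_neg (x : ℂ) : e (-x) = (e x)⁻¹ := by
  rw [e, e, ← Complex.exp_neg]; ring_nf

lemma e_intCast (n : ℤ) : e n = 1 := by
  rw [e, mul_comm]; exact Complex.exp_int_mul_two_pi_mul_I n

lemma e_natCast (n : ℕ) : e n = 1 := by exact_mod_cast e_intCast n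

lemma e_one : e 1 = 1 := by simpa using e_natCast 1

lemma e_add_intCast (x : ℂ) (n : ℤ) : e (x + n) = e x := by rw [e_add, e_intCast, mul_one]

lemma e_eq_of_sub_eq_intCast {x y : ℂ} (n : ℤ) (h : x - y = n) : e x = e y := by
  rw [show x = y + n by rw [← h]; ring, e_add_intCast]

lemma e_nat_mul (n : ℕ) (x : ℂ) : e (n * x) = e x ^ n := by
  rw [e, e, ← Complex.exp_nat_mul]; ring_nf

lemma e_half : e (1 / 2) = -1 := by
  rw [e, show (2 * Real.pi * Complex.I * (1 / 2) : ℂ) = Real.pi * Complex.I by ring,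
    Complex.exp_pi_mul_I]

lemma differentiable_e : Differentiable ℂ e := by unfold e; fun_prop

@[fun_prop]
lemma differentiableOn_e_comp {E : Type*} [NormedAddCommGroup E] [NormedSpace ℂ E] {s : Set E}
    {f : E → ℂ} (hf : DifferentiableOn ℂ f s) : DifferentiableOn ℂ (fun x => e (f x)) s :=
  differentiable_e.comp_differentiableOn hf

@[fun_prop]
lemma continuous_e : Continuous e := differentiable_e.continuous

lemma norm_e (x : ℂ) : ‖e x‖ = Real.exp (-2 * Real.pi * x.im) := by
  rw [e, Complex.norm_exp]; congr 1; simp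

/-- The automorphy factor `cτ + d`. -/
def autFactor (γ : SL(2, ℤ)) (τ : ℍ) : ℂ := (γ 1 0 : ℤ) * (τ : ℂ) + (γ 1 1 : ℤ)

lemma autFactor_eq_denom (γ : SL(2, ℤ)) (τ : ℍ) :
    autFactor γ τ = UpperHalfPlane.denom γ τ := rfl

lemma autFactor_ne_zero (γ : SL(2, ℤ)) (τ : ℍ) : autFactor γ τ ≠ 0 := by
  rw [autFactor_eq_denom]; exact UpperHalfPlane.denom_ne_zero _ _

lemma coe_smul_eq (γ : SL(2, ℤ)) (τ : ℍ) :
    ((γ • τ : ℍ) : ℂ) = ((γ 0 0 : ℤ) * (τ : ℂ) + (γ 0 1 : ℤ)) / autFactor γ τ := by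
  rw [UpperHalfPlane.coe_specialLinearGroup_apply]; simp [autFactor]

lemma det_eq_one_complex (γ : SL(2, ℤ)) :
    ((γ 0 0 : ℤ) : ℂ) * (γ 1 1 : ℤ) - (γ 0 1 : ℤ) * (γ 1 0 : ℤ) = 1 := by
  have := Matrix.det_fin_two γ.1
  rw [γ.2] at this
  exact_mod_cast this.symm

lemma autFactor_mul (γ δ : SL(2, ℤ)) (τ : ℍ) :
    autFactor (γ * δ) τ = autFactor γ (δ • τ) * autFactor δ τ := by
  have h := autFactor_ne_zero δ τ
  conv_rhs => rw [autFactor, coe_smul_eq]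
  have h1 : (γ * δ) 1 0 = γ 1 0 * δ 0 0 + γ 1 1 * δ 1 0 := by
    simp [Matrix.mul_apply, Fin.sum_univ_two]
  have h2 : (γ * δ) 1 1 = γ 1 0 * δ 0 1 + γ 1 1 * δ 1 1 := by
    simp [Matrix.mul_apply, Fin.sum_univ_two]
  rw [autFactor, h1, h2]
  field_simp
  rw [autFactor]
  push_cast
  ring

/-- The weight `k`, index `m` action of `SL₂(ℤ)` on functions on `ℍ × ℂ`. -/
def jacobiSlash (k : ℤ) (m : ℕ) (γ : SL(2, ℤ)) (φ : ℍ → ℂ → ℂ) (τ : ℍ) (z : ℂ) : ℂ :=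
  e (-(m * ((γ 1 0 : ℤ) * z ^ 2 / autFactor γ τ))) * (autFactor γ τ)⁻¹ ^ k *
    φ (γ • τ) (z / autFactor γ τ)

lemma jacobiSlash_mul (k : ℤ) (m : ℕ) (γ δ : SL(2, ℤ)) (φ : ℍ → ℂ → ℂ) :
    jacobiSlash k m (γ * δ) φ = jacobiSlash k m δ (jacobiSlash k m γ φ) := by
  ext τ z
  have hγ := autFactor_ne_zero γ (δ • τ)
  have hδ := autFactor_ne_zero δ τ
  have h1 : (γ * δ) 1 0 = γ 1 0 * δ 0 0 + γ 1 1 * δ 1 0 := by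
    simp [Matrix.mul_apply, Fin.sum_univ_two]
  simp only [jacobiSlash]
  have hexp : -((m : ℂ) * (((γ * δ) 1 0 : ℤ) * z ^ 2 / autFactor (γ * δ) τ)) =
      -(m * ((δ 1 0 : ℤ) * z ^ 2 / autFactor δ τ)) +
        -(m * ((γ 1 0 : ℤ) * (z / autFactor δ τ) ^ 2 / autFactor γ (δ • τ))) := by
    rw [autFactor_mul, h1, ← neg_add, ← mul_add]
    congr 2
    field_simp
    have : autFactor γ (δ • τ) * autFactor δ τ =
        (γ 1 0 : ℤ) * ((δ 0 0 : ℤ) * (τ : ℂ) + (δ 0 1 : ℤ)) + (γ 1 1 : ℤ) * autFactor δ τ := by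
      conv_lhs => rw [autFactor, coe_smul_eq]
      field_simp
    have hd := det_eq_one_complex δ
    rw [add_comm]
    push_cast
    have h2 : autFactor δ τ = (δ 1 0 : ℤ) * (τ : ℂ) + (δ 1 1 : ℤ) := rfl
    linear_combination (-((δ 1 0 : ℤ) : ℂ)) * z ^ 2 * this + ((γ 1 0 : ℤ) : ℂ) * z ^ 2 * hd +
      (((γ 1 0 : ℤ) : ℂ) * (δ 0 0 : ℤ)) * z ^ 2 * h2
  rw [hexp, e_add, autFactor_mul, mul_inv, mul_zpow, mul_smul, div_mul_eq_div_div_swap]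
  ring

lemma jacobiSlash_one (k : ℤ) (m : ℕ) (φ : ℍ → ℂ → ℂ) : jacobiSlash k m 1 φ = φ := by
  ext τ z
  simp [jacobiSlash, autFactor, e_zero]

/-- Invariance under the action of `SL₂(ℤ)` need only be tested on the generators `S` and `T`. -/
lemma jacobiSlash_eq_of_generators {k : ℤ} {m : ℕ} {φ : ℍ → ℂ → ℂ}
    (hS : jacobiSlash k m ModularGroup.S φ = φ) (hT : jacobiSlash k m ModularGroup.T φ = φ)
    (γ : SL(2, ℤ)) : jacobiSlash k m γ φ = φ := by
  have : γ ∈ Subgroup.closure {ModularGroup.S, ModularGroup.T} := by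
    simp [SpecialLinearGroup.SL2Z_generators]
  induction this using Subgroup.closure_induction with
  | mem x hx =>
    rcases hx with rfl | rfl
    · exact hS
    · exact hT
  | one => exact jacobiSlash_one k m φ
  | mul x y _ _ hx hy => rw [jacobiSlash_mul, hx, hy]
  | inv x _ hx =>
    conv_lhs => rw [← hx, ← jacobiSlash_mul, mul_inv_cancel, jacobiSlash_one]

/-- Quasi-periodicity under all of `ℤτ + ℤ` follows from that under `1` and `τ`. -/
lemma elliptic_of_generators {m : ℕ} {φ : ℍ → ℂ → ℂ} (h1 : ∀ τ z, φ τ (z + 1) = φ τ z)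
    (hτ : ∀ (τ : ℍ) z, e (m * ((τ : ℂ) + 2 * z)) * φ τ (z + τ) = φ τ z) (l u : ℤ) (τ : ℍ) (z : ℂ) :
    e (m * (l ^ 2 * (τ : ℂ) + 2 * l * z)) * φ τ (z + l * (τ : ℂ) + u) = φ τ z := by
  have hu : ∀ (u : ℤ) (z : ℂ), φ τ (z + u) = φ τ z := by
    intro u
    induction u using Int.induction_on with
    | zero => simp
    | succ i hi => intro z; push_cast at hi ⊢; rw [← add_assoc, h1, hi]
    | pred i hi =>
      intro z; push_cast at hi ⊢
      rw [← h1, show z + (-(i : ℂ) - 1) + 1 = z + -i by ring, hi]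
  rw [hu]
  clear u hu
  induction l using Int.induction_on generalizing z with
  | zero => simp [e_zero]
  | succ i hi =>
    rw [← hi z, ← hτ τ (z + (i : ℤ) * τ), ← mul_assoc, ← e_add]
    congr 2 <;> push_cast <;> ring
  | pred i hi =>
    rw [← hi z, ← hτ τ (z + ((-(i : ℤ) - 1 : ℤ) : ℂ) * τ),
      show (z + ((-(i : ℤ) - 1 : ℤ) : ℂ) * τ + τ) = z + ((-(i : ℤ) : ℤ) : ℂ) * τ by push_cast; ring,
      ← mul_assoc, ← e_add]
    congr 2; push_cast; ring

lemma coe_S_smul (τ : ℍ) : ((ModularGroup.S • τ : ℍ) : ℂ) = -1 / τ := by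
  rw [coe_smul_eq]; simp [autFactor, ModularGroup.S]

lemma coe_T_smul (τ : ℍ) : ((ModularGroup.T • τ : ℍ) : ℂ) = τ + 1 := by
  rw [coe_smul_eq]; simp [autFactor, ModularGroup.T]

/-- A holomorphic function is a Jacobi form as soon as it transforms correctly under generators of
`SL₂(ℤ) ⋉ ℤ²`. -/
lemma IsJacobiForm.of_generators {k : ℤ} {m : ℕ} {φ : ℍ → ℂ → ℂ}
    (hol : DifferentiableOn ℂ (fun p : ℂ × ℂ => φ (UpperHalfPlane.ofComplex p.1) p.2)
      {p : ℂ × ℂ | 0 < p.1.im})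
    (hS : ∀ (τ : ℍ) z, φ (ModularGroup.S • τ) (z / τ) = (τ : ℂ) ^ k * e (m * (z ^ 2 / τ)) * φ τ z)
    (hT : ∀ τ z, φ (ModularGroup.T • τ) z = φ τ z)
    (h1 : ∀ τ z, φ τ (z + 1) = φ τ z)
    (hτ : ∀ (τ : ℍ) z, e (m * ((τ : ℂ) + 2 * z)) * φ τ (z + τ) = φ τ z) :
    IsJacobiForm k m φ where
  holomorphic := hol
  modular γ τ z := by
    refine congrFun (congrFun (jacobiSlash_eq_of_generators (k := k) (m := m) (φ := φ) ?_ ?_ γ) τ) z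
    · ext τ z
      have hne : (τ : ℂ) ≠ 0 := UpperHalfPlane.ne_zero τ
      have : autFactor ModularGroup.S τ = τ := by simp [autFactor, ModularGroup.S]
      rw [jacobiSlash, this, hS, e_neg, inv_zpow]
      have h1 : ((ModularGroup.S 1 0 : ℤ) : ℂ) = 1 := by simp [ModularGroup.S]
      rw [h1, one_mul]
      have h2 := e_ne_zero (m * (z ^ 2 / τ))
      have h3 := zpow_ne_zero k hne
      generalize e (m * (z ^ 2 / τ)) = x at *
      field_simp
    · ext τ z
      have : autFactor ModularGroup.T τ = 1 := by simp [autFactor, ModularGroup.T]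
      rw [jacobiSlash, this]
      simp [ModularGroup.T, e_zero]
      exact hT τ z
  elliptic := elliptic_of_generators h1 hτ

lemma IsJacobiForm.S_smul {k : ℤ} {m : ℕ} {φ : ℍ → ℂ → ℂ} (h : IsJacobiForm k m φ) (τ : ℍ) (z : ℂ) :
    e (-(m * (z ^ 2 / τ))) * ((τ : ℂ)⁻¹) ^ k * φ (ModularGroup.S • τ) (z / τ) = φ τ z := by
  simpa [ModularGroup.S] using h.modular ModularGroup.S τ z

lemma IsJacobiForm.T_smul {k : ℤ} {m : ℕ} {φ : ℍ → ℂ → ℂ} (h : IsJacobiForm k m φ) (τ : ℍ) (z : ℂ) :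
    φ (ModularGroup.T • τ) z = φ τ z := by
  simpa [ModularGroup.T, e_zero] using h.modular ModularGroup.T τ z

lemma IsJacobiForm.neg_right {k : ℤ} {m : ℕ} {φ : ℍ → ℂ → ℂ} (h : IsJacobiForm k m φ) (hk : Odd k)
    (τ : ℍ) (z : ℂ) : φ τ (-z) = -φ τ z := by
  have := h.modular (-1) τ z
  simp [e_zero, hk.neg_one_zpow, inv_neg, div_neg] at this
  rw [← this, neg_neg]

lemma IsJacobiForm.mul {k k' : ℤ} {m m' : ℕ} {φ ψ : ℍ → ℂ → ℂ} (hφ : IsJacobiForm k m φ)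
    (hψ : IsJacobiForm k' m' ψ) : IsJacobiForm (k + k') (m + m') (fun τ z => φ τ z * ψ τ z) where
  holomorphic := hφ.holomorphic.mul hψ.holomorphic
  modular γ τ z := by
    conv_rhs => rw [← hφ.modular γ τ z, ← hψ.modular γ τ z]
    have h0 := inv_ne_zero (autFactor_ne_zero γ τ)
    change _ * (autFactor γ τ)⁻¹ ^ (k + k') * _ =
      _ * (autFactor γ τ)⁻¹ ^ k * _ * (_ * (autFactor γ τ)⁻¹ ^ k' * _)
    rw [zpow_add₀ h0, Nat.cast_add, add_mul, neg_add, e_add]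
    ring
  elliptic l u τ z := by
    conv_rhs => rw [← hφ.elliptic l u τ z, ← hψ.elliptic l u τ z]
    rw [Nat.cast_add, add_mul, e_add]
    ring

lemma IsJacobiForm.pow {k : ℤ} {m : ℕ} {φ : ℍ → ℂ → ℂ} (hφ : IsJacobiForm k m φ) (n : ℕ) :
    IsJacobiForm (n * k) (n * m) (fun τ z => φ τ z ^ n) := by
  induction n with
  | zero =>
    simp only [Nat.cast_zero, zero_mul, pow_zero]
    exact ⟨by fun_prop, by simp [e_zero], by simp [e_zero]⟩
  | succ n ih =>
    have := ih.mul hφ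
    simp only [← pow_succ] at this
    convert this using 1 <;> push_cast <;> ring

lemma IsJacobiForm.sum {ι : Type*} (s : Finset ι) {k : ℤ} {m : ℕ} {φ : ι → ℍ → ℂ → ℂ}
    (h : ∀ i ∈ s, IsJacobiForm k m (φ i)) : IsJacobiForm k m (fun τ z => ∑ i ∈ s, φ i τ z) where
  holomorphic := by
    have : (fun p : ℂ × ℂ => ∑ i ∈ s, φ i (UpperHalfPlane.ofComplex p.1) p.2) =
        ∑ i ∈ s, fun p : ℂ × ℂ => φ i (UpperHalfPlane.ofComplex p.1) p.2 := by
      ext p; simp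
    rw [this]
    exact DifferentiableOn.sum fun i hi => (h i hi).holomorphic
  modular γ τ z := by
    rw [Finset.mul_sum]
    exact Finset.sum_congr rfl fun i hi => (h i hi).modular γ τ z
  elliptic l u τ z := by
    rw [Finset.mul_sum]
    exact Finset.sum_congr rfl fun i hi => (h i hi).elliptic l u τ z

lemma IsJacobiForm.const_mul {k : ℤ} {m : ℕ} {φ : ℍ → ℂ → ℂ} (h : IsJacobiForm k m φ) (c : ℂ) :
    IsJacobiForm k m (fun τ z => c * φ τ z) where
  holomorphic := h.holomorphic.const_mul c
  modular γ τ z := by rw [← h.modular γ τ z]; ring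
  elliptic l u τ z := by rw [← h.elliptic l u τ z]; ring

/-! ### Theta functions -/

/-- The term `q^{n²/4m} y^n` of the theta series of index `m`. -/
def thetaTerm (m : ℕ) (τ : ℍ) (z : ℂ) (n : ℤ) : ℂ := e ((n : ℂ) ^ 2 / (4 * m) * (τ : ℂ) + n * z)

lemma theta_eq_tsum (m : ℕ) (r : ZMod (2 * m)) (τ : ℍ) (z : ℂ) :
    theta m r τ z = ∑' n : {n : ℤ // (n : ZMod (2 * m)) = r}, thetaTerm m τ z n := rfl

lemma thetaTerm_eq_jacobiTheta₂_term (m : ℕ) [NeZero m] (τ : ℍ) (z : ℂ) (n : ℤ) :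
    thetaTerm m τ z n = jacobiTheta₂_term n z (τ / (2 * m)) := by
  have : (m : ℂ) ≠ 0 := NeZero.ne _
  rw [thetaTerm, jacobiTheta₂_term, e]
  congr 1
  field_simp
  ring

lemma im_div_pos (m : ℕ) [NeZero m] (τ : ℍ) : 0 < ((τ : ℂ) / (2 * m)).im := by
  have h : ((τ : ℂ) / (2 * m)) = (τ : ℂ) / ((2 * m : ℝ) : ℂ) := by push_cast; ring
  rw [h, Complex.div_ofReal_im]
  have : (0 : ℝ) < m := Nat.cast_pos.mpr (NeZero.pos m)
  have := τ.im_pos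
  positivity

lemma summable_thetaTerm (m : ℕ) [NeZero m] (τ : ℍ) (z : ℂ) : Summable (thetaTerm m τ z) := by
  simp only [funext (thetaTerm_eq_jacobiTheta₂_term m τ z)]
  exact (hasSum_jacobiTheta₂_term z (im_div_pos m τ)).summable

/-- A linear combination of the `θ_{m,r}` as a single series over `ℤ`. -/
lemma hasSum_theta_combination (m : ℕ) [NeZero m] (v : ZMod (2 * m) → ℂ) (τ : ℍ) (z : ℂ) :
    HasSum (fun n : ℤ => v n * thetaTerm m τ z n) (∑ r, v r * theta m r τ z) := by
  have hs : Summable (fun n : ℤ => v n * thetaTerm m τ z n) := by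
    refine Summable.of_norm_bounded (g := fun n => (∑ r, ‖v r‖) * ‖thetaTerm m τ z n‖)
      ((summable_thetaTerm m τ z).norm.mul_left _) fun n => ?_
    rw [norm_mul]
    gcongr
    exact Finset.single_le_sum (f := fun r => ‖v r‖) (fun _ _ => norm_nonneg _) (Finset.mem_univ _)
  convert hs.hasSum using 1
  let E := Equiv.sigmaFiberEquiv (fun n : ℤ => (n : ZMod (2 * m)))
  rw [← E.tsum_eq]
  refine Eq.trans ?_ (Summable.tsum_sigma (E.summable_iff.mpr hs)).symm
  rw [tsum_fintype]
  refine Finset.sum_congr rfl fun r _ => ?_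
  rw [theta_eq_tsum, ← tsum_mul_left]
  refine tsum_congr fun n => ?_
  have h1 : E ⟨r, n⟩ = (n : ℤ) := rfl
  have h2 : ((n : ℤ) : ZMod (2 * m)) = r := n.2
  rw [Function.comp_apply, h1, h2]

lemma integral_e_int (n : ℤ) : ∫ x in (0 : ℝ)..1, e (n * (x : ℂ)) = if n = 0 then 1 else 0 := by
  split_ifs with h
  · simp [h, e_zero]
  · have hc : (2 * Real.pi * Complex.I * n : ℂ) ≠ 0 := by
      simp [Real.pi_ne_zero, h]
    have : ∀ x : ℝ, e (n * (x : ℂ)) = Complex.exp ((2 * Real.pi * Complex.I * n) * x) := by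
      intro x; rw [e]; congr 1; ring
    simp_rw [this]
    rw [integral_exp_mul_complex hc]
    have h1 : Complex.exp (2 * Real.pi * Complex.I * n * (1 : ℝ)) = 1 := by
      have := e_intCast n
      rw [e] at this
      simpa using this
    rw [h1]; simp

/-- The Fourier coefficients of a normally convergent Fourier series. -/
lemma fourier_coefficient {c : ℤ → ℂ} (hc : Summable c) {f : ℝ → ℂ}
    (hf : ∀ x : ℝ, HasSum (fun n : ℤ => c n * e (n * (x : ℂ))) (f x)) (N : ℤ) :
    ∫ x in (0 : ℝ)..1, f x * e (-(N * (x : ℂ))) = c N := by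
  have hnorm : ∀ (n : ℤ) (x : ℝ), ‖e (n * (x : ℂ))‖ = 1 := by
    intro n x; rw [norm_e]; simp
  have key := intervalIntegral.hasSum_integral_of_dominated_convergence (a := 0) (b := 1)
    (μ := MeasureTheory.volume) (ι := ℤ)
    (F := fun n (x : ℝ) => c n * e (n * (x : ℂ)) * e (-(N * (x : ℂ))))
    (f := fun x => f x * e (-(N * (x : ℂ)))) (fun n _ => ‖c n‖)
    (fun n => by
      apply Continuous.aestronglyMeasurable
      fun_prop)
    (fun n => by
      refine Filter.Eventually.of_forall fun x _ => ?_
      rw [norm_mul, norm_mul, hnorm, e_neg, norm_inv, hnorm]; simp)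
    (Filter.Eventually.of_forall fun _ _ => hc.norm)
    (by simp)
    (Filter.Eventually.of_forall fun x _ => (hf x).mul_right _)
  have h2 : ∀ n : ℤ, ∫ x in (0 : ℝ)..1, c n * e (n * (x : ℂ)) * e (-(N * (x : ℂ))) =
      if n = N then c N else 0 := by
    intro n
    have : ∀ x : ℝ, c n * e (n * (x : ℂ)) * e (-(N * (x : ℂ))) =
        c n * e (((n - N : ℤ) : ℂ) * (x : ℂ)) := by
      intro x; rw [mul_assoc, ← e_add]; congr 2; push_cast; ring
    simp_rw [this]
    rw [intervalIntegral.integral_const_mul, integral_e_int]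
    by_cases h : n = N
    · simp [h]
    · simp [h, sub_eq_zero]
  simp_rw [h2] at key
  have h3 := hasSum_ite_eq N (c N)
  exact key.unique h3

lemma thetaTerm_eq (m : ℕ) (τ : ℍ) (z : ℂ) (n : ℤ) :
    thetaTerm m τ z n = e ((n : ℂ) ^ 2 / (4 * m) * (τ : ℂ)) * e (n * z) := by
  rw [thetaTerm, e_add]

/-- The coefficients of a combination of theta functions as Fourier coefficients. -/
lemma integral_theta_combination (m : ℕ) [NeZero m] (v : ZMod (2 * m) → ℂ) (τ : ℍ) (N : ℤ) :
    ∫ x in (0 : ℝ)..1, (∑ r, v r * theta m r τ x) * e (-(N * (x : ℂ))) =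
      v N * e ((N : ℂ) ^ 2 / (4 * m) * (τ : ℂ)) := by
  have hs := (hasSum_theta_combination m v τ 0).summable
  simp only [thetaTerm, mul_zero, add_zero] at hs
  refine fourier_coefficient (c := fun n : ℤ => v n * e ((n : ℂ) ^ 2 / (4 * m) * (τ : ℂ))) hs
    (fun x => ?_) N
  convert hasSum_theta_combination m v τ x using 2 with n
  rw [thetaTerm_eq, mul_assoc]

/-- The theta functions of index `m` are linearly independent for each fixed `τ`: the Fourier
coefficients in `z` recover the coefficients of a combination. -/
lemma theta_linearIndependent (m : ℕ) [NeZero m] {v w : ZMod (2 * m) → ℂ} {τ : ℍ}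
    (h : ∀ z : ℂ, ∑ r, v r * theta m r τ z = ∑ r, w r * theta m r τ z) : v = w := by
  ext r
  obtain ⟨N, rfl⟩ := ZMod.intCast_surjective r
  have h1 := integral_theta_combination m v τ N
  have h2 := integral_theta_combination m w τ N
  simp_rw [h] at h1
  rw [h1] at h2
  exact mul_right_cancel₀ (e_ne_zero _) h2

lemma theta_neg_right (m : ℕ) (r : ZMod (2 * m)) (τ : ℍ) (z : ℂ) :
    theta m r τ (-z) = theta m (-r) τ z := by
  rw [theta_eq_tsum, theta_eq_tsum]
  let E : {n : ℤ // (n : ZMod (2 * m)) = r} ≃ {n : ℤ // (n : ZMod (2 * m)) = -r} :=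
    (Equiv.neg ℤ).subtypeEquiv fun n => by simp [neg_inj]
  rw [← E.tsum_eq]
  refine tsum_congr fun n => ?_
  have : ((E n : {n : ℤ // (n : ZMod (2 * m)) = -r}) : ℤ) = -(n : ℤ) := rfl
  rw [this, thetaTerm, thetaTerm]
  congr 1; push_cast; ring

/-- Translation of `θ_{m,r}` by the torsion point `(aτ + b)/n`, where `m = n·n'` and `r` is
represented by `s`. -/
lemma theta_translate {m n n' : ℕ} [NeZero m] (hm : m = n * n') (s a b : ℤ) (τ : ℍ) (z : ℂ) :
    e (m * ((a : ℂ) ^ 2 / (n : ℂ) ^ 2 * (τ : ℂ) + 2 * ((a : ℂ) / n) * z +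
      (a : ℂ) * b / (n : ℂ) ^ 2)) *
      theta m (s : ZMod (2 * m)) τ (z + (a : ℂ) / n * (τ : ℂ) + (b : ℂ) / n) =
    e ((b * (s + n' * a) : ℤ) / n) * theta m ((s + 2 * (n' * a) : ℤ) : ZMod (2 * m)) τ z := by
  have hm0 : m ≠ 0 := NeZero.ne m
  have hn : (n : ℂ) ≠ 0 := by rintro h; simp_all
  have hn' : (n' : ℂ) ≠ 0 := by rintro h; simp_all
  have hmc : (m : ℂ) = n * n' := by rw [hm]; push_cast; ring
  rw [theta_eq_tsum, theta_eq_tsum, ← tsum_mul_left, ← tsum_mul_left]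
  let E : {N : ℤ // (N : ZMod (2 * m)) = s} ≃
      {N : ℤ // (N : ZMod (2 * m)) = ((s + 2 * (n' * a) : ℤ) : ZMod (2 * m))} :=
    (Equiv.addRight (2 * (n' * a))).subtypeEquiv fun n => by simp
  rw [← E.tsum_eq]
  refine tsum_congr fun N => ?_
  obtain ⟨N, hN⟩ := N
  have hE : ((E ⟨N, hN⟩ : {N : ℤ // (N : ZMod (2 * m)) = _}) : ℤ) = N + 2 * (n' * a) := rfl
  rw [hE, thetaTerm, thetaTerm, ← e_add, ← e_add]
  rw [ZMod.intCast_eq_intCast_iff_dvd_sub] at hN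
  obtain ⟨t, ht⟩ := hN
  have hs : (s : ℂ) = N + 2 * (n * n') * t := by
    have : s = N + (2 * (n * n') : ℕ) * t := by rw [← hm, ← ht]; ring
    rw [this]; push_cast; ring
  refine e_eq_of_sub_eq_intCast (-(2 * n' * t * b)) ?_
  push_cast
  rw [hs, hmc]
  field_simp
  ring

lemma e_div_eq_stdAddChar (m : ℕ) [NeZero m] (n : ℤ) :
    e ((n : ℂ) / (2 * m)) = ZMod.stdAddChar (n : ZMod (2 * m)) := by
  rw [ZMod.stdAddChar_coe, e]
  congr 1; push_cast; ring

lemma hasSum_jacobiTheta₂_shift (m : ℕ) [NeZero m] (s : ℤ) (τ : ℍ) (z : ℂ) :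
    jacobiTheta₂ (z - s / (2 * m)) (τ / (2 * m)) =
      ∑ r : ZMod (2 * m), ZMod.stdAddChar (-(r * (s : ZMod (2 * m)))) * theta m r τ z := by
  refine HasSum.unique (hasSum_jacobiTheta₂_term _ (im_div_pos m τ)) ?_
  convert hasSum_theta_combination m
    (fun r => ZMod.stdAddChar (-(r * (s : ZMod (2 * m))))) τ z using 2 with n
  rw [← thetaTerm_eq_jacobiTheta₂_term]
  rw [show -((n : ZMod (2 * m)) * (s : ZMod (2 * m))) = ((-(n * s) : ℤ) : ZMod (2 * m)) by
    push_cast; ring, ← e_div_eq_stdAddChar, thetaTerm, thetaTerm, ← e_add]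
  congr 1; push_cast; ring

lemma theta_eq_jacobiTheta₂ (m : ℕ) [NeZero m] (s : ℤ) (τ : ℍ) (z : ℂ) :
    theta m (s : ZMod (2 * m)) τ z = e ((s : ℂ) ^ 2 / (4 * m) * (τ : ℂ) + s * z) *
      jacobiTheta₂ (2 * m * z + s * τ) (2 * m * τ) := by
  have hm : (m : ℂ) ≠ 0 := NeZero.ne _
  rw [theta_eq_tsum, jacobiTheta₂, ← tsum_mul_left]
  have h2m : ((2 * m : ℕ) : ℤ) ≠ 0 := by exact_mod_cast NeZero.ne (2 * m)
  let E : ℤ ≃ {N : ℤ // (N : ZMod (2 * m)) = s} :=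
    { toFun := fun l => ⟨s + (2 * m : ℕ) * l, by
        rw [Int.cast_add, Int.cast_mul, Int.cast_natCast, ZMod.natCast_self]; simp⟩
      invFun := fun N => (N - s) / (2 * m : ℕ)
      left_inv := fun l => by
        change (s + (2 * m : ℕ) * l - s) / (2 * m : ℕ) = l
        rw [add_sub_cancel_left, Int.mul_ediv_cancel_left _ h2m]
      right_inv := fun N => by
        obtain ⟨N, hN⟩ := N
        ext
        change s + (2 * m : ℕ) * ((N - s) / (2 * m : ℕ)) = N
        rw [Int.mul_ediv_cancel' ((ZMod.intCast_eq_intCast_iff_dvd_sub _ _ _).mp hN.symm)]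
        ring }
  rw [← E.tsum_eq]
  refine tsum_congr fun l => ?_
  have hE : ((E l : {N : ℤ // (N : ZMod (2 * m)) = s}) : ℤ) = s + (2 * m : ℕ) * l := rfl
  rw [hE, thetaTerm, jacobiTheta₂_term, e, e, ← Complex.exp_add]
  congr 1
  push_cast
  field_simp
  ring

/-- The behaviour of the theta functions under `τ ↦ -1/τ`. -/
lemma exists_theta_S_smul (m : ℕ) [NeZero m] (τ : ℍ) : ∃ u : ℂ, u ≠ 0 ∧
    ∀ (s : ZMod (2 * m)) (z : ℂ),
      e (-(m * (z ^ 2 / τ))) * theta m s (ModularGroup.S • τ) (z / τ) =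
        u * ∑ r : ZMod (2 * m), ZMod.stdAddChar (-(r * s)) * theta m r τ z := by
  have hm : (m : ℂ) ≠ 0 := NeZero.ne _
  have hτ : (τ : ℂ) ≠ 0 := UpperHalfPlane.ne_zero τ
  set κ : ℂ := (-Complex.I * ((τ : ℂ) / (2 * m))) ^ (1 / 2 : ℂ) with hκ
  have hκ0 : κ ≠ 0 := by
    rw [hκ, Complex.cpow_ne_zero_iff]
    left
    simp [hτ, hm]
  refine ⟨κ, hκ0, fun s z => ?_⟩
  obtain ⟨s, rfl⟩ := ZMod.intCast_surjective s
  rw [← hasSum_jacobiTheta₂_shift, theta_eq_jacobiTheta₂, coe_S_smul]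
  rw [jacobiTheta₂_functional_equation (z - s / (2 * m)) (τ / (2 * m)), ← hκ]
  have h1 : (z - s / (2 * m)) / ((τ : ℂ) / (2 * m)) = 2 * m * (z / τ) + s * (-1 / τ) := by
    field_simp
    ring
  have h2 : -1 / ((τ : ℂ) / (2 * m)) = 2 * m * (-1 / τ) := by field_simp
  rw [h1, h2]
  have h3 : Complex.exp (-Real.pi * Complex.I * (z - s / (2 * m)) ^ 2 / ((τ : ℂ) / (2 * m))) =
      e (-(m * (z ^ 2 / τ))) * e ((s : ℂ) ^ 2 / (4 * m) * (-1 / τ) + s * (z / τ)) := by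
    rw [← e_add, e]
    congr 1
    field_simp
    ring
  rw [h3]
  field_simp

lemma theta_T_smul (m : ℕ) [NeZero m] (s : ℤ) (τ : ℍ) (z : ℂ) :
    theta m (s : ZMod (2 * m)) (ModularGroup.T • τ) z =
      e ((s : ℂ) ^ 2 / (4 * m)) * theta m (s : ZMod (2 * m)) τ z := by
  have hm : (m : ℂ) ≠ 0 := NeZero.ne _
  rw [theta_eq_tsum, theta_eq_tsum, ← tsum_mul_left]
  refine tsum_congr fun N => ?_
  obtain ⟨N, hN⟩ := N
  rw [ZMod.intCast_eq_intCast_iff_dvd_sub] at hN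
  obtain ⟨t, ht⟩ := hN
  have hs : (s : ℂ) = N + 2 * m * t := by
    have : s = N + (2 * m : ℕ) * t := by rw [← ht]; ring
    rw [this]; push_cast; ring
  rw [thetaTerm, thetaTerm, coe_T_smul, ← e_add]
  refine e_eq_of_sub_eq_intCast (-(t * N + m * t ^ 2)) ?_
  rw [hs]
  push_cast
  field_simp
  ring

/-! ### The theta coefficients of a Jacobi form -/

lemma thetaSum_eq (m : ℕ) [NeZero m] (h : ZMod (2 * m) → ℍ → ℂ)
    (Ω : Matrix (ZMod (2 * m)) (ZMod (2 * m)) ℂ) (τ : ℍ) (z : ℂ) :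
    thetaSum m h Ω τ z = ∑ r' : ZMod (2 * m), (∑ r, h r τ * Ω r r') * theta m r' τ z := by
  simp_rw [thetaSum, Finset.sum_mul]
  exact Finset.sum_comm

lemma thetaSum_one (m : ℕ) [NeZero m] (h : ZMod (2 * m) → ℍ → ℂ) (τ : ℍ) (z : ℂ) :
    thetaSum m h 1 τ z = ∑ r : ZMod (2 * m), h r τ * theta m r τ z := by
  rw [thetaSum_eq]
  simp [Matrix.one_apply]

lemma thetaSum_eq_thetaSum_one (m : ℕ) [NeZero m] (h : ZMod (2 * m) → ℍ → ℂ)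
    (Ω : Matrix (ZMod (2 * m)) (ZMod (2 * m)) ℂ) :
    thetaSum m h Ω = thetaSum m (fun r' τ => ∑ r, h r τ * Ω r r') 1 := by
  ext τ z
  rw [thetaSum_eq, thetaSum_one]

/-- The theta coefficients of a Jacobi form of odd weight are odd. -/
lemma coeff_neg {m : ℕ} [NeZero m] {k : ℤ} (hk : Odd k) {h : ZMod (2 * m) → ℍ → ℂ}
    (hJ : IsJacobiForm k m (thetaSum m h 1)) (r : ZMod (2 * m)) (τ : ℍ) : h (-r) τ = -h r τ := by
  have := theta_linearIndependent m (v := fun r => h (-r) τ) (w := fun r => -h r τ) (τ := τ) (by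
    intro z
    have := hJ.neg_right hk τ z
    rw [thetaSum_one, thetaSum_one] at this
    simp_rw [theta_neg_right] at this
    simp_rw [neg_mul, Finset.sum_neg_distrib, ← this]
    exact Fintype.sum_equiv (Equiv.neg _) _ _ fun r => by simp)
  exact congrFun this r

/-- The theta coefficients of a Jacobi form transform under `T` by the quadratic character
`r ↦ e(-r²/4m)`. -/
lemma coeff_T_smul {m : ℕ} [NeZero m] {k : ℤ} {h : ZMod (2 * m) → ℍ → ℂ}
    (hJ : IsJacobiForm k m (thetaSum m h 1)) (s : ℤ) (τ : ℍ) :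
    h s (ModularGroup.T • τ) * e ((s : ℂ) ^ 2 / (4 * m)) = h s τ := by
  have hval : ∀ r : ZMod (2 * m), (((r.val : ℤ)) : ZMod (2 * m)) = r := by simp
  have := theta_linearIndependent m
    (v := fun r => h r (ModularGroup.T • τ) * e (((r.val : ℤ) : ℂ) ^ 2 / (4 * m)))
    (w := fun r => h r τ) (τ := τ) (by
    intro z
    have := hJ.T_smul τ z
    rw [thetaSum_one, thetaSum_one] at this
    rw [← this]
    refine Finset.sum_congr rfl fun r _ => ?_
    have h1 := theta_T_smul m (r.val : ℤ) τ z
    rw [hval] at h1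
    rw [h1]; ring)
  rw [← congrFun this s]
  have hm : (m : ℂ) ≠ 0 := NeZero.ne _
  congr 1
  obtain ⟨t, ht⟩ := (ZMod.intCast_eq_intCast_iff_dvd_sub s ((s : ZMod (2 * m)).val : ℤ) (2 * m)).mp
    (hval s).symm
  have hs : (((s : ZMod (2 * m)).val : ℤ) : ℂ) = s + 2 * m * t := by
    have : ((s : ZMod (2 * m)).val : ℤ) = s + (2 * m : ℕ) * t := by rw [← ht]; ring
    rw [this]; push_cast; ring
  refine e_eq_of_sub_eq_intCast (-(t * s + m * t ^ 2)) ?_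
  rw [hs]
  push_cast
  field_simp
  ring

/-- The theta coefficients of a Jacobi form transform under `S` by the finite Fourier transform, up
to a factor that does not depend on the form. -/
lemma coeff_S_smul {m : ℕ} [NeZero m] (k : ℤ) (τ : ℍ) : ∃ u : ℂ, u ≠ 0 ∧
    ∀ h : ZMod (2 * m) → ℍ → ℂ, IsJacobiForm k m (thetaSum m h 1) → ∀ r,
      h r τ = u * ∑ s : ZMod (2 * m), h s (ModularGroup.S • τ) * ZMod.stdAddChar (-(r * s)) := by
  obtain ⟨u, hu, H⟩ := exists_theta_S_smul m τ
  have hτ : (τ : ℂ) ≠ 0 := UpperHalfPlane.ne_zero τ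
  refine ⟨(τ : ℂ)⁻¹ ^ k * u, mul_ne_zero (zpow_ne_zero _ (inv_ne_zero hτ)) hu, fun h hJ r => ?_⟩
  have := theta_linearIndependent m (w := fun r => (τ : ℂ)⁻¹ ^ k * u *
      ∑ s : ZMod (2 * m), h s (ModularGroup.S • τ) * ZMod.stdAddChar (-(r * s)))
    (v := fun r => h r τ) (τ := τ) (by
    intro z
    have := hJ.S_smul τ z
    rw [thetaSum_one, thetaSum_one] at this
    rw [← this, Finset.mul_sum]
    have h1 : ∀ s, e (-(m * (z ^ 2 / τ))) * (τ : ℂ)⁻¹ ^ k *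
        (h s (ModularGroup.S • τ) * theta m s (ModularGroup.S • τ) (z / τ)) =
        ∑ r : ZMod (2 * m), (τ : ℂ)⁻¹ ^ k * u * (h s (ModularGroup.S • τ) *
          ZMod.stdAddChar (-(r * s))) * theta m r τ z := by
      intro s
      calc _ = (τ : ℂ)⁻¹ ^ k * h s (ModularGroup.S • τ) *
            (e (-(m * (z ^ 2 / τ))) * theta m s (ModularGroup.S • τ) (z / τ)) := by ring
        _ = _ := by
          rw [H, Finset.mul_sum, Finset.mul_sum]
          exact Finset.sum_congr rfl fun r _ => by ring
    simp_rw [h1]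
    rw [Finset.sum_comm]
    refine Finset.sum_congr rfl fun r _ => ?_
    rw [Finset.mul_sum, Finset.sum_mul])
  exact congrFun this r

/-! ### The Eichler–Zagier operators -/

lemma dvd_val_intCast {d N : ℕ} [NeZero N] (h : d ∣ N) (y : ℤ) :
    d ∣ ((y : ZMod N)).val ↔ (d : ℤ) ∣ y := by
  rw [← Int.natCast_dvd_natCast, ZMod.val_intCast]
  exact EuclideanDomain.dvd_mod_iff (by exact_mod_cast h)

lemma sum_e_eq_ite (n : ℕ) [NeZero n] (t : ℤ) :
    ∑ b ∈ Finset.range n, e (((b : ℤ) * t : ℤ) / n) = if (n : ℤ) ∣ t then (n : ℂ) else 0 := by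
  have hn : (n : ℂ) ≠ 0 := NeZero.ne _
  have h1 : ∀ b : ℕ, e (((b : ℤ) * t : ℤ) / n) = e (t / n) ^ b := by
    intro b; rw [← e_nat_mul]; congr 1; push_cast; ring
  simp_rw [h1]
  split_ifs with h
  · obtain ⟨c, rfl⟩ := h
    have : e (((n * c : ℤ) : ℂ) / n) = 1 := by
      rw [show (((n * c : ℤ) : ℂ) / n) = (c : ℤ) by push_cast; field_simp, e_intCast]
    simp_rw [this]
    simp
  · have hne : e ((t : ℂ) / n) ≠ 1 := by
      intro h1
      apply h
      rw [e, Complex.exp_eq_one_iff] at h1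
      obtain ⟨c, hc⟩ := h1
      have h2 : (2 * Real.pi * Complex.I : ℂ) ≠ 0 := Complex.two_pi_I_ne_zero
      have h3 : (t : ℂ) / n = c := by
        apply mul_left_cancel₀ h2; rw [hc]; ring
      rw [div_eq_iff hn] at h3
      exact ⟨c, by rw [mul_comm]; exact_mod_cast h3⟩
    rw [geom_sum_eq hne, ← e_nat_mul, show (n : ℂ) * (t / n) = (t : ℤ) by field_simp, e_intCast]
    simp

/-- The action of `W_m(n)` on theta functions is given by the matrix `Ω_m(n)`. -/
lemma eichlerZagier_theta {m n : ℕ} [NeZero m] (hnm : n ∣ m) (r : ZMod (2 * m)) (τ : ℍ) (z : ℂ) :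
    eichlerZagier m n (theta m r) τ z = ∑ r' : ZMod (2 * m), omega m n r r' * theta m r' τ z := by
  obtain ⟨n', hm⟩ := hnm
  have hm0 : m ≠ 0 := NeZero.ne m
  have hn0 : n ≠ 0 := by rintro rfl; simp_all
  have hn'0 : n' ≠ 0 := by rintro rfl; simp_all
  have : NeZero n := ⟨hn0⟩
  have hn : (n : ℂ) ≠ 0 := NeZero.ne _
  obtain ⟨s, rfl⟩ := ZMod.intCast_surjective r
  have h1 : ∀ a ∈ Finset.range n, ∑ b ∈ Finset.range n,
      e (m * ((a : ℂ) ^ 2 / (n : ℂ) ^ 2 * (τ : ℂ) + 2 * ((a : ℂ) / n) * z +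
      (a : ℂ) * b / (n : ℂ) ^ 2)) * theta m (s : ZMod (2 * m)) τ
        (z + (a : ℂ) / n * (τ : ℂ) + (b : ℂ) / n) =
      n * if (n : ℤ) ∣ s + n' * a then
        theta m ((s + 2 * (n' * a) : ℤ) : ZMod (2 * m)) τ z else 0 := by
    intro a _
    have h2 := fun b : ℕ => theta_translate hm s a b τ z
    simp only [Int.cast_natCast] at h2
    simp_rw [h2]
    rw [← Finset.sum_mul, sum_e_eq_ite]
    split_ifs <;> simp
  rw [eichlerZagier, Finset.sum_congr rfl h1, ← Finset.mul_sum, ← mul_assoc,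
    one_div_mul_cancel hn, one_mul, ← Finset.sum_filter]
  have h3 : ∀ r' : ZMod (2 * m), omega m n s r' * theta m r' τ z =
      if 2 * n ∣ ((s : ZMod (2 * m)) + r').val ∧ 2 * m / n ∣ ((s : ZMod (2 * m)) - r').val then
        theta m r' τ z else 0 := by
    intro r'; simp [omega]
  have hdiv : 2 * m / n = 2 * n' := by
    rw [hm, show 2 * (n * n') = n * (2 * n') by ring, Nat.mul_div_cancel_left _ (NeZero.pos n)]
  simp_rw [h3]
  rw [← Finset.sum_filter, hdiv]
  have hd1 : 2 * n ∣ 2 * m := ⟨n', by rw [hm]; ring⟩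
  have hd2 : 2 * n' ∣ 2 * m := ⟨n, by rw [hm]; ring⟩
  have hn'z : (n' : ℤ) ≠ 0 := by exact_mod_cast hn'0
  refine Finset.sum_bij (fun a _ => ((s + 2 * (n' * a) : ℤ) : ZMod (2 * m))) ?_ ?_ ?_ ?_
  · intro a ha
    rw [Finset.mem_filter] at ha
    rw [Finset.mem_filter]
    refine ⟨Finset.mem_univ _, ?_, ?_⟩
    · rw [← Int.cast_add, dvd_val_intCast hd1]
      obtain ⟨c, hc⟩ := ha.2
      exact ⟨c, by push_cast; linear_combination 2 * hc⟩
    · rw [← Int.cast_sub, dvd_val_intCast hd2]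
      exact ⟨-a, by push_cast; ring⟩
  · intro a ha b hb hab
    rw [Finset.mem_filter, Finset.mem_range] at ha hb
    rw [ZMod.intCast_eq_intCast_iff_dvd_sub] at hab
    obtain ⟨c, hc⟩ := hab
    have h4 : (b : ℤ) - a = n * c := by
      rw [hm] at hc
      push_cast at hc
      have : 2 * (n' : ℤ) * ((b : ℤ) - a) = 2 * n' * (n * c) := by linear_combination hc
      exact mul_left_cancel₀ (by simpa using hn'z) this
    have h5 : (n : ℤ) ∣ (b : ℤ) - a := ⟨c, h4⟩
    have := Int.eq_zero_of_abs_lt_dvd h5 (by rw [abs_lt]; constructor <;> omega)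
    omega
  · intro r' hr'
    rw [Finset.mem_filter] at hr'
    obtain ⟨_, hA, hB⟩ := hr'
    obtain ⟨t, rfl⟩ := ZMod.intCast_surjective r'
    rw [← Int.cast_add, dvd_val_intCast hd1] at hA
    rw [← Int.cast_sub, dvd_val_intCast hd2] at hB
    obtain ⟨c, hc⟩ := hA
    obtain ⟨d, hd⟩ := hB
    push_cast at hc hd
    have hnz : (n : ℤ) ≠ 0 := by exact_mod_cast hn0
    have hnn := Int.emod_nonneg (-d) hnz
    have hlt := Int.emod_lt_of_pos (-d) (by positivity : (0 : ℤ) < n)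
    have hdm := Int.emod_add_mul_ediv (-d) n
    set a := (-d) % (n : ℤ) with ha
    have hcast : ((a.toNat : ℕ) : ℤ) = a := Int.toNat_of_nonneg hnn
    refine ⟨a.toNat, ?_, ?_⟩
    · rw [Finset.mem_filter, Finset.mem_range]
      refine ⟨by omega, ?_⟩
      rw [hcast]
      refine ⟨c - n' * ((-d) / n), ?_⟩
      have : 2 * (s + n' * a) = 2 * ((n : ℤ) * (c - n' * ((-d) / n))) := by
        linear_combination hc + hd + 2 * (n' : ℤ) * hdm
      exact mul_left_cancel₀ two_ne_zero this
    · rw [ZMod.intCast_eq_intCast_iff_dvd_sub, hcast]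
      refine ⟨(-d) / n, ?_⟩
      rw [hm]; push_cast
      linear_combination (-1) * hd - 2 * (n' : ℤ) * hdm
  · intros; rfl

lemma eichlerZagier_sum {ι : Type*} (S : Finset ι) (m n : ℕ) (c : ι → ℍ → ℂ)
    (f : ι → ℍ → ℂ → ℂ) (τ : ℍ) (z : ℂ) :
    eichlerZagier m n (fun τ z => ∑ i ∈ S, c i τ * f i τ z) τ z =
      ∑ i ∈ S, c i τ * eichlerZagier m n (f i) τ z := by
  simp only [eichlerZagier, Finset.mul_sum]
  conv_rhs => rw [Finset.sum_comm]
  refine Finset.sum_congr rfl fun a _ => ?_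
  rw [Finset.sum_comm]
  exact Finset.sum_congr rfl fun i _ => Finset.sum_congr rfl fun b _ => by ring

/-- Linear extension of `eichlerZagier_theta`: `Ω_m(n)` acts on Jacobi forms as `W_m(n)`. -/
lemma thetaSum_omega {m n : ℕ} [NeZero m] (hnm : n ∣ m) (h : ZMod (2 * m) → ℍ → ℂ) :
    thetaSum m h (omega m n) = eichlerZagier m n (thetaSum m h 1) := by
  ext τ z
  have : thetaSum m h 1 = fun τ z => ∑ r : ZMod (2 * m), h r τ * theta m r τ z := by
    ext τ z; exact thetaSum_one m h τ z
  rw [this, eichlerZagier_sum, thetaSum]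
  refine Finset.sum_congr rfl fun r _ => ?_
  rw [eichlerZagier_theta hnm, Finset.mul_sum]
  exact Finset.sum_congr rfl fun r' _ => by ring

/-- The translate of `φ` by the point `(aτ + b)/n`, with the factor that occurs in `W_m(n)`. -/
def torsionTranslate (m n : ℕ) (a b : ℤ) (φ : ℍ → ℂ → ℂ) (τ : ℍ) (z : ℂ) : ℂ :=
  e (m * ((a : ℂ) ^ 2 / (n : ℂ) ^ 2 * (τ : ℂ) + 2 * ((a : ℂ) / n) * z +
      (a : ℂ) * b / (n : ℂ) ^ 2)) * φ τ (z + (a : ℂ) / n * (τ : ℂ) + (b : ℂ) / n)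

lemma torsionTranslate_add {k : ℤ} {m n n' : ℕ} (hm : m = n * n') (hn0 : n ≠ 0)
    {φ : ℍ → ℂ → ℂ} (hφ : IsJacobiForm k m φ) (a b l u : ℤ) (τ : ℍ) (z : ℂ) :
    torsionTranslate m n (a + n * l) (b + n * u) φ τ z = torsionTranslate m n a b φ τ z := by
  have hn : (n : ℂ) ≠ 0 := Nat.cast_ne_zero.mpr hn0
  rw [torsionTranslate, torsionTranslate,
    ← hφ.elliptic l u τ (z + (a : ℂ) / n * (τ : ℂ) + (b : ℂ) / n), ← mul_assoc, ← e_add]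
  congr 1
  · refine e_eq_of_sub_eq_intCast (n' * (a * u - l * b) + m * l * u) ?_
    have hmc : (m : ℂ) = n * n' := by rw [hm]; push_cast; ring
    push_cast
    rw [hmc]
    field_simp
    ring
  · congr 1
    push_cast
    field_simp
    ring

lemma torsionTranslate_congr {k : ℤ} {m n : ℕ} [NeZero n] (hnm : n ∣ m)
    {φ : ℍ → ℂ → ℂ} (hφ : IsJacobiForm k m φ) {a b a' b' : ℤ}
    (ha : (a : ZMod n) = a') (hb : (b : ZMod n) = b') :
    torsionTranslate m n a b φ = torsionTranslate m n a' b' φ := by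
  obtain ⟨n', hm⟩ := hnm
  obtain ⟨l, hl⟩ := (ZMod.intCast_eq_intCast_iff_dvd_sub _ _ _).mp ha
  obtain ⟨u, hu⟩ := (ZMod.intCast_eq_intCast_iff_dvd_sub _ _ _).mp hb
  obtain rfl : a' = a + n * l := by omega
  obtain rfl : b' = b + n * u := by omega
  ext τ z
  exact (torsionTranslate_add hm (NeZero.ne n) hφ a b l u τ z).symm

lemma torsionTranslate_elliptic {k : ℤ} {m n : ℕ} [NeZero n] (hnm : n ∣ m)
    {φ : ℍ → ℂ → ℂ} (hφ : IsJacobiForm k m φ) (a b l u : ℤ) (τ : ℍ) (z : ℂ) :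
    e (m * (l ^ 2 * (τ : ℂ) + 2 * l * z)) * torsionTranslate m n a b φ τ (z + l * (τ : ℂ) + u) =
      torsionTranslate m n a b φ τ z := by
  obtain ⟨n', hm⟩ := hnm
  have hn : (n : ℂ) ≠ 0 := NeZero.ne _
  rw [torsionTranslate, torsionTranslate,
    ← hφ.elliptic l u τ (z + (a : ℂ) / n * (τ : ℂ) + (b : ℂ) / n), ← mul_assoc, ← mul_assoc,
    ← e_add, ← e_add]
  congr 1
  · refine e_eq_of_sub_eq_intCast (2 * n' * (a * u - l * b)) ?_
    have hmc : (m : ℂ) = n * n' := by rw [hm]; push_cast; ring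
    push_cast
    rw [hmc]
    field_simp
    ring
  · congr 1
    ring

/-- `SL₂(ℤ)` permutes the torsion translates of a Jacobi form. -/
lemma torsionTranslate_modular {k : ℤ} {m n : ℕ} [NeZero n]
    {φ : ℍ → ℂ → ℂ} (hφ : IsJacobiForm k m φ) (a b : ℤ) (γ : SL(2, ℤ)) (τ : ℍ) (z : ℂ) :
    jacobiSlash k m γ (torsionTranslate m n a b φ) τ z =
      torsionTranslate m n (a * γ 0 0 + b * γ 1 0) (a * γ 0 1 + b * γ 1 1) φ τ z := by
  have hn : (n : ℂ) ≠ 0 := NeZero.ne _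
  have hj := autFactor_ne_zero γ τ
  have hdet := det_eq_one_complex γ
  have hjd : autFactor γ τ = ((γ 1 0 : ℤ) : ℂ) * (τ : ℂ) + ((γ 1 1 : ℤ) : ℂ) := rfl
  rw [torsionTranslate, ← hφ.modular γ τ, jacobiSlash, torsionTranslate]
  change _ = _ * (e (-((m : ℂ) * (((γ 1 0 : ℤ) : ℂ) * _ ^ 2 / autFactor γ τ))) *
    (autFactor γ τ)⁻¹ ^ k * φ _ (_ / autFactor γ τ))
  rw [coe_smul_eq]
  push_cast
  generalize ((γ 0 0 : ℤ) : ℂ) = A at *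
  generalize ((γ 0 1 : ℤ) : ℂ) = B at *
  generalize ((γ 1 0 : ℤ) : ℂ) = C at *
  generalize ((γ 1 1 : ℤ) : ℂ) = D at *
  generalize autFactor γ τ = j at *
  have key : ∀ p q : ℂ, -(C * z ^ 2 / j) + (p ^ 2 * ((A * τ + B) / j) + 2 * p * (z / j) + p * q) =
      ((p * A + q * C) ^ 2 * τ + 2 * (p * A + q * C) * z + (p * A + q * C) * (p * B + q * D)) -
        C * (z + (p * A + q * C) * τ + (p * B + q * D)) ^ 2 / j := by
    intro p q
    have h1 : (p * A + q * C) * j = p + C * (p * (A * τ + B) + q * j) := by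
      rw [hjd]; linear_combination p * hdet
    field_simp
    have h2 : (p * A + q * C) * τ + (p * B + q * D) = p * (A * τ + B) + q * j := by
      rw [hjd]; ring
    linear_combination (-((p * A + q * C) * τ + (p * B + q * D) + 2 * z)) * h1 +
      (C * ((p * A + q * C) * τ + (p * B + q * D) + 2 * z) - p) * h2
  have k1 : φ (γ • τ) (z / j + a / n * ((A * τ + B) / j) + b / n) =
      φ (γ • τ) ((z + (a * A + b * C) / n * τ + (a * B + b * D) / n) / j) := by
    congr 1
    field_simp
    rw [hjd]; ring
  have k2 : e (-(m * (C * z ^ 2 / j))) * e (m * ((a : ℂ) ^ 2 / (n : ℂ) ^ 2 * ((A * τ + B) / j) +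
        2 * ((a : ℂ) / n) * (z / j) + a * b / (n : ℂ) ^ 2)) =
      e (m * ((a * A + b * C) ^ 2 / (n : ℂ) ^ 2 * τ + 2 * ((a * A + b * C) / n) * z +
        (a * A + b * C) * (a * B + b * D) / (n : ℂ) ^ 2)) *
      e (-(m * (C * (z + (a * A + b * C) / n * τ + (a * B + b * D) / n) ^ 2 / j))) := by
    rw [← e_add, ← e_add]
    congr 1
    have e1 : (a * A + b * C) / (n : ℂ) = a / n * A + b / n * C := by ring
    have e2 : (a * B + b * D) / (n : ℂ) = a / n * B + b / n * D := by ring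
    rw [e1, e2]
    have := key (a / n) (b / n)
    linear_combination (m : ℂ) * this
  rw [k1]
  linear_combination (j⁻¹ ^ k * φ (γ • τ) ((z + (a * A + b * C) / n * τ +
    (a * B + b * D) / n) / j)) * k2

lemma eichlerZagier_eq_sum_zmod (m n : ℕ) [NeZero n] (φ : ℍ → ℂ → ℂ) (τ : ℍ) (z : ℂ) :
    eichlerZagier m n φ τ z =
      1 / n * ∑ p : ZMod n × ZMod n, torsionTranslate m n p.1.val p.2.val φ τ z := by
  rw [eichlerZagier, ← Finset.sum_product']
  congr 1
  refine Finset.sum_bij' (fun p _ => ((p.1 : ZMod n), (p.2 : ZMod n)))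
    (fun p _ => (p.1.val, p.2.val)) (fun _ _ => Finset.mem_univ _)
    (fun p _ => by simp [ZMod.val_lt]) ?_ (fun p _ => by simp) ?_
  · intro p hp
    simp only [Finset.mem_product, Finset.mem_range] at hp
    ext <;> simp [Nat.mod_eq_of_lt, hp.1, hp.2]
  · intro p hp
    simp only [Finset.mem_product, Finset.mem_range] at hp
    rw [ZMod.val_cast_of_lt hp.1, ZMod.val_cast_of_lt hp.2]
    simp [torsionTranslate]

/-- The right action of `SL₂(ℤ)` on pairs of residues modulo `n`. -/
def torsionEquiv (n : ℕ) (γ : SL(2, ℤ)) : ZMod n × ZMod n ≃ ZMod n × ZMod n where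
  toFun p := (p.1 * (γ 0 0 : ℤ) + p.2 * (γ 1 0 : ℤ), p.1 * (γ 0 1 : ℤ) + p.2 * (γ 1 1 : ℤ))
  invFun p := (p.1 * (γ 1 1 : ℤ) - p.2 * (γ 1 0 : ℤ), -p.1 * (γ 0 1 : ℤ) + p.2 * (γ 0 0 : ℤ))
  left_inv p := by
    have h := Matrix.det_fin_two γ.1
    rw [γ.2] at h
    have h' : (1 : ZMod n) = (γ 0 0 : ℤ) * (γ 1 1 : ℤ) - (γ 0 1 : ℤ) * (γ 1 0 : ℤ) := by
      exact_mod_cast congrArg (Int.cast : ℤ → ZMod n) h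
    ext
    · dsimp only; linear_combination (-p.1) * h'
    · dsimp only; linear_combination (-p.2) * h'
  right_inv p := by
    have h := Matrix.det_fin_two γ.1
    rw [γ.2] at h
    have h' : (1 : ZMod n) = (γ 0 0 : ℤ) * (γ 1 1 : ℤ) - (γ 0 1 : ℤ) * (γ 1 0 : ℤ) := by
      exact_mod_cast congrArg (Int.cast : ℤ → ZMod n) h
    ext
    · dsimp only; linear_combination (-p.1) * h'
    · dsimp only; linear_combination (-p.2) * h'

/-- `W_m(n)` maps Jacobi forms of index `m` to Jacobi forms of the same weight and index. -/
lemma IsJacobiForm.eichlerZagier {k : ℤ} {m n : ℕ} [NeZero m] (hnm : n ∣ m) {φ : ℍ → ℂ → ℂ}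
    (hφ : IsJacobiForm k m φ) : IsJacobiForm k m (eichlerZagier m n φ) := by
  have : NeZero n := ⟨by rintro rfl; exact NeZero.ne m (zero_dvd_iff.mp hnm)⟩
  have hfun : JacobiADE.eichlerZagier m n φ = fun τ z =>
      1 / n * ∑ p : ZMod n × ZMod n, torsionTranslate m n p.1.val p.2.val φ τ z := by
    ext τ z; exact eichlerZagier_eq_sum_zmod m n φ τ z
  constructor
  · unfold JacobiADE.eichlerZagier
    refine DifferentiableOn.const_mul (DifferentiableOn.fun_sum fun a _ =>
      DifferentiableOn.fun_sum fun b _ => ?_) _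
    have hcoe : ∀ p ∈ {p : ℂ × ℂ | 0 < p.1.im}, ((UpperHalfPlane.ofComplex p.1 : ℍ) : ℂ) = p.1 :=
      fun p hp => UpperHalfPlane.ofComplex_apply_of_im_pos hp ▸ rfl
    have h2 : DifferentiableOn ℂ (fun p : ℂ × ℂ => e (m * ((a : ℂ) ^ 2 / (n : ℂ) ^ 2 * p.1 +
        2 * ((a : ℂ) / n) * p.2 + (a : ℂ) * b / (n : ℂ) ^ 2)) *
        φ (UpperHalfPlane.ofComplex p.1) (p.2 + (a : ℂ) / n * p.1 + (b : ℂ) / n))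
        {p : ℂ × ℂ | 0 < p.1.im} := by
      refine DifferentiableOn.mul (by fun_prop) ?_
      exact hφ.holomorphic.comp (f := fun p : ℂ × ℂ =>
        (p.1, p.2 + (a : ℂ) / n * p.1 + (b : ℂ) / n)) (by fun_prop) fun p hp => hp
    refine h2.congr fun p hp => ?_
    rw [hcoe p hp]
  · intro γ τ z
    rw [hfun]
    have hsum : ∀ p : ZMod n × ZMod n,
        jacobiSlash k m γ (torsionTranslate m n p.1.val p.2.val φ) τ z =
          torsionTranslate m n ((torsionEquiv n γ p).1.val) ((torsionEquiv n γ p).2.val) φ τ z := by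
      intro p
      rw [torsionTranslate_modular hφ]
      refine congrFun (congrFun (torsionTranslate_congr hnm hφ ?_ ?_) τ) z <;>
        simp [torsionEquiv]
    beta_reduce
    rw [← Equiv.sum_comp (torsionEquiv n γ) fun p => torsionTranslate m n p.1.val p.2.val φ τ z,
      ← Finset.sum_congr rfl fun p _ => hsum p]
    simp only [jacobiSlash, autFactor, ← Finset.mul_sum]
    ring
  · intro l u τ z
    rw [hfun]
    simp only [← torsionTranslate_elliptic hnm hφ _ _ l u τ z, ← Finset.mul_sum]
    ring

/-! ### The theta decomposition -/

/-- The integral of an entire function of period `1` over a period does not depend on the line. -/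
lemma integral_shift_of_periodic {g : ℂ → ℂ} (hg : Differentiable ℂ g) (hp : ∀ z, g (z + 1) = g z)
    (w : ℂ) : ∫ x in (0 : ℝ)..1, g (x + w) = ∫ x in (0 : ℝ)..1, g x := by
  have hre : ∀ (w : ℂ) (t : ℝ),
      ∫ x in (0 : ℝ)..1, g (x + (w + t)) = ∫ x in (0 : ℝ)..1, g (x + w) := by
    intro w t
    have hper : Function.Periodic (fun x : ℝ => g (x + w)) 1 := by
      intro x
      change g (((x + 1 : ℝ) : ℂ) + w) = g (x + w)
      rw [← hp (x + w)]; congr 1; push_cast; ring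
    have h1 := hper.intervalIntegral_add_eq t 0
    have h2 := intervalIntegral.integral_comp_add_right (a := 0) (b := 1)
      (fun x : ℝ => g (x + w)) t
    rw [zero_add] at h1 h2
    rw [← h1, add_comm t 1, ← h2]
    refine intervalIntegral.integral_congr fun x _ => ?_
    congr 1; push_cast; ring
  have him : ∀ y : ℝ, ∫ x in (0 : ℝ)..1, g (x + y * Complex.I) = ∫ x in (0 : ℝ)..1, g x := by
    intro y
    have h := Complex.integral_boundary_rect_eq_zero_of_differentiableOn g 0 (1 + y * Complex.I)
      hg.differentiableOn
    have h1 : ∀ t : ℝ, g (1 + t * Complex.I) = g (t * Complex.I) := by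
      intro t; rw [add_comm, hp]
    simp [h1] at h
    exact (sub_eq_zero.mp h).symm
  have := hre (w.im * Complex.I) w.re
  rw [him] at this
  rw [← this]
  congr 1; ext x; congr 2
  rw [add_comm, Complex.re_add_im]

/-- Pointwise convergence of the Fourier series of a continuous function of period `1` with
summable Fourier coefficients. -/
lemma hasSum_fourier_of_summable {f : ℝ → ℂ} (hf : Continuous f) (hp : Function.Periodic f 1)
    (hs : Summable fun n : ℤ => ∫ x in (0 : ℝ)..1, f x * e (-(n * (x : ℂ)))) :
    HasSum (fun n : ℤ => ∫ x in (0 : ℝ)..1, f x * e (-(n * (x : ℂ)))) (f 0) := by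
  let F : C(AddCircle (1 : ℝ), ℂ) := ⟨hp.lift, by
    exact continuous_coinduced_dom.mpr hf⟩
  have hcoef : ∀ n : ℤ, fourierCoeff F n = ∫ x in (0 : ℝ)..1, f x * e (-(n * (x : ℂ))) := by
    intro n
    rw [fourierCoeff_eq_intervalIntegral F n 0]
    simp only [zero_add, div_one, one_smul, fourier_coe_apply, smul_eq_mul]
    refine intervalIntegral.integral_congr fun x _ => ?_
    have : F (x : AddCircle (1 : ℝ)) = f x := hp.lift_coe x
    rw [this, mul_comm, e]
    congr 2
    push_cast; ring
  have hF : Summable (fourierCoeff F) := by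
    rw [funext hcoef]; exact hs
  have := has_pointwise_sum_fourier_series_of_summable hF (0 : ℝ)
  have h0 : F ((0 : ℝ) : AddCircle (1 : ℝ)) = f 0 := hp.lift_coe 0
  rw [h0] at this
  simpa [hcoef] using this

/-- The Fourier coefficients of a Jacobi form in the variable `z`. -/
def jacobiCoeff (φ : ℍ → ℂ → ℂ) (n : ℤ) (τ : ℍ) : ℂ :=
  ∫ x in (0 : ℝ)..1, φ τ x * e (-(n * (x : ℂ)))

lemma IsJacobiForm.differentiable {k : ℤ} {m : ℕ} {φ : ℍ → ℂ → ℂ} (hφ : IsJacobiForm k m φ)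
    (τ : ℍ) : Differentiable ℂ (φ τ) := by
  rw [← differentiableOn_univ]
  have := hφ.holomorphic.comp (f := fun z : ℂ => ((τ : ℂ), z)) (s := Set.univ) (by fun_prop)
    (fun z _ => τ.im_pos)
  refine this.congr fun z _ => ?_
  simp

lemma IsJacobiForm.add_one {k : ℤ} {m : ℕ} {φ : ℍ → ℂ → ℂ} (hφ : IsJacobiForm k m φ)
    (τ : ℍ) (z : ℂ) : φ τ (z + 1) = φ τ z := by
  have := hφ.elliptic 0 1 τ z
  simpa [e_zero] using this

/-- Moving the line of integration to height `Im w`. -/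
lemma jacobiCoeff_shift {k : ℤ} {m : ℕ} {φ : ℍ → ℂ → ℂ} (hφ : IsJacobiForm k m φ) (n : ℤ)
    (τ : ℍ) (w : ℂ) : ∫ x in (0 : ℝ)..1, φ τ (x + w) * e (-(n * (x : ℂ))) =
      e (n * w) * jacobiCoeff φ n τ := by
  have h := integral_shift_of_periodic (g := fun z => φ τ z * e (-(n * z)))
    ((hφ.differentiable τ).mul (differentiable_e.comp (by fun_prop))) (by
      intro z
      rw [hφ.add_one, e_eq_of_sub_eq_intCast (-n)]
      push_cast; ring) w
  rw [jacobiCoeff, ← h, ← intervalIntegral.integral_const_mul]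
  refine intervalIntegral.integral_congr fun x _ => ?_
  rw [show -((n : ℂ) * (x + w)) = -(n * w) + -(n * x) by ring, e_add, e_neg (n * w)]
  have h0 := e_ne_zero (n * w)
  generalize e (n * w) = y at *
  field_simp

/-- Quasi-periodicity under `lτ` relates the Fourier coefficients whose indices differ by a multiple
of `2m`. -/
lemma jacobiCoeff_add {k : ℤ} {m : ℕ} {φ : ℍ → ℂ → ℂ} (hφ : IsJacobiForm k m φ) (n l : ℤ)
    (τ : ℍ) :
    jacobiCoeff φ (n + 2 * m * l) τ = e ((m * l ^ 2 + n * l) * τ) * jacobiCoeff φ n τ := by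
  have h := jacobiCoeff_shift hφ n τ (l * τ)
  have h1 : ∀ x : ℝ, φ τ (x + l * τ) * e (-(n * (x : ℂ))) =
      e (-(m * l ^ 2 * τ)) * (φ τ x * e (-(((n + 2 * m * l : ℤ) : ℂ) * (x : ℂ)))) := by
    intro x
    have h2 := hφ.elliptic l 0 τ x
    rw [Int.cast_zero, add_zero] at h2
    rw [← h2, e_neg, e_neg, e_neg, mul_add]
    push_cast
    rw [show (n + 2 * m * l : ℂ) * x = n * x + m * (2 * l * x) by ring, e_add,  e_add,
      show (m : ℂ) * ((l : ℂ) ^ 2 * τ) = m * l ^ 2 * τ by ring]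
    have h3 := e_ne_zero (m * (2 * l * x))
    have h4 := e_ne_zero (m * l ^ 2 * τ)
    generalize e (m * (2 * l * x)) = y at *
    generalize e (m * l ^ 2 * τ) = y' at *
    field_simp
  simp_rw [h1] at h
  rw [intervalIntegral.integral_const_mul, e_neg] at h
  change (e _)⁻¹ * jacobiCoeff φ (n + 2 * m * l) τ = _ at h
  rw [add_mul, e_add, show (n : ℂ) * l * τ = n * (l * τ) by ring, mul_assoc (e _), ← h]
  have := e_ne_zero (m * l ^ 2 * τ)
  field_simp

/-- The theta coefficient `h_r` of a Jacobi form. -/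
def thetaCoeff (m : ℕ) (φ : ℍ → ℂ → ℂ) (r : ZMod (2 * m)) (τ : ℍ) : ℂ :=
  e (-((r.val : ℂ) ^ 2 / (4 * m) * τ)) * jacobiCoeff φ r.val τ

lemma jacobiCoeff_eq {k : ℤ} {m : ℕ} [NeZero m] {φ : ℍ → ℂ → ℂ} (hφ : IsJacobiForm k m φ) (n : ℤ)
    (τ : ℍ) : jacobiCoeff φ n τ =
      thetaCoeff m φ (n : ZMod (2 * m)) τ * e ((n : ℂ) ^ 2 / (4 * m) * (τ : ℂ)) := by
  have hm : (m : ℂ) ≠ 0 := NeZero.ne _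
  obtain ⟨t, ht⟩ := (ZMod.intCast_eq_intCast_iff_dvd_sub ((n : ZMod (2 * m)).val : ℤ) n (2 * m)).mp
    (by simp)
  set s : ℤ := ((n : ZMod (2 * m)).val : ℤ) with hs
  have hn : n = s + 2 * m * t := by push_cast at ht; linarith
  rw [thetaCoeff]
  have hsc : (((n : ZMod (2 * m)).val : ℕ) : ℂ) = (s : ℂ) := by rw [hs]; push_cast; rfl
  rw [hsc, ← hs]
  conv_lhs => rw [hn, jacobiCoeff_add hφ]
  rw [mul_right_comm, ← e_add]
  congr 2
  rw [hn]; push_cast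
  field_simp
  ring

/-- Every Jacobi form of index `m` has a theta decomposition. -/
lemma thetaSum_thetaCoeff {k : ℤ} {m : ℕ} [NeZero m] {φ : ℍ → ℂ → ℂ} (hφ : IsJacobiForm k m φ) :
    thetaSum m (thetaCoeff m φ) 1 = φ := by
  ext τ z
  rw [thetaSum_one]
  have h1 := hasSum_theta_combination m (fun r => thetaCoeff m φ r τ) τ z
  have h2 : ∀ n : ℤ, ∫ x in (0 : ℝ)..1, φ τ (x + z) * e (-(n * (x : ℂ))) =
      thetaCoeff m φ (n : ZMod (2 * m)) τ * thetaTerm m τ z n := by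
    intro n
    rw [jacobiCoeff_shift hφ, jacobiCoeff_eq hφ, thetaTerm_eq]; ring
  have h3 := hasSum_fourier_of_summable (f := fun x => φ τ (x + z))
    ((hφ.differentiable τ).continuous.comp (by fun_prop))
    (fun x => by
      dsimp only
      rw [← hφ.add_one τ (x + z)]; congr 1; push_cast; ring)
    (by simp_rw [h2]; exact h1.summable)
  simp_rw [h2] at h3
  rw [h1.unique h3]; simp

lemma hasExponentialGrowth_thetaCoeff {m : ℕ} {φ : ℍ → ℂ → ℂ}
    (hφ : ∃ A B C : ℝ, ∀ (τ : ℍ) (x : ℝ), B ≤ τ.im → ‖φ τ x‖ ≤ C * Real.exp (A * τ.im)) :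
    HasExponentialGrowth (thetaCoeff m φ) := by
  obtain ⟨A, B, C, H⟩ := hφ
  intro r
  refine ⟨2 * Real.pi * ((r.val : ℝ) ^ 2 / (4 * m)) + A, B, C, fun τ hτ => ?_⟩
  have h1 : ‖jacobiCoeff φ r.val τ‖ ≤ C * Real.exp (A * τ.im) := by
    have := intervalIntegral.norm_integral_le_of_norm_le_const (a := (0 : ℝ)) (b := 1)
      (C := C * Real.exp (A * τ.im))
      (f := fun x : ℝ => φ τ x * e (-(((r.val : ℤ) : ℂ) * (x : ℂ)))) (fun x _ => by
        rw [norm_mul, norm_e]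
        simpa using H τ x hτ)
    simpa [jacobiCoeff] using this
  rw [thetaCoeff, norm_mul, norm_e, add_mul, Real.exp_add]
  have h2 : (-((r.val : ℂ) ^ 2 / (4 * m) * τ)).im = -((r.val : ℝ) ^ 2 / (4 * m) * τ.im) := by
    have : ((r.val : ℂ) ^ 2 / (4 * m)) = (((r.val : ℝ) ^ 2 / (4 * m) : ℝ) : ℂ) := by push_cast; rfl
    rw [this, Complex.neg_im, Complex.im_ofReal_mul]
    rfl
  rw [h2]
  calc _ ≤ Real.exp (-2 * Real.pi * -((r.val : ℝ) ^ 2 / (4 * m) * τ.im)) *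
        (C * Real.exp (A * τ.im)) := by gcongr
    _ = _ := by ring_nf

/-! ### The four Jacobi theta functions -/

/-- The Jacobi theta function `θ₃(τ,z) = ∑ q^{n²/2} y^n`. -/
def jtheta3 (τ : ℍ) (z : ℂ) : ℂ := jacobiTheta₂ z τ

/-- The Jacobi theta function `θ₄(τ,z) = ∑ (-1)^n q^{n²/2} y^n`. -/
def jtheta4 (τ : ℍ) (z : ℂ) : ℂ := jacobiTheta₂ (z + 1 / 2) τ

/-- The Jacobi theta function `θ₂(τ,z) = ∑ q^{(n+1/2)²/2} y^{n+1/2}`. -/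
def jtheta2 (τ : ℍ) (z : ℂ) : ℂ := e (τ / 8 + z / 2) * jacobiTheta₂ (z + τ / 2) τ

/-- The odd Jacobi theta function `∑ (-1)^n q^{(n+1/2)²/2} y^{n+1/2}`, up to a factor `i`. -/
def jtheta1 (τ : ℍ) (z : ℂ) : ℂ := e (τ / 8 + z / 2) * jacobiTheta₂ (z + τ / 2 + 1 / 2) τ

/-- The factor `√(-iτ)` in the transformation formula of the theta functions. -/
def thetaFactor (τ : ℍ) : ℂ := (-Complex.I * (τ : ℂ)) ^ (1 / 2 : ℂ)

lemma thetaFactor_sq (τ : ℍ) : thetaFactor τ ^ 2 = -Complex.I * τ := by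
  rw [thetaFactor, ← Complex.cpow_nat_mul]
  simp

lemma thetaFactor_ne_zero (τ : ℍ) : thetaFactor τ ≠ 0 := by
  intro h
  have := thetaFactor_sq τ
  rw [h] at this
  simp [UpperHalfPlane.ne_zero τ] at this

lemma jacobiTheta₂_S (τ : ℍ) (w : ℂ) : jacobiTheta₂ (w / τ) (-1 / τ) =
    thetaFactor τ * e (w ^ 2 / (2 * τ)) * jacobiTheta₂ w τ := by
  have hτ : (τ : ℂ) ≠ 0 := UpperHalfPlane.ne_zero τ
  rw [jacobiTheta₂_functional_equation w τ, ← thetaFactor]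
  have h1 : Complex.exp (-Real.pi * Complex.I * w ^ 2 / τ) = (e (w ^ 2 / (2 * τ)))⁻¹ := by
    rw [← e_neg, e]; congr 1; field_simp
  rw [h1]
  have := thetaFactor_ne_zero τ
  have := e_ne_zero (w ^ 2 / (2 * τ))
  generalize e (w ^ 2 / (2 * τ)) = y at *
  field_simp

lemma jtheta3_S (τ : ℍ) (z : ℂ) : jtheta3 (ModularGroup.S • τ) (z / τ) =
    thetaFactor τ * e (z ^ 2 / (2 * τ)) * jtheta3 τ z := by
  rw [jtheta3, coe_S_smul, jacobiTheta₂_S, jtheta3]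

lemma jtheta4_S (τ : ℍ) (z : ℂ) : jtheta4 (ModularGroup.S • τ) (z / τ) =
    thetaFactor τ * e (z ^ 2 / (2 * τ)) * jtheta2 τ z := by
  have hτ : (τ : ℂ) ≠ 0 := UpperHalfPlane.ne_zero τ
  have h2 : e ((z + τ / 2) ^ 2 / (2 * τ)) = e (z ^ 2 / (2 * τ)) * e (τ / 8 + z / 2) := by
    rw [← e_add]
    congr 1
    field_simp
    ring
  rw [jtheta4, coe_S_smul, show z / (τ : ℂ) + 1 / 2 = (z + τ / 2) / τ by field_simp,
    jacobiTheta₂_S, jtheta2, h2]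
  ring

lemma jtheta2_S (τ : ℍ) (z : ℂ) : jtheta2 (ModularGroup.S • τ) (z / τ) =
    thetaFactor τ * e (z ^ 2 / (2 * τ)) * jtheta4 τ z := by
  have hτ : (τ : ℂ) ≠ 0 := UpperHalfPlane.ne_zero τ
  have h1 : jacobiTheta₂ (z + 1 / 2) τ = jacobiTheta₂ (z - 1 / 2) τ := by
    rw [← jacobiTheta₂_add_left (z - 1 / 2)]; congr 1; ring
  have h2 : e (-1 / (τ : ℂ) / 8 + z / τ / 2) * e ((z - 1 / 2) ^ 2 / (2 * τ)) =
      e (z ^ 2 / (2 * τ)) := by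
    rw [← e_add]
    congr 1
    field_simp
    ring
  rw [jtheta2, coe_S_smul, show z / (τ : ℂ) + -1 / τ / 2 = (z - 1 / 2) / τ by field_simp; ring,
    jacobiTheta₂_S, jtheta4, h1]
  linear_combination thetaFactor τ * jacobiTheta₂ (z - 1 / 2) τ * h2

lemma e_neg_quarter : e (-(1 / 4)) = -Complex.I := by
  rw [e, show (2 * Real.pi * Complex.I * -(1 / 4) : ℂ) = -(Real.pi / 2 * Complex.I) by ring,
    Complex.exp_neg, Complex.exp_pi_div_two_mul_I, Complex.inv_I]

lemma jtheta1_S (τ : ℍ) (z : ℂ) : jtheta1 (ModularGroup.S • τ) (z / τ) =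
    -Complex.I * thetaFactor τ * e (z ^ 2 / (2 * τ)) * jtheta1 τ z := by
  have hτ : (τ : ℂ) ≠ 0 := UpperHalfPlane.ne_zero τ
  have h1 : jacobiTheta₂ (z + τ / 2 + 1 / 2) τ = jacobiTheta₂ (z + τ / 2 - 1 / 2) τ := by
    rw [← jacobiTheta₂_add_left (z + τ / 2 - 1 / 2)]; congr 1; ring
  have h2 : e (-1 / (τ : ℂ) / 8 + z / τ / 2) * e ((z + τ / 2 - 1 / 2) ^ 2 / (2 * τ)) =
      e (-(1 / 4)) * e (z ^ 2 / (2 * τ)) * e (τ / 8 + z / 2) := by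
    rw [← e_add, ← e_add, ← e_add]
    congr 1
    field_simp
    ring
  rw [jtheta1, coe_S_smul,
    show z / (τ : ℂ) + -1 / τ / 2 + 1 / 2 = (z + τ / 2 - 1 / 2) / τ by field_simp; ring,
    jacobiTheta₂_S, jtheta1, h1, ← e_neg_quarter]
  linear_combination thetaFactor τ * jacobiTheta₂ (z + τ / 2 - 1 / 2) τ * h2

lemma jacobiTheta₂_add_one_right (z τ : ℂ) :
    jacobiTheta₂ z (τ + 1) = jacobiTheta₂ (z + 1 / 2) τ := by
  refine tsum_congr fun n => ?_
  rw [jacobiTheta₂_term, jacobiTheta₂_term]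
  obtain ⟨c, hc⟩ := Int.even_mul_succ_self (n - 1)
  have h : (n : ℂ) ^ 2 = n + 2 * c := by
    have : n ^ 2 = n + 2 * c := by linear_combination hc
    exact_mod_cast this
  have h1 := e_intCast c
  rw [e] at h1
  rw [show 2 * Real.pi * Complex.I * n * z + Real.pi * Complex.I * n ^ 2 * (τ + 1) =
    (2 * Real.pi * Complex.I * n * (z + 1 / 2) + Real.pi * Complex.I * n ^ 2 * τ) +
      2 * Real.pi * Complex.I * c by linear_combination (Real.pi * Complex.I) * h, Complex.exp_add,
    h1, mul_one]

lemma jtheta3_T (τ : ℍ) (z : ℂ) : jtheta3 (ModularGroup.T • τ) z = jtheta4 τ z := by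
  rw [jtheta3, coe_T_smul, jacobiTheta₂_add_one_right, jtheta4]

lemma jtheta4_T (τ : ℍ) (z : ℂ) : jtheta4 (ModularGroup.T • τ) z = jtheta3 τ z := by
  rw [jtheta4, coe_T_smul, jacobiTheta₂_add_one_right, jtheta3, ← jacobiTheta₂_add_left z]
  congr 1; ring

lemma jtheta2_T (τ : ℍ) (z : ℂ) : jtheta2 (ModularGroup.T • τ) z = e (1 / 8) * jtheta2 τ z := by
  rw [jtheta2, coe_T_smul, jacobiTheta₂_add_one_right, jtheta2, ← jacobiTheta₂_add_left (z + τ / 2),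
    ← mul_assoc, ← e_add]
  congr 2 <;> ring

lemma jtheta1_T (τ : ℍ) (z : ℂ) : jtheta1 (ModularGroup.T • τ) z = e (1 / 8) * jtheta1 τ z := by
  rw [jtheta1, coe_T_smul, jacobiTheta₂_add_one_right, jtheta1,
    ← jacobiTheta₂_add_left (z + τ / 2 + 1 / 2), ← mul_assoc, ← e_add]
  congr 2 <;> ring

lemma jtheta3_add_one (τ : ℍ) (z : ℂ) : jtheta3 τ (z + 1) = jtheta3 τ z :=
  jacobiTheta₂_add_left z τ

lemma jtheta4_add_one (τ : ℍ) (z : ℂ) : jtheta4 τ (z + 1) = jtheta4 τ z := by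
  rw [jtheta4, jtheta4, ← jacobiTheta₂_add_left (z + 1 / 2)]; congr 1; ring

lemma jtheta2_add_one (τ : ℍ) (z : ℂ) : jtheta2 τ (z + 1) = -jtheta2 τ z := by
  rw [jtheta2, jtheta2, ← jacobiTheta₂_add_left (z + τ / 2), ← neg_mul, neg_eq_neg_one_mul,
    ← e_half, ← e_add]
  congr 2 <;> ring

lemma jtheta1_add_one (τ : ℍ) (z : ℂ) : jtheta1 τ (z + 1) = -jtheta1 τ z := by
  rw [jtheta1, jtheta1, ← jacobiTheta₂_add_left (z + τ / 2 + 1 / 2), ← neg_mul, neg_eq_neg_one_mul,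
    ← e_half, ← e_add]
  congr 2 <;> ring

lemma jacobiTheta₂_add_tau (τ w : ℂ) :
    jacobiTheta₂ (w + τ) τ = e (-(τ / 2 + w)) * jacobiTheta₂ w τ := by
  rw [jacobiTheta₂_add_left', e]
  congr 2; ring

lemma jtheta3_add_tau (τ : ℍ) (z : ℂ) : e (τ / 2 + z) * jtheta3 τ (z + τ) = jtheta3 τ z := by
  rw [jtheta3, jtheta3, jacobiTheta₂_add_tau, ← mul_assoc, ← e_add, add_neg_cancel, e_zero, one_mul]

lemma jtheta4_add_tau (τ : ℍ) (z : ℂ) : e (τ / 2 + z) * jtheta4 τ (z + τ) = -jtheta4 τ z := by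
  rw [jtheta4, jtheta4, show z + (τ : ℂ) + 1 / 2 = z + 1 / 2 + τ by ring, jacobiTheta₂_add_tau,
    ← mul_assoc, ← e_add, ← neg_one_mul (jacobiTheta₂ _ _), ← e_half]
  congr 1
  refine e_eq_of_sub_eq_intCast (-1) ?_
  push_cast; ring

lemma jtheta2_add_tau (τ : ℍ) (z : ℂ) : e (τ / 2 + z) * jtheta2 τ (z + τ) = jtheta2 τ z := by
  rw [jtheta2, jtheta2, show z + (τ : ℂ) + τ / 2 = z + τ / 2 + τ by ring, jacobiTheta₂_add_tau,
    ← mul_assoc, ← mul_assoc, ← e_add, ← e_add]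
  congr 2; ring

lemma jtheta1_add_tau (τ : ℍ) (z : ℂ) : e (τ / 2 + z) * jtheta1 τ (z + τ) = -jtheta1 τ z := by
  rw [jtheta1, jtheta1, show z + (τ : ℂ) + τ / 2 + 1 / 2 = z + τ / 2 + 1 / 2 + τ by ring,
    jacobiTheta₂_add_tau, ← mul_assoc, ← mul_assoc, ← e_add, ← e_add, ← neg_mul,
    ← neg_one_mul (e (τ / 8 + z / 2)), ← e_half, ← e_add]
  congr 1
  refine e_eq_of_sub_eq_intCast (-1) ?_
  push_cast; ring

lemma coe_ofComplex {p : ℂ × ℂ} (hp : p ∈ {p : ℂ × ℂ | 0 < p.1.im}) :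
    ((UpperHalfPlane.ofComplex p.1 : ℍ) : ℂ) = p.1 :=
  UpperHalfPlane.ofComplex_apply_of_im_pos hp ▸ rfl

lemma differentiableOn_jacobiTheta₂ {f : ℂ × ℂ → ℂ} (hf : Differentiable ℂ f) :
    DifferentiableOn ℂ (fun p : ℂ × ℂ => jacobiTheta₂ (f p) p.1) {p : ℂ × ℂ | 0 < p.1.im} := by
  intro p hp
  have h1 := (hasFDerivAt_jacobiTheta₂ (f p) (τ := p.1) hp).differentiableAt
  exact (DifferentiableAt.comp (f := fun p : ℂ × ℂ => (f p, p.1)) p h1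
    (by fun_prop)).differentiableWithinAt

/-- Joint holomorphy of a function on `ℍ × ℂ`. -/
def IsHolomorphic (φ : ℍ → ℂ → ℂ) : Prop :=
  DifferentiableOn ℂ (fun p : ℂ × ℂ => φ (UpperHalfPlane.ofComplex p.1) p.2) {p : ℂ × ℂ | 0 < p.1.im}

lemma isHolomorphic_jtheta3 {g : ℂ → ℂ} (hg : Differentiable ℂ g) :
    IsHolomorphic fun τ z => jtheta3 τ (g z) := by
  refine (differentiableOn_jacobiTheta₂ (f := fun p => g p.2) (by fun_prop)).congr fun p hp => ?_
  simp only [jtheta3, coe_ofComplex hp]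

lemma isHolomorphic_jtheta4 {g : ℂ → ℂ} (hg : Differentiable ℂ g) :
    IsHolomorphic fun τ z => jtheta4 τ (g z) := by
  refine (differentiableOn_jacobiTheta₂ (f := fun p => g p.2 + 1 / 2) (by fun_prop)).congr
    fun p hp => ?_
  simp only [jtheta4, coe_ofComplex hp]

lemma isHolomorphic_jtheta2 {g : ℂ → ℂ} (hg : Differentiable ℂ g) :
    IsHolomorphic fun τ z => jtheta2 τ (g z) := by
  have h1 : DifferentiableOn ℂ (fun p : ℂ × ℂ => e (p.1 / 8 + g p.2 / 2))
    {p : ℂ × ℂ | 0 < p.1.im} := by fun_prop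
  refine (h1.mul (differentiableOn_jacobiTheta₂ (f := fun p => g p.2 + p.1 / 2)
    (by fun_prop))).congr fun p hp => ?_
  simp only [jtheta2, coe_ofComplex hp, Pi.mul_apply]

lemma isHolomorphic_jtheta1 {g : ℂ → ℂ} (hg : Differentiable ℂ g) :
    IsHolomorphic fun τ z => jtheta1 τ (g z) := by
  have h1 : DifferentiableOn ℂ (fun p : ℂ × ℂ => e (p.1 / 8 + g p.2 / 2))
    {p : ℂ × ℂ | 0 < p.1.im} := by fun_prop
  refine (h1.mul (differentiableOn_jacobiTheta₂ (f := fun p => g p.2 + p.1 / 2 + 1 / 2)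
    (by fun_prop))).congr fun p hp => ?_
  simp only [jtheta1, coe_ofComplex hp, Pi.mul_apply]

/-! ### Some Jacobi forms of small index -/

/-- The product `θ₂θ₃θ₄` of theta constants, a multiple of `η³`. -/
def thetaProd (τ : ℍ) : ℂ := jtheta2 τ 0 * jtheta3 τ 0 * jtheta4 τ 0

lemma thetaProd_S (τ : ℍ) : thetaProd (ModularGroup.S • τ) = thetaFactor τ ^ 3 * thetaProd τ := by
  have h2 := jtheta2_S τ 0
  have h3 := jtheta3_S τ 0
  have h4 := jtheta4_S τ 0
  rw [zero_div, zero_pow two_ne_zero, zero_div, e_zero, mul_one] at h2 h3 h4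
  rw [thetaProd, h2, h3, h4, thetaProd]
  ring

lemma thetaProd_T (τ : ℍ) : thetaProd (ModularGroup.T • τ) = e (1 / 8) * thetaProd τ := by
  rw [thetaProd, jtheta2_T, jtheta3_T, jtheta4_T, thetaProd]
  ring

lemma isHolomorphic_thetaProd : IsHolomorphic fun τ _ => thetaProd τ :=
  ((isHolomorphic_jtheta2 (g := fun _ => 0) (by fun_prop)).mul
    (isHolomorphic_jtheta3 (g := fun _ => 0) (by fun_prop))).mul
    (isHolomorphic_jtheta4 (g := fun _ => 0) (by fun_prop))

lemma I_pow_four_mul (n : ℕ) : Complex.I ^ (4 * n) = 1 := by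
  rw [pow_mul, Complex.I_pow_four, one_pow]

lemma e_eighth_pow : e (1 / 8) ^ 8 = 1 := by
  rw [← e_nat_mul]; norm_num [e_one]

/-- The cusp form of weight `10` and index `1`, up to a constant. -/
def phi10 (τ : ℍ) (z : ℂ) : ℂ := jtheta1 τ z ^ 2 * thetaProd τ ^ 6

lemma isJacobiForm_phi10 : IsJacobiForm 10 1 phi10 := by
  refine .of_generators ?_ ?_ ?_ ?_ ?_
  · exact ((isHolomorphic_jtheta1 differentiable_id).pow 2).mul (isHolomorphic_thetaProd.pow 6)
  · intro τ z
    have hτ : (τ : ℂ) ≠ 0 := UpperHalfPlane.ne_zero τ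
    rw [phi10, jtheta1_S, thetaProd_S, phi10]
    have h1 : e (((1 : ℕ) : ℂ) * (z ^ 2 / τ)) = e (z ^ 2 / (2 * τ)) ^ 2 := by
      rw [← e_nat_mul]; congr 1; push_cast; field_simp
    have h2 : (-Complex.I) ^ 2 * thetaFactor τ ^ 20 = (τ : ℂ) ^ 10 := by
      rw [show 20 = 2 * 10 by norm_num, pow_mul, thetaFactor_sq, mul_pow, ← mul_assoc, ← pow_add,
        neg_pow, show 2 + 10 = 4 * 3 by norm_num, I_pow_four_mul]
      norm_num
    rw [h1, show (τ : ℂ) ^ (10 : ℤ) = (τ : ℂ) ^ 10 by norm_cast, ← h2]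
    ring
  · intro τ z
    rw [phi10, jtheta1_T, thetaProd_T, phi10]
    linear_combination (jtheta1 τ z ^ 2 * thetaProd τ ^ 6) * e_eighth_pow
  · intro τ z
    rw [phi10, jtheta1_add_one, phi10]; ring
  · intro τ z
    have h := jtheta1_add_tau τ z
    have h1 : e (((1 : ℕ) : ℂ) * (τ + 2 * z)) = e (τ / 2 + z) ^ 2 := by
      rw [← e_nat_mul]; congr 1; push_cast; ring
    rw [h1, phi10, ← mul_assoc, ← mul_pow, h, phi10]; ring

/-- The cusp form of weight `11` and index `2`, up to a constant. -/
def phi11 (τ : ℍ) (z : ℂ) : ℂ := jtheta1 τ (2 * z) * thetaProd τ ^ 7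

lemma isJacobiForm_phi11 : IsJacobiForm 11 2 phi11 := by
  refine .of_generators ?_ ?_ ?_ ?_ ?_
  · exact (isHolomorphic_jtheta1 (g := fun z => 2 * z) (by fun_prop)).mul
      (isHolomorphic_thetaProd.pow 7)
  · intro τ z
    have hτ : (τ : ℂ) ≠ 0 := UpperHalfPlane.ne_zero τ
    rw [phi11, show 2 * (z / (τ : ℂ)) = 2 * z / τ by ring, jtheta1_S, thetaProd_S, phi11]
    have h1 : e (((2 : ℕ) : ℂ) * (z ^ 2 / τ)) = e ((2 * z) ^ 2 / (2 * τ)) := by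
      congr 1; push_cast; field_simp
    have h2 : (-Complex.I) * thetaFactor τ ^ 22 = (τ : ℂ) ^ 11 := by
      rw [show 22 = 2 * 11 by norm_num, pow_mul, thetaFactor_sq, mul_pow, ← mul_assoc, ← pow_succ',
        neg_pow, show 11 + 1 = 4 * 3 by norm_num, I_pow_four_mul]
      norm_num
    rw [h1, show (τ : ℂ) ^ (11 : ℤ) = (τ : ℂ) ^ 11 by norm_cast, ← h2]
    ring
  · intro τ z
    rw [phi11, jtheta1_T, thetaProd_T, phi11]
    linear_combination (jtheta1 τ (2 * z) * thetaProd τ ^ 7) * e_eighth_pow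
  · intro τ z
    rw [phi11, show 2 * (z + 1) = 2 * z + 1 + 1 by ring, jtheta1_add_one, jtheta1_add_one, phi11]
    ring
  · intro τ z
    have h := jtheta1_add_tau τ (2 * z)
    have h' := jtheta1_add_tau τ (2 * z + τ)
    have h1 : e (((2 : ℕ) : ℂ) * (τ + 2 * z)) = e (τ / 2 + 2 * z) * e (τ / 2 + (2 * z + τ)) := by
      rw [← e_add]; congr 1; push_cast; ring
    rw [h1, phi11, show 2 * (z + (τ : ℂ)) = 2 * z + τ + τ by ring, phi11]
    linear_combination (e (τ / 2 + 2 * z) * thetaProd τ ^ 7) * h' - thetaProd τ ^ 7 * h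

/-- Twice the Jacobi–Eisenstein series of weight `4` and index `1`. -/
def phi4 (τ : ℍ) (z : ℂ) : ℂ :=
  jtheta2 τ 0 ^ 6 * jtheta2 τ z ^ 2 + jtheta3 τ 0 ^ 6 * jtheta3 τ z ^ 2 +
    jtheta4 τ 0 ^ 6 * jtheta4 τ z ^ 2

lemma isJacobiForm_phi4 : IsJacobiForm 4 1 phi4 := by
  refine .of_generators ?_ ?_ ?_ ?_ ?_
  · exact ((((isHolomorphic_jtheta2 (g := fun _ => 0) (by fun_prop)).pow 6).mul
      ((isHolomorphic_jtheta2 differentiable_id).pow 2)).add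
      (((isHolomorphic_jtheta3 (g := fun _ => 0) (by fun_prop)).pow 6).mul
      ((isHolomorphic_jtheta3 differentiable_id).pow 2))).add
      (((isHolomorphic_jtheta4 (g := fun _ => 0) (by fun_prop)).pow 6).mul
      ((isHolomorphic_jtheta4 differentiable_id).pow 2))
  · intro τ z
    have hτ : (τ : ℂ) ≠ 0 := UpperHalfPlane.ne_zero τ
    have k2 := jtheta2_S τ 0
    have k3 := jtheta3_S τ 0
    have k4 := jtheta4_S τ 0
    rw [zero_div, zero_pow two_ne_zero, zero_div, e_zero, mul_one] at k2 k3 k4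
    rw [phi4, jtheta2_S, jtheta3_S, jtheta4_S, k2, k3, k4, phi4]
    have h1 : e (((1 : ℕ) : ℂ) * (z ^ 2 / τ)) = e (z ^ 2 / (2 * τ)) ^ 2 := by
      rw [← e_nat_mul]; congr 1; push_cast; field_simp
    have h2 : thetaFactor τ ^ 8 = (τ : ℂ) ^ 4 := by
      rw [show 8 = 2 * 4 by norm_num, pow_mul, thetaFactor_sq, mul_pow,
        neg_pow, Complex.I_pow_four]
      norm_num
    rw [h1, show (τ : ℂ) ^ (4 : ℤ) = (τ : ℂ) ^ 4 by norm_cast, ← h2]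
    ring
  · intro τ z
    rw [phi4, jtheta2_T, jtheta2_T, jtheta3_T, jtheta3_T, jtheta4_T, jtheta4_T, phi4]
    linear_combination (jtheta2 τ 0 ^ 6 * jtheta2 τ z ^ 2) * e_eighth_pow
  · intro τ z
    rw [phi4, jtheta2_add_one, jtheta3_add_one, jtheta4_add_one, phi4]; ring
  · intro τ z
    have h2 := jtheta2_add_tau τ z
    have h3 := jtheta3_add_tau τ z
    have h4 := jtheta4_add_tau τ z
    have h1 : e (((1 : ℕ) : ℂ) * (τ + 2 * z)) = e (τ / 2 + z) ^ 2 := by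
      rw [← e_nat_mul]; congr 1; push_cast; ring
    have h4' : (e (τ / 2 + z) * jtheta4 τ (z + τ)) ^ 2 = jtheta4 τ z ^ 2 := by rw [h4]; ring
    rw [h1, phi4, phi4, ← h4', ← h2, ← h3]
    ring

/-! ### Modular forms as Jacobi forms of index zero -/

lemma isJacobiForm_of_modular {w : ℤ} {f : ℍ → ℂ}
    (hf : DifferentiableOn ℂ (f ∘ UpperHalfPlane.ofComplex) {τ | 0 < τ.im})
    (hmod : ∀ (γ : SL(2, ℤ)) (τ : ℍ), f (γ • τ) = autFactor γ τ ^ w * f τ) :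
    IsJacobiForm w 0 fun τ _ => f τ where
  holomorphic := hf.comp (f := fun p : ℂ × ℂ => p.1) (by fun_prop) fun p hp => hp
  modular γ τ z := by
    have h0 := autFactor_ne_zero γ τ
    change _ * (autFactor γ τ)⁻¹ ^ w * f (γ • τ) = _
    rw [hmod, inv_zpow]
    have := zpow_ne_zero w h0
    simp only [CharP.cast_eq_zero, zero_mul, neg_zero, e_zero]
    field_simp
  elliptic l u τ z := by simp [e_zero]

lemma modularForm_smul {w : ℤ} {F : Type*} [FunLike F ℍ ℂ]
    [SlashInvariantFormClass F 𝒮ℒ w] (f : F) (γ : SL(2, ℤ)) (τ : ℍ) :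
    f (γ • τ) = autFactor γ τ ^ w * f τ := by
  have := SlashInvariantForm.slash_action_eqn'' (Γ := 𝒮ℒ) (k := w) f
    (γ := (γ : GL (Fin 2) ℝ)) ⟨γ, rfl⟩ τ
  exact this

lemma isJacobiForm_E {K : ℕ} (hK : 3 ≤ K) : IsJacobiForm K 0 fun τ _ => ModularForm.E hK τ :=
  isJacobiForm_of_modular
    (UpperHalfPlane.mdifferentiable_iff.mp (ModularFormClass.holo (ModularForm.E hK)))
    (modularForm_smul _)

lemma isJacobiForm_discriminant_inv :
    IsJacobiForm (-12) 0 fun τ _ => (ModularForm.discriminant τ)⁻¹ := by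
  refine isJacobiForm_of_modular ?_ ?_
  · have := UpperHalfPlane.mdifferentiable_iff.mp (CuspFormClass.holo CuspForm.discriminant)
    exact this.inv fun τ hτ => ModularForm.discriminant_ne_zero _
  · intro γ τ
    have := modularForm_smul (w := 12) CuspForm.discriminant γ τ
    rw [CuspForm.coe_discriminant] at this
    rw [this, mul_inv, zpow_neg]

lemma tendsto_E_atImInfty {K : ℕ} (hK : 3 ≤ K) (hK2 : Even K) :
    Filter.Tendsto (ModularForm.E hK) UpperHalfPlane.atImInfty (nhds 1) := by
  have h1 : UpperHalfPlane.valueAtInfty (ModularForm.E hK) = 1 := by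
    rw [← EisensteinSeries.E_qExpansion_coeff_zero hK hK2]
    refine (UpperHalfPlane.qExpansion_coeff_zero one_pos ?_ ?_).symm
    · exact ModularFormClass.analyticAt_cuspFunction_zero (ModularForm.E hK) one_pos
        one_mem_strictPeriods_SL
    · exact SlashInvariantFormClass.periodic_comp_ofComplex (ModularForm.E hK)
        one_mem_strictPeriods_SL
  obtain ⟨c, hc, hO⟩ := ModularFormClass.exp_decay_sub_atImInfty' (ModularForm.E hK)
  rw [h1] at hO
  have h2 : Filter.Tendsto (fun τ : ℍ => Real.exp (-c * τ.im)) UpperHalfPlane.atImInfty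
      (nhds 0) := by
    have him : Filter.Tendsto UpperHalfPlane.im UpperHalfPlane.atImInfty Filter.atTop :=
      Filter.tendsto_comap
    refine Real.tendsto_exp_atBot.comp ?_
    exact him.const_mul_atTop_of_neg (by linarith)
  have h3 := (hO.trans_tendsto h2).add_const 1
  simpa using h3

/-- At most exponential growth of `φ(τ,x)` as `Im τ → ∞`, uniformly in `x ∈ ℝ`. -/
def HasExpBound (φ : ℍ → ℂ → ℂ) : Prop :=
  ∃ A B C : ℝ, ∀ (τ : ℍ) (x : ℝ), B ≤ τ.im → ‖φ τ x‖ ≤ C * Real.exp (A * τ.im)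

lemma HasExpBound.mul {φ ψ : ℍ → ℂ → ℂ} (h : HasExpBound φ) (h' : HasExpBound ψ) :
    HasExpBound fun τ z => φ τ z * ψ τ z := by
  obtain ⟨A, B, C, H⟩ := h
  obtain ⟨A', B', C', H'⟩ := h'
  refine ⟨A + A', max B B', C * C', fun τ x hτ => ?_⟩
  have h1 := H τ x ((le_max_left _ _).trans hτ)
  have h2 := H' τ x ((le_max_right _ _).trans hτ)
  rw [norm_mul, add_mul, Real.exp_add]
  calc _ ≤ (C * Real.exp (A * τ.im)) * (C' * Real.exp (A' * τ.im)) :=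
        mul_le_mul h1 h2 (norm_nonneg _) ((norm_nonneg _).trans h1)
    _ = _ := by ring

lemma HasExpBound.pow {φ : ℍ → ℂ → ℂ} (h : HasExpBound φ) (n : ℕ) :
    HasExpBound fun τ z => φ τ z ^ n := by
  induction n with
  | zero => exact ⟨0, 0, 1, by simp⟩
  | succ n ih => simpa only [pow_succ] using ih.mul h

lemma HasExpBound.add {φ ψ : ℍ → ℂ → ℂ} (h : HasExpBound φ) (h' : HasExpBound ψ) :
    HasExpBound fun τ z => φ τ z + ψ τ z := by
  obtain ⟨A, B, C, H⟩ := h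
  obtain ⟨A', B', C', H'⟩ := h'
  refine ⟨max A A', max B B', |C| + |C'|, fun τ x hτ => ?_⟩
  have h1 := H τ x ((le_max_left _ _).trans hτ)
  have h2 := H' τ x ((le_max_right _ _).trans hτ)
  have hy := τ.im_pos.le
  refine (norm_add_le _ _).trans ?_
  rw [add_mul]
  refine add_le_add (h1.trans ?_) (h2.trans ?_)
  · exact mul_le_mul (le_abs_self _) (Real.exp_le_exp.mpr (by gcongr; exact le_max_left _ _))
      (Real.exp_pos _).le (abs_nonneg _)
  · exact mul_le_mul (le_abs_self _) (Real.exp_le_exp.mpr (by gcongr; exact le_max_right _ _))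
      (Real.exp_pos _).le (abs_nonneg _)

lemma exists_bound_of_eventually {P : ℍ → Prop} (h : ∀ᶠ τ in UpperHalfPlane.atImInfty, P τ) :
    ∃ B : ℝ, ∀ τ : ℍ, B ≤ τ.im → P τ :=
  (UpperHalfPlane.atImInfty_mem _).mp h

/-- For every even weight there is a weakly holomorphic modular form for `SL₂(ℤ)` that does not
vanish near the cusp. -/
lemma exists_modular_of_even {w : ℤ} (hw : Even w) : ∃ g : ℍ → ℂ,
    IsJacobiForm w 0 (fun τ _ => g τ) ∧ HasExpBound (fun τ _ => g τ) ∧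
      ∀ᶠ τ in UpperHalfPlane.atImInfty, g τ ≠ 0 := by
  -- `E_K / Δ^a` with `K = w + 12 a`, where `a` is so large that `3 ≤ K`
  set a : ℕ := w.natAbs + 1 with ha
  obtain ⟨K, hK⟩ : ∃ K : ℕ, (K : ℤ) = w + 12 * a := ⟨(w + 12 * a).toNat, by omega⟩
  have hK3 : 3 ≤ K := by omega
  have hK2 : Even K := by
    have : Even (K : ℤ) := by rw [hK]; exact hw.add (by simp [show Even (12 : ℤ) by decide])
    exact_mod_cast this
  have hE := tendsto_E_atImInfty hK3 hK2
  refine ⟨fun τ => ModularForm.E hK3 τ * (ModularForm.discriminant τ)⁻¹ ^ a, ?_, ?_, ?_⟩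
  · have := (isJacobiForm_E hK3).mul (isJacobiForm_discriminant_inv.pow a)
    convert this using 1
    · rw [hK]; ring
    · simp
  · refine HasExpBound.mul (φ := fun τ _ => ModularForm.E hK3 τ)
      (ψ := fun τ _ => (ModularForm.discriminant τ)⁻¹ ^ a) ?_
      (HasExpBound.pow (φ := fun τ _ => (ModularForm.discriminant τ)⁻¹) ?_ a)
    · have h1 : ∀ᶠ τ in UpperHalfPlane.atImInfty, ‖ModularForm.E hK3 τ‖ ≤ 2 := by
        filter_upwards [(hE.norm).eventually (gt_mem_nhds (show ‖(1 : ℂ)‖ < 2 by simp))] with τ hτ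
        exact hτ.le
      obtain ⟨B, hB⟩ := exists_bound_of_eventually h1
      exact ⟨0, B, 2, fun τ x hτ => by simpa using hB τ hτ⟩
    · obtain ⟨C, hC⟩ := ModularForm.exp_isBigO_discriminant.bound
      obtain ⟨B, hB⟩ := exists_bound_of_eventually hC
      refine ⟨2 * Real.pi, B, C, fun τ x hτ => ?_⟩
      have h1 := hB τ hτ
      have h2 : 0 < ‖ModularForm.discriminant τ‖ :=
        norm_pos_iff.mpr (ModularForm.discriminant_ne_zero τ)
      rw [Real.norm_of_nonneg (Real.exp_pos _).le] at h1
      rw [norm_inv, inv_le_iff_one_le_mul₀ h2]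
      have h3 : Real.exp (-2 * Real.pi * τ.im) * Real.exp (2 * Real.pi * τ.im) = 1 := by
        rw [← Real.exp_add]; ring_nf; exact Real.exp_zero
      calc (1 : ℝ) = _ := h3.symm
        _ ≤ (C * ‖ModularForm.discriminant τ‖) * Real.exp (2 * Real.pi * τ.im) := by gcongr
        _ = _ := by ring
  · filter_upwards [hE.eventually_ne one_ne_zero] with τ hτ
    exact mul_ne_zero hτ (pow_ne_zero _ (inv_ne_zero (ModularForm.discriminant_ne_zero τ)))

/-! ### Growth of the theta functions -/

lemma norm_jacobiTheta₂_term_le_of_one_le {c : ℝ} (hc : c = 0 ∨ c = 1 / 2) {w τ : ℂ}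
    (hτ : 1 ≤ τ.im) (hw : w.im = c * τ.im) (n : ℤ) :
    ‖jacobiTheta₂_term n w τ‖ ≤ ‖jacobiTheta₂_term n (c * Complex.I) Complex.I‖ := by
  rw [norm_jacobiTheta₂_term, norm_jacobiTheta₂_term, Real.exp_le_exp, hw]
  have hn : (0 : ℝ) ≤ n ^ 2 + 2 * c * n := by
    rcases hc with rfl | rfl
    · simp; positivity
    · have : 0 ≤ n * (n + 1) := by
        rcases le_or_gt 0 n with h | h
        · positivity
        · exact mul_nonneg_of_nonpos_of_nonpos (by omega) (by omega)
      have h2 : (0 : ℝ) ≤ n * (n + 1) := by exact_mod_cast this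
      linarith
  simp only [Complex.mul_im, Complex.ofReal_re, Complex.I_im, Complex.ofReal_im, Complex.I_re]
  nlinarith [mul_nonneg (mul_nonneg Real.pi_pos.le hn) (sub_nonneg.mpr hτ)]

lemma exists_norm_jacobiTheta₂_le {c : ℝ} (hc : c = 0 ∨ c = 1 / 2) :
    ∃ C : ℝ, ∀ w τ : ℂ, 1 ≤ τ.im → w.im = c * τ.im → ‖jacobiTheta₂ w τ‖ ≤ C := by
  refine ⟨∑' n : ℤ, ‖jacobiTheta₂_term n (c * Complex.I) Complex.I‖, fun w τ hτ hw => ?_⟩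
  have hs := (hasSum_jacobiTheta₂_term (c * Complex.I) (τ := Complex.I) (by simp)).summable.norm
  exact tsum_of_norm_bounded hs.hasSum (norm_jacobiTheta₂_term_le_of_one_le hc hτ hw)

lemma hasExpBound_jtheta3 (a : ℝ) : HasExpBound fun τ z => jtheta3 τ (a * z) := by
  obtain ⟨C, hC⟩ := exists_norm_jacobiTheta₂_le (Or.inl rfl)
  exact ⟨0, 1, C, fun τ x hτ => by simpa [jtheta3] using hC _ _ hτ (by simp)⟩

lemma hasExpBound_jtheta4 (a : ℝ) : HasExpBound fun τ z => jtheta4 τ (a * z) := by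
  obtain ⟨C, hC⟩ := exists_norm_jacobiTheta₂_le (Or.inl rfl)
  exact ⟨0, 1, C, fun τ x hτ => by simpa [jtheta4] using hC _ _ hτ (by simp)⟩

lemma norm_e_theta_le (τ : ℍ) (x : ℝ) : ‖e (τ / 8 + x / 2)‖ ≤ 1 := by
  rw [norm_e, Real.exp_le_one_iff]
  have h : ((τ : ℂ) / 8 + x / 2).im = τ.im / 8 := by
    rw [show ((τ : ℂ) / 8 + x / 2) = ((1 / 8 : ℝ) : ℂ) * τ + ((x / 2 : ℝ) : ℂ) by push_cast; ring,
      Complex.add_im, Complex.im_ofReal_mul, Complex.ofReal_im, UpperHalfPlane.coe_im]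
    ring
  rw [h]
  nlinarith [Real.pi_pos, τ.im_pos]

lemma im_half (τ : ℍ) : ((τ : ℂ) / 2).im = 1 / 2 * τ.im := by
  rw [show (τ : ℂ) / 2 = ((1 / 2 : ℝ) : ℂ) * τ by push_cast; ring, Complex.im_ofReal_mul,
    UpperHalfPlane.coe_im]

lemma hasExpBound_jtheta2 (a : ℝ) : HasExpBound fun τ z => jtheta2 τ (a * z) := by
  obtain ⟨C, hC⟩ := exists_norm_jacobiTheta₂_le (Or.inr rfl)
  refine ⟨0, 1, C, fun τ x hτ => ?_⟩
  have h1 := hC ((a : ℂ) * x + τ / 2) τ hτ (by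
    rw [Complex.add_im, im_half, ← Complex.ofReal_mul, Complex.ofReal_im, zero_add]; rfl)
  have h2 := norm_e_theta_le τ (a * x)
  rw [Complex.ofReal_mul] at h2
  simp only [jtheta2]
  rw [norm_mul, zero_mul, Real.exp_zero, mul_one]
  exact (mul_le_of_le_one_left (norm_nonneg _) h2).trans h1

lemma hasExpBound_jtheta1 (a : ℝ) : HasExpBound fun τ z => jtheta1 τ (a * z) := by
  obtain ⟨C, hC⟩ := exists_norm_jacobiTheta₂_le (Or.inr rfl)
  refine ⟨0, 1, C, fun τ x hτ => ?_⟩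
  have h1 := hC ((a : ℂ) * x + τ / 2 + 1 / 2) τ hτ (by
    rw [Complex.add_im, Complex.add_im, im_half, ← Complex.ofReal_mul, Complex.ofReal_im, zero_add]
    simp)
  have h2 := norm_e_theta_le τ (a * x)
  rw [Complex.ofReal_mul] at h2
  simp only [jtheta1]
  rw [norm_mul, zero_mul, Real.exp_zero, mul_one]
  exact (mul_le_of_le_one_left (norm_nonneg _) h2).trans h1

lemma hasExpBound_thetaProd : HasExpBound fun τ _ => thetaProd τ := by
  have := ((hasExpBound_jtheta2 0).mul (hasExpBound_jtheta3 0)).mul (hasExpBound_jtheta4 0)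
  simp only [Complex.ofReal_zero, zero_mul] at this
  exact this

lemma hasExpBound_phi10 : HasExpBound phi10 := by
  have := ((hasExpBound_jtheta1 1).pow 2).mul (hasExpBound_thetaProd.pow 6)
  simp only [Complex.ofReal_one, one_mul] at this
  exact this

lemma hasExpBound_phi11 : HasExpBound phi11 := by
  have := (hasExpBound_jtheta1 2).mul (hasExpBound_thetaProd.pow 7)
  simp only [Complex.ofReal_ofNat] at this
  exact this

lemma hasExpBound_phi4 : HasExpBound phi4 := by
  have := ((((hasExpBound_jtheta2 0).pow 6).mul ((hasExpBound_jtheta2 1).pow 2)).add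
    (((hasExpBound_jtheta3 0).pow 6).mul ((hasExpBound_jtheta3 1).pow 2))).add
    (((hasExpBound_jtheta4 0).pow 6).mul ((hasExpBound_jtheta4 1).pow 2))
  simp only [Complex.ofReal_one, one_mul, Complex.ofReal_zero, zero_mul] at this
  exact this

/-! ### Theta constants on the imaginary axis -/

lemma jacobiTheta₂_pos {w τ : ℂ} (hτ : 0 < τ.im) (hτ0 : τ.re = 0) (hw : w.re = 0) :
    ∃ r : ℝ, 0 < r ∧ jacobiTheta₂ w τ = r := by
  have hterm : ∀ n : ℤ, jacobiTheta₂_term n w τ =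
      ((Real.exp (-2 * Real.pi * n * w.im - Real.pi * n ^ 2 * τ.im) : ℝ) : ℂ) := by
    intro n
    rw [jacobiTheta₂_term, Complex.ofReal_exp]
    congr 1
    have h1 : w = w.im * Complex.I := by apply Complex.ext <;> simp [hw]
    have h2 : τ = τ.im * Complex.I := by apply Complex.ext <;> simp [hτ0]
    conv_lhs => rw [h1, h2]
    push_cast
    linear_combination (2 * Real.pi * n * w.im + Real.pi * n ^ 2 * τ.im : ℂ) * Complex.I_sq
  have hs := (hasSum_jacobiTheta₂_term w hτ).summable
  simp only [funext hterm] at hs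
  have hs' := Complex.summable_ofReal.mp hs
  refine ⟨_, hs'.tsum_pos (fun n => (Real.exp_pos _).le) 0 (Real.exp_pos _), ?_⟩
  rw [Complex.ofReal_tsum, jacobiTheta₂]
  exact tsum_congr hterm

lemma jtheta3_pos {τ : ℍ} (hτ : τ.re = 0) : ∃ r : ℝ, 0 < r ∧ jtheta3 τ 0 = r :=
  jacobiTheta₂_pos τ.im_pos hτ rfl

lemma jtheta2_pos {τ : ℍ} (hτ : τ.re = 0) : ∃ r : ℝ, 0 < r ∧ jtheta2 τ 0 = r := by
  have h2 : (τ : ℂ) = τ.im * Complex.I := by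
    apply Complex.ext <;> simp [hτ]
  obtain ⟨r, hr, h⟩ := jacobiTheta₂_pos (w := 0 + τ / 2) τ.im_pos hτ (by rw [h2]; simp)
  refine ⟨Real.exp (-(Real.pi * τ.im / 4)) * r, by positivity, ?_⟩
  rw [jtheta2, h, e]
  push_cast
  congr 2
  rw [h2]
  linear_combination (Real.pi * τ.im / 4 : ℂ) * Complex.I_sq

lemma S_smul_S_smul (τ : ℍ) : ModularGroup.S • (ModularGroup.S • τ) = τ := by
  apply UpperHalfPlane.ext
  have := UpperHalfPlane.ne_zero τ
  rw [coe_S_smul, coe_S_smul]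
  field_simp

/-- The value of `θ₄` is obtained from that of `θ₂` by `τ ↦ -1/τ`; the eighth power removes the
branch of the square root. -/
lemma jtheta4_pow_pos {τ : ℍ} (hτ : τ.re = 0) : ∃ r : ℝ, 0 < r ∧ jtheta4 τ 0 ^ 8 = r := by
  have h2 : (τ : ℂ) = τ.im * Complex.I := by
    apply Complex.ext <;> simp [hτ]
  have him := τ.im_pos
  have h0 : (τ.im : ℂ) ≠ 0 := by exact_mod_cast him.ne'
  have hS : ((ModularGroup.S • τ : ℍ) : ℂ) = ((1 / τ.im : ℝ) : ℂ) * Complex.I := by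
    rw [coe_S_smul, h2]
    push_cast
    field_simp
    rw [Complex.I_sq]
  have hre : (ModularGroup.S • τ : ℍ).re = 0 := by
    rw [← UpperHalfPlane.coe_re, hS]; simp
  obtain ⟨r, hr, h⟩ := jtheta2_pos hre
  have h4 := jtheta4_S (ModularGroup.S • τ) 0
  rw [S_smul_S_smul, zero_div, zero_pow two_ne_zero, zero_div, e_zero, mul_one, h] at h4
  refine ⟨(1 / τ.im) ^ 4 * r ^ 8, by positivity, ?_⟩
  rw [h4, mul_pow, show 8 = 2 * 4 by norm_num, pow_mul, thetaFactor_sq, hS,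
    show -Complex.I * (((1 / τ.im : ℝ) : ℂ) * Complex.I) = ((1 / τ.im : ℝ) : ℂ) by
      linear_combination (-((1 / τ.im : ℝ) : ℂ)) * Complex.I_sq]
  push_cast
  ring

lemma thetaProd_ne_zero {τ : ℍ} (hτ : τ.re = 0) : thetaProd τ ≠ 0 := by
  obtain ⟨r2, h2, e2⟩ := jtheta2_pos hτ
  obtain ⟨r3, h3, e3⟩ := jtheta3_pos hτ
  obtain ⟨r4, h4, e4⟩ := jtheta4_pow_pos hτ
  have h4' : jtheta4 τ 0 ≠ 0 := by
    intro h
    rw [h, zero_pow (by norm_num)] at e4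
    exact h4.ne (by exact_mod_cast e4)
  rw [thetaProd, e2, e3]
  exact mul_ne_zero (mul_ne_zero (by exact_mod_cast h2.ne') (by exact_mod_cast h3.ne')) h4'

lemma phi4_zero_ne_zero {τ : ℍ} (hτ : τ.re = 0) : phi4 τ 0 ≠ 0 := by
  obtain ⟨r2, h2, e2⟩ := jtheta2_pos hτ
  obtain ⟨r3, h3, e3⟩ := jtheta3_pos hτ
  obtain ⟨r4, h4, e4⟩ := jtheta4_pow_pos hτ
  have : phi4 τ 0 = ((r2 ^ 8 + r3 ^ 8 + r4 : ℝ) : ℂ) := by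
    rw [phi4]
    push_cast
    rw [← e2, ← e3, ← e4]
    ring
  rw [this]
  have : 0 < r2 ^ 8 + r3 ^ 8 + r4 := by positivity
  exact_mod_cast this.ne'

lemma jtheta1_zero (τ : ℍ) : jtheta1 τ 0 = 0 := by
  have h1 := jacobiTheta₂_add_tau τ (-((τ : ℂ) / 2 + 1 / 2))
  rw [jacobiTheta₂_neg_left, show (τ : ℂ) / 2 + -(τ / 2 + 1 / 2) = -(1 / 2) by ring, neg_neg, e_half,
    show -((τ : ℂ) / 2 + 1 / 2) + τ = τ / 2 + 1 / 2 - 1 by ring] at h1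
  have h2 := jacobiTheta₂_add_left ((τ : ℂ) / 2 + 1 / 2 - 1) τ
  rw [sub_add_cancel] at h2
  rw [← h2] at h1
  have h3 : jacobiTheta₂ ((τ : ℂ) / 2 + 1 / 2) τ = 0 := by linear_combination h1 / 2
  rw [jtheta1, zero_add, h3, mul_zero]

lemma exists_jtheta1_ne_zero {τ : ℍ} (hτ : τ.re = 0) : ∃ z, jtheta1 τ z ≠ 0 := by
  refine ⟨-(τ / 2 + 1 / 2), ?_⟩
  obtain ⟨r3, h3, e3⟩ := jtheta3_pos hτ
  rw [jtheta1, show -((τ : ℂ) / 2 + 1 / 2) + τ / 2 + 1 / 2 = 0 by ring]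
  refine mul_ne_zero (e_ne_zero _) ?_
  rw [← jtheta3, e3]
  exact_mod_cast h3.ne'

/-! ### A spanning family of Jacobi forms -/

open Polynomial in
/-- If `ψ` has a zero at `0` without vanishing identically near `0`, and `χ(0) ≠ 0`, then the
products `ψ^i χ^(N-i)` are linearly independent, even after multiplication with a function that
does not vanish near `0`. -/
lemma linearIndependent_pow_mul_pow {N : ℕ} {F ψ χ : ℂ → ℂ} {G : Fin (N + 1) → ℂ}
    (hψ : ContinuousAt ψ 0) (hχ : ContinuousAt χ 0) (hψ0 : ψ 0 = 0) (hχ0 : χ 0 ≠ 0)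
    (hψne : ∀ᶠ z in nhdsWithin 0 {0}ᶜ, ψ z ≠ 0) (hFne : ∀ᶠ z in nhdsWithin 0 {0}ᶜ, F z ≠ 0)
    (hG : ∀ i, G i ≠ 0) {c : Fin (N + 1) → ℂ}
    (h : ∀ z, ∑ i, c i * (G i * F z * ψ z ^ (i : ℕ) * χ z ^ (N - i : ℕ)) = 0) : c = 0 := by
  -- a relation makes `ψ / χ`, which takes arbitrarily small non-zero values, a root of `p`
  set p : ℂ[X] := ∑ i : Fin (N + 1), C (c i * G i) * X ^ (i : ℕ) with hp
  have hχne : ∀ᶠ z in nhdsWithin (0 : ℂ) {0}ᶜ, χ z ≠ 0 :=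
    (hχ.eventually_ne hχ0).filter_mono nhdsWithin_le_nhds
  have hroot : ∀ᶠ z in nhdsWithin (0 : ℂ) {0}ᶜ, p.eval (ψ z / χ z) = 0 := by
    filter_upwards [hχne, hFne] with z h1 h2
    have h3 : F z * χ z ^ N * p.eval (ψ z / χ z) = 0 := by
      rw [← h z, hp, eval_finsetSum, Finset.mul_sum]
      refine Finset.sum_congr rfl fun i _ => ?_
      have hi : χ z ^ N = χ z ^ (i : ℕ) * χ z ^ (N - i : ℕ) := by
        rw [← pow_add]; congr 1; omega
      rw [hi, eval_mul, eval_C, eval_pow, eval_X, div_pow]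
      field_simp
    exact (mul_eq_zero.mp h3).resolve_left (mul_ne_zero h2 (pow_ne_zero _ h1))
  have hp0 : p = 0 := by
    by_contra hne
    have hlim : Filter.Tendsto (fun z => ψ z / χ z) (nhds 0) (nhds 0) := by
      have : Filter.Tendsto (fun z => ψ z / χ z) (nhds 0) (nhds (ψ 0 / χ 0)) :=
        (hψ.div hχ hχ0).tendsto
      rwa [hψ0, zero_div] at this
    have hfin : (({x ∈ p.roots.toFinset | x ≠ 0} : Finset ℂ) : Set ℂ)ᶜ ∈ nhds (0 : ℂ) :=
      (Finset.finite_toSet _).isClosed.isOpen_compl.mem_nhds (by simp)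
    have h1 : ∀ᶠ z in nhdsWithin (0 : ℂ) {0}ᶜ,
        ψ z / χ z ∈ (({x ∈ p.roots.toFinset | x ≠ 0} : Finset ℂ) : Set ℂ)ᶜ :=
      (hlim.mono_left nhdsWithin_le_nhds).eventually hfin
    obtain ⟨z, hz1, hz2, hz3, hz4⟩ := (h1.and (hroot.and (hψne.and hχne))).exists
    apply hz1
    simp only [Finset.coe_filter, Set.mem_ofPred_eq, Multiset.mem_toFinset]
    exact ⟨(mem_roots hne).mpr hz2, div_ne_zero hz3 hz4⟩
  ext i
  have h1 : p.coeff i = 0 := by rw [hp0, coeff_zero]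
  rw [hp, finsetSum_coeff] at h1
  simp only [coeff_C_mul, coeff_X_pow, mul_ite, mul_one, mul_zero, Fin.val_inj] at h1
  rw [Finset.sum_ite_eq Finset.univ i] at h1
  simpa [hG i] using h1

lemma eventually_ne_zero_of_differentiable {f : ℂ → ℂ} (hf : Differentiable ℂ f)
    (h : ∃ z, f z ≠ 0) : ∀ᶠ z in nhdsWithin 0 {0}ᶜ, f z ≠ 0 := by
  have ha : AnalyticOnNhd ℂ f Set.univ := fun z _ => hf.analyticAt z
  rcases (ha 0 (Set.mem_univ _)).eventually_eq_zero_or_eventually_ne_zero with h0 | h0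
  · obtain ⟨z, hz⟩ := h
    exact absurd (ha.eqOn_zero_of_preconnected_of_eventuallyEq_zero isPreconnected_univ
      (Set.mem_univ 0) h0 (Set.mem_univ z)) hz
  · exact h0

/-- There are `m - 1` Jacobi forms of odd weight `k` and index `m`, of exponential growth, that are
linearly independent as functions of `z` for a suitable `τ`. -/
lemma exists_independent_jacobiForms {m : ℕ} (hm : 2 ≤ m) {k : ℤ} (hk : Odd k) :
    ∃ (τ : ℍ) (φ : Fin (m - 1) → ℍ → ℂ → ℂ), (∀ i, IsJacobiForm k m (φ i)) ∧
      (∀ i, HasExpBound (φ i)) ∧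
      ∀ c : Fin (m - 1) → ℂ, (∀ z, ∑ i, c i * φ i τ z = 0) → c = 0 := by
  obtain ⟨N, rfl⟩ : ∃ N, m = N + 2 := ⟨m - 2, by omega⟩
  -- the forms are `g_i φ₁₁ φ₁₀^i φ₄^(N-i)`, where the modular form `g_i` corrects the weight
  have hw : ∀ i : Fin (N + 1), Even (k - 11 - 10 * (i : ℕ) - 4 * ((N - i : ℕ) : ℤ)) := by
    intro i
    obtain ⟨t, rfl⟩ := hk
    exact ⟨t - 5 - 5 * (i : ℕ) - 2 * ((N - i : ℕ) : ℤ), by ring⟩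
  choose g hgJ hgB hgne using fun i => exists_modular_of_even (hw i)
  obtain ⟨B, hB⟩ := exists_bound_of_eventually (Filter.eventually_all.mpr hgne)
  -- on the imaginary axis the theta constants do not vanish, and high up neither do the `g_i`
  let τ : ℍ := ⟨(max B 1 : ℝ) * Complex.I, by simp⟩
  have hre : τ.re = 0 := by
    change ((max B 1 : ℝ) * Complex.I : ℂ).re = 0
    simp
  have him : τ.im = max B 1 := by
    change ((max B 1 : ℝ) * Complex.I : ℂ).im = _
    rw [Complex.im_ofReal_mul, Complex.I_im, mul_one]
  refine ⟨τ, fun i τ z => g i τ * phi11 τ z * phi10 τ z ^ (i : ℕ) * phi4 τ z ^ (N - i : ℕ),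
    fun i => ?_, fun i => ?_, fun c hc => ?_⟩
  · have := (((hgJ i).mul isJacobiForm_phi11).mul (isJacobiForm_phi10.pow i)).mul
      (isJacobiForm_phi4.pow (N - i : ℕ))
    convert this using 1
    · ring
    · have := i.2; omega
  · exact (((hgB i).mul hasExpBound_phi11).mul (hasExpBound_phi10.pow i)).mul
      (hasExpBound_phi4.pow (N - i : ℕ))
  · obtain ⟨z1, hz1⟩ := exists_jtheta1_ne_zero hre
    have hD := thetaProd_ne_zero hre
    refine linearIndependent_pow_mul_pow (F := phi11 τ) (ψ := phi10 τ) (χ := phi4 τ)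
      (G := fun i => g i τ) (isJacobiForm_phi10.differentiable τ).continuous.continuousAt
      (isJacobiForm_phi4.differentiable τ).continuous.continuousAt ?_ (phi4_zero_ne_zero hre)
      (eventually_ne_zero_of_differentiable (isJacobiForm_phi10.differentiable τ) ⟨z1, ?_⟩)
      (eventually_ne_zero_of_differentiable (isJacobiForm_phi11.differentiable τ) ⟨z1 / 2, ?_⟩)
      (hB τ (him ▸ le_max_left _ _)) hc
    · rw [phi10, jtheta1_zero]; ring
    · exact mul_ne_zero (pow_ne_zero _ hz1) (pow_ne_zero _ hD)
    · refine mul_ne_zero ?_ (pow_ne_zero _ hD)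
      rwa [mul_div_cancel₀ _ two_ne_zero]

/-! ### Odd functions on `ℤ/2m` -/

lemma sum_zmod_eq_sum_range {n : ℕ} [NeZero n] {A : Type*} [AddCommMonoid A] (g : ZMod n → A) :
    ∑ x, g x = ∑ i ∈ Finset.range n, g i := by
  refine Finset.sum_bij' (fun x _ => x.val) (fun i _ => (i : ZMod n))
    (fun x _ => Finset.mem_range.mpr (ZMod.val_lt x)) (fun _ _ => Finset.mem_univ _)
    (fun x _ => by simp) (fun i hi => ZMod.val_cast_of_lt (Finset.mem_range.mp hi))
    (fun x _ => by simp)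

lemma natCast_two_mul_sub (m i : ℕ) (hi : i ≤ 2 * m) :
    ((2 * m - i : ℕ) : ZMod (2 * m)) = -(i : ZMod (2 * m)) := by
  rw [Nat.cast_sub hi, ZMod.natCast_self, zero_sub]

lemma neg_natCast_self (m : ℕ) : -(m : ZMod (2 * m)) = m := by
  rw [← natCast_two_mul_sub m m (by omega)]; congr 1; omega

/-- The sum of an even function on `ℤ/2m` that vanishes at `0` and at `m`. -/
lemma sum_zmod_of_even {m : ℕ} [NeZero m] {A : Type*} [AddCommMonoid A] {g : ZMod (2 * m) → A}
    (hg : ∀ x, g (-x) = g x) (h0 : g 0 = 0) (hm : g m = 0) :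
    ∑ x, g x = 2 • ∑ i ∈ Finset.Icc 1 (m - 1), g i := by
  have hm0 : 0 < m := NeZero.pos m
  rw [sum_zmod_eq_sum_range, two_nsmul]
  have hsplit : Finset.range (2 * m) = {0} ∪ ({m} ∪ (Finset.Icc 1 (m - 1) ∪
      Finset.Icc (m + 1) (2 * m - 1))) := by
    ext i; simp only [Finset.mem_range, Finset.mem_union, Finset.mem_singleton, Finset.mem_Icc]; omega
  rw [hsplit, Finset.sum_union, Finset.sum_union, Finset.sum_union, Finset.sum_singleton,
    Finset.sum_singleton, hm, Nat.cast_zero, h0, zero_add, zero_add]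
  · congr 1
    refine Finset.sum_bij' (fun i _ => 2 * m - i) (fun i _ => 2 * m - i) ?_ ?_ ?_ ?_ ?_
    · intro i hi; rw [Finset.mem_Icc] at hi ⊢; omega
    · intro i hi; rw [Finset.mem_Icc] at hi ⊢; omega
    · intro i hi; rw [Finset.mem_Icc] at hi; omega
    · intro i hi; rw [Finset.mem_Icc] at hi; omega
    · intro i hi
      rw [Finset.mem_Icc] at hi
      rw [natCast_two_mul_sub m i (by omega), hg]
  all_goals
    rw [Finset.disjoint_left]
    intro i hi
    simp only [Finset.mem_union, Finset.mem_singleton, Finset.mem_Icc] at hi ⊢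
    omega

/-- The sign of the representative of `x ∈ ℤ/2m` in `(-m, m]`, where `m` itself has sign `0`. -/
def zsign {m : ℕ} (x : ZMod (2 * m)) : ℤ :=
  if x.val = 0 ∨ x.val = m then 0 else if x.val < m then 1 else -1

/-- The absolute value of the representative of `x ∈ ℤ/2m` in `(-m, m]`. -/
def zabs {m : ℕ} (x : ZMod (2 * m)) : ℕ := min x.val (2 * m - x.val)

lemma zsign_neg {m : ℕ} [NeZero m] (x : ZMod (2 * m)) : zsign (-x) = -zsign x := by
  have hx := ZMod.val_lt x
  have hm0 : 0 < m := NeZero.pos m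
  rw [zsign, zsign, ZMod.neg_val]
  split_ifs with h1 h2 <;> simp_all <;> grind

lemma zabs_neg {m : ℕ} [NeZero m] (x : ZMod (2 * m)) : zabs (-x) = zabs x := by
  have hx := ZMod.val_lt x
  rw [zabs, zabs, ZMod.neg_val]
  split_ifs with h1
  · simp [h1]
  · omega

lemma zsign_natCast {m r : ℕ} (h : r ∈ Finset.Icc 1 (m - 1)) : zsign (r : ZMod (2 * m)) = 1 := by
  rw [Finset.mem_Icc] at h
  rw [zsign, ZMod.val_cast_of_lt (by omega), if_neg (by omega), if_pos (by omega)]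

lemma zabs_natCast {m r : ℕ} (h : r ∈ Finset.Icc 1 (m - 1)) : zabs (r : ZMod (2 * m)) = r := by
  rw [Finset.mem_Icc] at h
  rw [zabs, ZMod.val_cast_of_lt (by omega)]
  omega

lemma zsign_zero (m : ℕ) : zsign (0 : ZMod (2 * m)) = 0 := by simp [zsign]

lemma zsign_self (m : ℕ) [NeZero m] : zsign (m : ZMod (2 * m)) = 0 := by
  have hm0 : 0 < m := NeZero.pos m
  rw [zsign, ZMod.val_cast_of_lt (by omega)]; simp

/-- Every element of `ℤ/2m` is `0`, `m`, or `±r` with `1 ≤ r ≤ m - 1`. -/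
lemma zmod_cases {m : ℕ} [NeZero m] (x : ZMod (2 * m)) :
    x = 0 ∨ x = m ∨ ∃ r ∈ Finset.Icc 1 (m - 1), x = (r : ZMod (2 * m)) ∨ x = -(r : ZMod (2 * m)) := by
  have hx := ZMod.val_lt x
  have hxv : ((x.val : ℕ) : ZMod (2 * m)) = x := by simp
  rcases lt_trichotomy x.val m with h | h | h
  · rcases Nat.eq_zero_or_pos x.val with h0 | h0
    · left; exact (ZMod.val_eq_zero x).mp h0
    · right; right
      exact ⟨x.val, by rw [Finset.mem_Icc]; omega, Or.inl hxv.symm⟩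
  · right; left; exact hxv.symm.trans (congrArg _ h)
  · right; right
    refine ⟨2 * m - x.val, by rw [Finset.mem_Icc]; omega, Or.inr ?_⟩
    rw [natCast_two_mul_sub m _ hx.le, hxv, neg_neg]

/-- The extension of a matrix indexed by `1, …, m-1` to an odd function on `(ℤ/2m)²`. -/
def oddExt (m : ℕ) (c : ℕ → ℕ → ℕ) (x y : ZMod (2 * m)) : ℤ :=
  zsign x * zsign y * c (zabs x) (zabs y)

lemma oddExt_neg_left {m : ℕ} [NeZero m] (c : ℕ → ℕ → ℕ) (x y : ZMod (2 * m)) :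
    oddExt m c (-x) y = -oddExt m c x y := by
  rw [oddExt, oddExt, zsign_neg, zabs_neg]; ring

lemma oddExt_neg_right {m : ℕ} [NeZero m] (c : ℕ → ℕ → ℕ) (x y : ZMod (2 * m)) :
    oddExt m c x (-y) = -oddExt m c x y := by
  rw [oddExt, oddExt, zsign_neg, zabs_neg]; ring

lemma oddExt_natCast {m : ℕ} (c : ℕ → ℕ → ℕ) {r s : ℕ} (hr : r ∈ Finset.Icc 1 (m - 1))
    (hs : s ∈ Finset.Icc 1 (m - 1)) : oddExt m c r s = c r s := by
  rw [oddExt, zsign_natCast hr, zsign_natCast hs, zabs_natCast hr, zabs_natCast hs]; ring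

lemma eq_zero_of_odd {x : ℂ} (h : x = -x) : x = 0 := by
  have : 2 * x = 0 := by linear_combination h
  simpa using this

lemma odd_zero {m : ℕ} {f : ZMod (2 * m) → ℂ} (hf : ∀ x, f (-x) = -f x) : f 0 = 0 :=
  eq_zero_of_odd (by rw [← hf, neg_zero])

lemma odd_self {m : ℕ} {f : ZMod (2 * m) → ℂ} (hf : ∀ x, f (-x) = -f x) : f m = 0 :=
  eq_zero_of_odd (by rw [← hf, neg_natCast_self])

lemma sum_zmod_mul_of_odd {m : ℕ} [NeZero m] {f g : ZMod (2 * m) → ℂ} (hf : ∀ x, f (-x) = -f x)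
    (hg : ∀ x, g (-x) = -g x) :
    ∑ x, f x * g x = 2 * ∑ i ∈ Finset.Icc 1 (m - 1), f i * g i := by
  rw [sum_zmod_of_even (g := fun x => f x * g x) (fun x => by rw [hf, hg]; ring)
    (by rw [odd_zero hf, zero_mul]) (by rw [odd_self hf, zero_mul]), nsmul_eq_mul]
  push_cast
  rfl

/-- The odd part in the first index of a matrix pairs in the same way with odd vectors. -/
lemma sum_mul_eq_half_odd {m : ℕ} [NeZero m] {f : ZMod (2 * m) → ℂ} (hf : ∀ x, f (-x) = -f x)
    (g : ZMod (2 * m) → ℂ) : ∑ x, f x * g x = 1 / 2 * ∑ x, f x * (g x - g (-x)) := by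
  have h : ∑ x, f x * g (-x) = -∑ x, f x * g x := by
    rw [← Equiv.sum_comp (Equiv.neg _), ← Finset.sum_neg_distrib]
    exact Finset.sum_congr rfl fun x _ => by simp [hf]
  simp_rw [mul_sub]
  rw [Finset.sum_sub_distrib, h]
  ring

lemma sum_Icc_eq_sum_fin {A : Type*} [AddCommMonoid A] (m : ℕ) (f : ℕ → A) :
    ∑ r ∈ Finset.Icc 1 (m - 1), f r = ∑ j : Fin (m - 1), f (j + 1) := by
  rw [Fin.sum_univ_eq_sum_range (fun i => f (i + 1)), Finset.range_eq_Ico, Finset.sum_Ico_add']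
  refine Finset.sum_congr ?_ fun _ _ => rfl
  ext; simp only [Finset.mem_Icc, Finset.mem_Ico]; omega

/-- A family of odd vectors that spans all odd vectors, in the form in which it is used. -/
lemma exists_spanning_family {m : ℕ} [NeZero m] (hm : 2 ≤ m) {k : ℤ} (hk : Odd k) :
    ∃ (τ : ℍ) (h : Fin (m - 1) → ZMod (2 * m) → ℍ → ℂ),
      (∀ i, IsJacobiForm k m (thetaSum m (h i) 1)) ∧ (∀ i, HasExponentialGrowth (h i)) ∧
      ∀ f : ZMod (2 * m) → ℂ, (∀ x, f (-x) = -f x) → (∀ i, ∑ x, h i x τ * f x = 0) → f = 0 := by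
  obtain ⟨τ, φ, hφ, hB, hind⟩ := exists_independent_jacobiForms hm hk
  have hJ : ∀ i, IsJacobiForm k m (thetaSum m (thetaCoeff m (φ i)) 1) := fun i => by
    rw [thetaSum_thetaCoeff (hφ i)]; exact hφ i
  refine ⟨τ, fun i => thetaCoeff m (φ i), hJ, fun i => hasExponentialGrowth_thetaCoeff (hB i),
    fun f hf hsum => ?_⟩
  have hodd := fun i x => coeff_neg hk (hJ i) x τ
  -- linear independence of the forms makes the square matrix of their coefficients invertible
  let H : Matrix (Fin (m - 1)) (Fin (m - 1)) ℂ :=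
    Matrix.of fun i j => thetaCoeff m (φ i) (((j : ℕ) + 1 : ℕ) : ZMod (2 * m)) τ
  have hdet : H.det ≠ 0 := by
    intro h0
    obtain ⟨c, hc, hcH⟩ := Matrix.exists_vecMul_eq_zero_iff.mpr h0
    refine hc (hind c fun z => ?_)
    have hall : ∀ x : ZMod (2 * m), ∑ i, c i * thetaCoeff m (φ i) x τ = 0 := by
      have hF : ∀ x : ZMod (2 * m), (fun x => ∑ i, c i * thetaCoeff m (φ i) x τ) (-x) =
          -(fun x => ∑ i, c i * thetaCoeff m (φ i) x τ) x := by
        intro x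
        simp only [hodd, mul_neg, Finset.sum_neg_distrib]
      have hpos : ∀ r ∈ Finset.Icc 1 (m - 1),
          ∑ i, c i * thetaCoeff m (φ i) (r : ZMod (2 * m)) τ = 0 := by
        intro r hr
        rw [Finset.mem_Icc] at hr
        have : _ = (0 : ℂ) := congrFun hcH ⟨r - 1, by omega⟩
        simpa only [Matrix.vecMul, dotProduct, H, Matrix.of_apply, Nat.sub_add_cancel hr.1] using this
      intro x
      rcases zmod_cases x with rfl | rfl | ⟨r, hr, rfl | rfl⟩
      · exact odd_zero (f := fun x => ∑ i, c i * thetaCoeff m (φ i) x τ) hF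
      · exact odd_self (f := fun x => ∑ i, c i * thetaCoeff m (φ i) x τ) hF
      · exact hpos r hr
      · have := hF r
        dsimp only at this
        rw [this, hpos r hr, neg_zero]
    have h1 : ∀ i, φ i τ z = ∑ x : ZMod (2 * m), thetaCoeff m (φ i) x τ * theta m x τ z := by
      intro i
      rw [← thetaSum_one, thetaSum_thetaCoeff (hφ i)]
    simp_rw [h1, Finset.mul_sum]
    rw [Finset.sum_comm]
    refine Finset.sum_eq_zero fun x _ => ?_
    simp_rw [← mul_assoc]
    rw [← Finset.sum_mul, hall, zero_mul]
  have hv : H.mulVec (fun j => f (((j : ℕ) + 1 : ℕ) : ZMod (2 * m))) = 0 := by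
    ext i
    have h1 := hsum i
    rw [sum_zmod_mul_of_odd (hodd i) hf, sum_Icc_eq_sum_fin m (fun r =>
      thetaCoeff m (φ i) (r : ZMod (2 * m)) τ * f (r : ZMod (2 * m)))] at h1
    simpa [Matrix.mulVec, dotProduct, H] using h1
  have hv0 := Matrix.eq_zero_of_mulVec_eq_zero hdet hv
  have hpos : ∀ r ∈ Finset.Icc 1 (m - 1), f (r : ZMod (2 * m)) = 0 := by
    intro r hr
    rw [Finset.mem_Icc] at hr
    have : _ = (0 : ℂ) := congrFun hv0 ⟨r - 1, by omega⟩
    simpa only [Nat.sub_add_cancel hr.1] using this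
  ext x
  rcases zmod_cases x with rfl | rfl | ⟨r, hr, rfl | rfl⟩
  · exact odd_zero hf
  · exact odd_self hf
  · exact hpos r hr
  · rw [hf, hpos r hr, neg_zero]; rfl

/-! ### The modular invariant attached to a matrix that preserves Jacobi forms -/

lemma hasExponentialGrowth_zero {ι : Type*} :
    HasExponentialGrowth (fun (_ : ι) (_ : ℍ) => (0 : ℂ)) :=
  fun _ => ⟨0, 0, 0, fun τ _ => by simp⟩

lemma HasExponentialGrowth.add {ι : Type*} {h h' : ι → ℍ → ℂ} (H : HasExponentialGrowth h)
    (H' : HasExponentialGrowth h') : HasExponentialGrowth (fun r τ => h r τ + h' r τ) := by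
  intro r
  obtain ⟨A, B, C, hb⟩ := H r
  obtain ⟨A', B', C', hb'⟩ := H' r
  refine ⟨max A A', max B B', |C| + |C'|, fun τ hτ => (norm_add_le _ _).trans ?_⟩
  have him := τ.im_pos
  have h1 : Real.exp (A * τ.im) ≤ Real.exp (max A A' * τ.im) :=
    Real.exp_le_exp.mpr (mul_le_mul_of_nonneg_right (le_max_left _ _) him.le)
  have h2 : Real.exp (A' * τ.im) ≤ Real.exp (max A A' * τ.im) :=
    Real.exp_le_exp.mpr (mul_le_mul_of_nonneg_right (le_max_right _ _) him.le)
  rw [add_mul]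
  exact add_le_add
    ((hb τ ((le_max_left _ _).trans hτ)).trans
      (mul_le_mul (le_abs_self _) h1 (Real.exp_pos _).le (abs_nonneg _)))
    ((hb' τ ((le_max_right _ _).trans hτ)).trans
      (mul_le_mul (le_abs_self _) h2 (Real.exp_pos _).le (abs_nonneg _)))

lemma HasExponentialGrowth.const_mul {ι : Type*} {h : ι → ℍ → ℂ} (H : HasExponentialGrowth h)
    (a : ℂ) : HasExponentialGrowth (fun r τ => a * h r τ) := by
  intro r
  obtain ⟨A, B, C, hb⟩ := H r
  refine ⟨A, B, ‖a‖ * C, fun τ hτ => ?_⟩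
  rw [norm_mul, mul_assoc]
  exact mul_le_mul_of_nonneg_left (hb τ hτ) (norm_nonneg _)

lemma hasExponentialGrowth_sum {ι κ : Type*} (s : Finset κ) {h : κ → ι → ℍ → ℂ}
    (H : ∀ i, HasExponentialGrowth (h i)) :
    HasExponentialGrowth (fun r τ => ∑ i ∈ s, h i r τ) := by
  classical
  induction s using Finset.induction_on with
  | empty => simpa using hasExponentialGrowth_zero
  | insert i s hi ih => simp_rw [Finset.sum_insert hi]; exact (H i).add ih

lemma four_mul_dvd_sq_sub_sq {m a b : ℤ} (h : 2 * m ∣ a - b ∨ 2 * m ∣ a + b) :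
    4 * m ∣ a ^ 2 - b ^ 2 := by
  rcases h with ⟨k, hk⟩ | ⟨k, hk⟩
  · obtain rfl : a = b + 2 * m * k := by linear_combination hk
    exact ⟨k * b + m * k ^ 2, by ring⟩
  · obtain rfl : a = -b + 2 * m * k := by linear_combination hk
    exact ⟨-(k * b) + m * k ^ 2, by ring⟩

lemma exists_int_of_e_eq {x y : ℂ} (h : e x = e y) : ∃ n : ℤ, x = y + n := by
  rw [e, e, Complex.exp_eq_exp_iff_exists_int] at h
  obtain ⟨n, hn⟩ := h
  refine ⟨n, ?_⟩
  have h2 : (2 * Real.pi * Complex.I : ℂ) ≠ 0 := Complex.two_pi_I_ne_zero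
  apply mul_left_cancel₀ h2
  linear_combination hn

/-- The values `c r s`, for `1 ≤ r, s ≤ m - 1`, form a modular invariant: extended to an odd
function on `(ℤ/2m)²` they commute with the finite Fourier transform and with the quadratic
character `r ↦ e(r²/4m)`.  They are normalised by `c 1 1 = 1`. -/
structure IsModularInvariant (m : ℕ) [NeZero m] (c : ℕ → ℕ → ℕ) : Prop where
  one_one : c 1 1 = 1
  fourier : ∀ s x : ZMod (2 * m), ∑ r, ZMod.stdAddChar (-(r * s)) * (oddExt m c r x : ℂ) =
    ∑ y, (oddExt m c s y : ℂ) * ZMod.stdAddChar (-(x * y))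
  dvd : ∀ s x : ℤ, oddExt m c s x ≠ 0 → (4 * m : ℤ) ∣ s ^ 2 - x ^ 2

/-- The combination of theta functions in `HasThetaCoefficients`, expressed by all theta
functions. -/
lemma sum_theta_coefficients {m : ℕ} [NeZero m] {h : ZMod (2 * m) → ℂ}
    (hodd : ∀ r, h (-r) = -h r) (c : ℕ → ℕ → ℕ) (τ : ℍ) (z : ℂ) :
    ∑ r ∈ Finset.Icc 1 (m - 1), ∑ r' ∈ Finset.Icc 1 (m - 1),
      (c r r' : ℂ) * h (r : ZMod (2 * m)) *
        (theta m (r' : ZMod (2 * m)) τ z - theta m (-(r' : ZMod (2 * m))) τ z) =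
    ∑ x, (1 / 2 * ∑ r, h r * (oddExt m c r x : ℂ)) * theta m x τ z := by
  have h1 : ∀ x, (1 / 2 * ∑ r, h r * (oddExt m c r (-x) : ℂ)) =
      -(1 / 2 * ∑ r, h r * (oddExt m c r x : ℂ)) := by
    intro x
    simp_rw [oddExt_neg_right]
    push_cast
    simp_rw [mul_neg, Finset.sum_neg_distrib, mul_neg]
  rw [sum_mul_eq_half_odd h1, sum_zmod_mul_of_odd h1 (fun x => by rw [neg_neg]; ring),
    Finset.sum_comm, ← mul_assoc, one_div, inv_mul_cancel₀ two_ne_zero, one_mul]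
  refine Finset.sum_congr rfl fun x hx => ?_
  rw [sum_zmod_mul_of_odd hodd (fun r => by rw [oddExt_neg_left]; push_cast; rfl), ← mul_assoc,
    inv_mul_cancel₀ two_ne_zero, one_mul, Finset.sum_mul]
  refine Finset.sum_congr rfl fun r hr => ?_
  rw [oddExt_natCast c hr hx]
  push_cast
  ring

/-- An uncountable set cannot be divided into countably many finite sets. -/
lemma exists_infinite_fiber {α β : Type*} [Uncountable α] [Countable β] (f : α → β) :
    ∃ b, (f ⁻¹' {b}).Infinite := by
  by_contra! h
  have h1 : (Set.univ : Set α) = ⋃ b, f ⁻¹' {b} := by ext; simp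
  have h2 : (Set.univ : Set α).Countable := by
    rw [h1]
    exact Set.countable_iUnion fun b => (h b).countable
  exact not_countable (Set.countable_univ_iff.mp h2)

open Polynomial in
/-- A matrix as in the second part of the theorem acts on odd vectors by a modular invariant.  The
coefficients are allowed to depend on the vector, but they are integers, so on a one-parameter
family `∑ tⁱ h_i` they are the same for infinitely many `t`. -/
lemma exists_modularInvariant {m : ℕ} [NeZero m] (hm : 2 ≤ m) {k : ℤ} (hk : Odd k)
    {Ω : Matrix (ZMod (2 * m)) (ZMod (2 * m)) ℂ}
    (H : ∀ h : ZMod (2 * m) → ℍ → ℂ, HasExponentialGrowth h →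
        IsJacobiForm k m (thetaSum m h 1) →
          IsJacobiForm k m (thetaSum m h Ω) ∧
          ∃ c : ℕ → ℕ → ℕ, c 1 1 = 1 ∧ HasThetaCoefficients m h c (thetaSum m h Ω)) :
    ∃ c : ℕ → ℕ → ℕ, IsModularInvariant m c ∧
      ∀ r x, Ω r x - Ω (-r) x = (oddExt m c r x : ℂ) := by
  obtain ⟨τ, h, hJ, hG, hspan⟩ := exists_spanning_family hm hk
  let ht : ℂ → ZMod (2 * m) → ℍ → ℂ := fun t r τ => ∑ i : Fin (m - 1), t ^ (i : ℕ) * h i r τ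
  have htG : ∀ t, HasExponentialGrowth (ht t) := fun t =>
    hasExponentialGrowth_sum _ fun i => (hG i).const_mul _
  have htJ : ∀ t, IsJacobiForm k m (thetaSum m (ht t) 1) := by
    intro t
    have h1 : thetaSum m (ht t) 1 = fun τ z =>
        ∑ i : Fin (m - 1), t ^ (i : ℕ) * thetaSum m (h i) 1 τ z := by
      ext τ z
      simp_rw [thetaSum_one, ht, Finset.mul_sum, Finset.sum_mul]
      rw [Finset.sum_comm]
      simp_rw [mul_assoc]
    rw [h1]
    exact IsJacobiForm.sum _ fun i _ => (hJ i).const_mul _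
  choose c hc1 hc using fun t => (H (ht t) (htG t) (htJ t)).2
  -- comparison of the coefficients of `θ_{m,x}`
  have hkey : ∀ t x, ∑ r, ht t r τ * (Ω r x - Ω (-r) x) =
      ∑ r, ht t r τ * (oddExt m (c t) r x : ℂ) := by
    intro t x
    have hodd := fun r => coeff_neg hk (htJ t) r τ
    have := congrFun (theta_linearIndependent m (τ := τ) (v := fun x => ∑ r, ht t r τ * Ω r x)
      (w := fun x => 1 / 2 * ∑ r, ht t r τ * (oddExt m (c t) r x : ℂ)) (fun z => by
        rw [← thetaSum_eq, hc t τ z]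
        exact sum_theta_coefficients (h := fun r => ht t r τ) hodd _ _ _)) x
    rw [sum_mul_eq_half_odd hodd] at this
    exact mul_left_cancel₀ (by norm_num) this
  have : Uncountable ℂ := ⟨fun hcount =>
    not_countable_complex (Set.countable_univ_iff.mpr hcount)⟩
  obtain ⟨c0, hinf⟩ := exists_infinite_fiber fun (t : ℂ) (a b : Fin (m + 1)) => c t a b
  obtain ⟨t0, ht0⟩ := hinf.nonempty
  have hval : ∀ t ∈ (fun (t : ℂ) (a b : Fin (m + 1)) => c t a b) ⁻¹' {c0}, ∀ r x,
      oddExt m (c t) r x = oddExt m (c t0) r x := by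
    intro t htc r x
    have h1 : (fun (a b : Fin (m + 1)) => c t a b) = fun (a b : Fin (m + 1)) => c t0 a b :=
      htc.trans ht0.symm
    have hlt : ∀ y : ZMod (2 * m), zabs y < m + 1 := fun y => by
      rw [zabs]; have := ZMod.val_lt y; omega
    have h2 : c t (zabs r) (zabs x) = c t0 (zabs r) (zabs x) :=
      congrFun (congrFun h1 ⟨_, hlt r⟩) ⟨_, hlt x⟩
    rw [oddExt, oddExt, h2]
  have hΩ : ∀ r x, Ω r x - Ω (-r) x = (oddExt m (c t0) r x : ℂ) := by
    intro r x
    have := hspan (fun r => Ω r x - Ω (-r) x - (oddExt m (c t0) r x : ℂ))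
      (fun r => by rw [oddExt_neg_left, neg_neg]; push_cast; ring) (fun i => by
      -- by `hkey`, this polynomial vanishes at each of the infinitely many `t` with the same `c`
      set p : ℂ[X] := ∑ i : Fin (m - 1),
        C (∑ r, h i r τ * (Ω r x - Ω (-r) x - (oddExt m (c t0) r x : ℂ))) * X ^ (i : ℕ) with hp
      have hp0 : p = 0 := by
        refine eq_zero_of_infinite_isRoot p (hinf.mono fun t htc => ?_)
        have h1 := hkey t x
        simp_rw [hval t htc] at h1
        rw [← sub_eq_zero, ← Finset.sum_sub_distrib] at h1
        change p.eval t = 0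
        rw [← h1, hp, eval_finsetSum]
        simp_rw [eval_mul, eval_C, eval_pow, eval_X, Finset.sum_mul, ← mul_sub, ht, Finset.sum_mul]
        rw [Finset.sum_comm]
        refine Finset.sum_congr rfl fun r _ => Finset.sum_congr rfl fun i _ => ?_
        ring
      have h1 : p.coeff i = 0 := by rw [hp0, coeff_zero]
      rw [hp, finsetSum_coeff] at h1
      simp only [coeff_C_mul, coeff_X_pow, mul_ite, mul_one, mul_zero, Fin.val_inj] at h1
      rwa [Finset.sum_ite_eq Finset.univ i, if_pos (Finset.mem_univ _)] at h1)
    exact sub_eq_zero.mp (congrFun this r)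
  have hodd := fun i r => coeff_neg hk (hJ i) r τ
  have hΩJ : ∀ i, IsJacobiForm k m (thetaSum m (fun x τ => ∑ r, h i r τ * Ω r x) 1) := by
    intro i
    rw [← thetaSum_eq_thetaSum_one]
    exact (H (h i) (hG i) (hJ i)).1
  refine ⟨c t0, ⟨hc1 t0, fun s x => ?_, fun s x hsx => ?_⟩, hΩ⟩
  · -- both `h` and `hᵀ Ω` transform under `S` by the same Fourier transform
    obtain ⟨u, hu, hS⟩ := coeff_S_smul (m := m) k (ModularGroup.S • τ)
    rw [S_smul_S_smul] at hS
    have := hspan (fun s => ∑ r, ZMod.stdAddChar (-(r * s)) * (oddExt m (c t0) r x : ℂ) -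
        ∑ y, (oddExt m (c t0) s y : ℂ) * ZMod.stdAddChar (-(x * y))) (fun s => by
      have h1 : ∑ r, ZMod.stdAddChar (-(r * -s)) * (oddExt m (c t0) r x : ℂ) =
          -∑ r, ZMod.stdAddChar (-(r * s)) * (oddExt m (c t0) r x : ℂ) := by
        rw [← Equiv.sum_comp (Equiv.neg _), ← Finset.sum_neg_distrib]
        refine Finset.sum_congr rfl fun r _ => ?_
        rw [Equiv.neg_apply, oddExt_neg_left, neg_mul_neg]; push_cast; ring
      rw [h1]
      simp_rw [oddExt_neg_left]
      push_cast
      simp_rw [neg_mul, Finset.sum_neg_distrib]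
      ring) (fun i => by
      let B : ZMod (2 * m) → ℂ := fun s => ∑ r, ZMod.stdAddChar (-(r * s)) * Ω r x -
        ∑ y, Ω s y * ZMod.stdAddChar (-(x * y))
      have hB : ∑ s, h i s τ * B s = 0 := by
        have h1 := hS _ (hΩJ i) x
        have h2 := hS _ (hJ i)
        simp_rw [h2, mul_assoc] at h1
        rw [← Finset.mul_sum] at h1
        have h3 := mul_left_cancel₀ hu h1
        rw [← sub_eq_zero] at h3
        rw [← h3]
        simp_rw [B, mul_sub, Finset.sum_sub_distrib, Finset.mul_sum, Finset.sum_mul]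
        congr 1
        · rw [Finset.sum_comm]
          simp_rw [mul_assoc]
        · rw [Finset.sum_comm]
          simp_rw [mul_assoc]
      rw [sum_mul_eq_half_odd (hodd i)] at hB
      rw [← (mul_eq_zero.mp hB).resolve_left (by norm_num)]
      refine Finset.sum_congr rfl fun s _ => ?_
      congr 1
      have h1 : ∑ r, ZMod.stdAddChar (-(r * -s)) * Ω r x =
          ∑ r, ZMod.stdAddChar (-(r * s)) * Ω (-r) x := by
        rw [← Equiv.sum_comp (Equiv.neg _)]
        refine Finset.sum_congr rfl fun r _ => ?_
        rw [Equiv.neg_apply, neg_mul_neg]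
      simp_rw [B, h1, ← hΩ, mul_sub, sub_mul, Finset.sum_sub_distrib]
      ring)
    exact sub_eq_zero.mp (congrFun this s)
  · -- both `h` and `hᵀ Ω` transform under `T` by the character `E`
    let E : ZMod (2 * m) → ℂ := fun r => e (-(((r.val : ℤ) : ℂ) ^ 2 / (4 * m)))
    have hm0 : (m : ℂ) ≠ 0 := by exact_mod_cast NeZero.ne m
    have hEeq : ∀ a b : ℤ, (4 * m : ℤ) ∣ a ^ 2 - b ^ 2 →
        e (-((a : ℂ) ^ 2 / (4 * m))) = e (-((b : ℂ) ^ 2 / (4 * m))) := by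
      rintro a b ⟨j, hj⟩
      have h1 : (a : ℂ) ^ 2 = (b : ℂ) ^ 2 + 4 * m * j := by
        have : ((a ^ 2 - b ^ 2 : ℤ) : ℂ) = ((4 * m * j : ℤ) : ℂ) := by rw [hj]
        push_cast at this
        linear_combination this
      rw [h1, show -(((b : ℂ) ^ 2 + 4 * m * j) / (4 * m)) =
        -((b : ℂ) ^ 2 / (4 * m)) + ((-j : ℤ) : ℂ) by push_cast; field_simp; ring, e_add_intCast]
    have hE : ∀ a : ℤ, E a = e (-((a : ℂ) ^ 2 / (4 * m))) := by
      intro a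
      refine hEeq _ _ (four_mul_dvd_sq_sub_sq (Or.inl ?_))
      have : (((((a : ZMod (2 * m)).val : ℤ) - a : ℤ)) : ZMod (2 * m)) = 0 := by simp
      simpa using (ZMod.intCast_zmod_eq_zero_iff_dvd _ _).mp this
    have hEneg : ∀ r, E (-r) = E r := by
      intro r
      obtain ⟨a, rfl⟩ := ZMod.intCast_surjective r
      rw [← Int.cast_neg, hE, hE]
      push_cast
      rw [neg_sq]
    have hT : ∀ h : ZMod (2 * m) → ℍ → ℂ, IsJacobiForm k m (thetaSum m h 1) → ∀ r,
        h r (ModularGroup.T • τ) = h r τ * E r := by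
      intro h hJ r
      obtain ⟨a, rfl⟩ := ZMod.intCast_surjective r
      rw [hE, ← coeff_T_smul hJ a τ, mul_assoc, ← e_add, add_neg_cancel, e_zero, mul_one]
    have := hspan (fun s => (E s - E (x : ZMod (2 * m))) *
        (oddExt m (c t0) s (x : ZMod (2 * m)) : ℂ)) (fun s => by
      rw [hEneg, oddExt_neg_left]; push_cast; ring) (fun i => by
      have h1 := hT _ (hΩJ i) (x : ZMod (2 * m))
      simp_rw [hT _ (hJ i)] at h1
      rw [Finset.sum_mul, ← sub_eq_zero, ← Finset.sum_sub_distrib] at h1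
      have h2 : ∑ s, h i s τ * ((E s - E (x : ZMod (2 * m))) * Ω s (x : ZMod (2 * m))) = 0 := by
        rw [← h1]
        exact Finset.sum_congr rfl fun s _ => by ring
      rw [sum_mul_eq_half_odd (hodd i)] at h2
      rw [← (mul_eq_zero.mp h2).resolve_left (by norm_num)]
      refine Finset.sum_congr rfl fun s _ => ?_
      rw [hEneg, ← hΩ]; ring)
    have h1 := (mul_eq_zero.mp (congrFun this (s : ZMod (2 * m)))).resolve_right
      (by exact_mod_cast hsx)
    rw [hE, hE, sub_eq_zero] at h1
    obtain ⟨j, hj⟩ := exists_int_of_e_eq h1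
    refine ⟨-j, ?_⟩
    have h2 : (s : ℂ) ^ 2 - (x : ℂ) ^ 2 = 4 * m * -j := by
      field_simp at hj
      linear_combination -hj
    exact_mod_cast h2

/-! ### Galois symmetry of modular invariants -/

lemma stdAddChar_pow {N : ℕ} [NeZero N] (l : ℕ) (a : ZMod N) :
    ZMod.stdAddChar a ^ l = ZMod.stdAddChar ((l : ZMod N) * a) := by
  rw [← AddChar.map_nsmul_eq_pow, nsmul_eq_mul]

lemma isPrimitiveRoot_stdAddChar (N : ℕ) [NeZero N] :
    IsPrimitiveRoot (ZMod.stdAddChar (1 : ZMod N)) N := by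
  have h := ZMod.stdAddChar_coe (N := N) 1
  rw [Int.cast_one] at h
  rw [h, Int.cast_one, mul_one]
  exact Complex.isPrimitiveRoot_exp N (NeZero.ne N)

open Polynomial in
/-- An integral linear relation between `N`-th roots of unity is preserved by the automorphism that
raises them to the `l`-th power, for `l` coprime to `N`. -/
lemma sum_stdAddChar_galois {N : ℕ} [NeZero N] {ι : Type*} [Fintype ι] {l : ℕ} (hl : l.Coprime N)
    (g : ι → ℤ) (a : ι → ZMod N) (h : ∑ i, (g i : ℂ) * ZMod.stdAddChar (a i) = 0) :
    ∑ i, (g i : ℂ) * ZMod.stdAddChar ((l : ZMod N) * a i) = 0 := by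
  set ζ := ZMod.stdAddChar (1 : ZMod N)
  have hζ : IsPrimitiveRoot ζ N := isPrimitiveRoot_stdAddChar N
  have hval : ∀ x : ZMod N, ζ ^ x.val = ZMod.stdAddChar x := fun x => by
    rw [stdAddChar_pow, mul_one, ZMod.natCast_zmod_val]
  set p : ℤ[X] := ∑ i, C (g i) * X ^ (a i).val with hp
  have heval : ∀ z : ℂ, aeval z p = ∑ i, (g i : ℂ) * z ^ (a i).val := fun z => by
    simp [hp, map_sum]
  have h1 : aeval ζ p = 0 := by simp_rw [heval, hval, h]
  have h2 : minpoly ℤ ζ ∣ p :=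
    minpoly.isIntegrallyClosed_dvd (hζ.isIntegral (NeZero.pos N)) h1
  rw [hζ.minpoly_eq_pow_coprime hl] at h2
  obtain ⟨q, hq⟩ := h2
  have h3 : aeval (ζ ^ l) p = 0 := by rw [hq, map_mul, minpoly.aeval, zero_mul]
  rw [heval] at h3
  rw [← h3]
  refine Finset.sum_congr rfl fun i _ => ?_
  rw [← pow_mul, mul_comm l, pow_mul, hval, stdAddChar_pow]

lemma sum_units_mul {R A : Type*} [Monoid R] [Fintype R] [AddCommMonoid A] (u : Rˣ) (f : R → A) :
    ∑ y, f (u * y) = ∑ y, f y :=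
  Fintype.sum_equiv (Units.mulLeft u) _ _ fun _ => rfl

/-- Injectivity of the finite Fourier transform, combined with a permutation by a unit `u`. -/
lemma eq_of_sum_stdAddChar_eq {N : ℕ} [NeZero N] {f g : ZMod N → ℂ} (u : (ZMod N)ˣ)
    (h : ∀ x, ∑ y, f y * ZMod.stdAddChar (-(x * y)) =
      ∑ y, g y * ZMod.stdAddChar (-(x * ((u : ZMod N) * y)))) (y : ZMod N) : f (u * y) = g y := by
  have h3 : f = fun y => g (((u⁻¹ : (ZMod N)ˣ) : ZMod N) * y) := by
    apply (ZMod.dft (N := N) (E := ℂ)).injective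
    ext x
    simp_rw [ZMod.dft_apply, smul_eq_mul]
    calc _ = ∑ y, f y * ZMod.stdAddChar (-(x * y)) :=
          Finset.sum_congr rfl fun y _ => by rw [mul_comm, mul_comm y]
      _ = ∑ y, g y * ZMod.stdAddChar (-(x * ((u : ZMod N) * y))) := h x
      _ = ∑ y, g (((u⁻¹ : (ZMod N)ˣ) : ZMod N) * y) *
            ZMod.stdAddChar (-(x * ((u : ZMod N) * (((u⁻¹ : (ZMod N)ˣ) : ZMod N) * y)))) :=
          (sum_units_mul u⁻¹ fun y => g y * ZMod.stdAddChar (-(x * ((u : ZMod N) * y)))).symm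
      _ = _ := Finset.sum_congr rfl fun y _ => by
          rw [Units.mul_inv_cancel_left, mul_comm, mul_comm x]
  rw [h3]
  dsimp only
  rw [Units.inv_mul_cancel_left]

variable {m : ℕ} [NeZero m] {c : ℕ → ℕ → ℕ}

/-- A modular invariant is fixed by simultaneous multiplication of both indices by a unit. -/
lemma IsModularInvariant.oddExt_mul (hc : IsModularInvariant m c) {l : ℕ}
    (hl : l.Coprime (2 * m)) (s y : ZMod (2 * m)) :
    oddExt m c (l * s) (l * y) = oddExt m c s y := by
  have h1 : ∀ x : ZMod (2 * m),
      ∑ r, ZMod.stdAddChar (-(r * ((l : ZMod (2 * m)) * s))) * (oddExt m c r x : ℂ) =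
      ∑ y, (oddExt m c s y : ℂ) * ZMod.stdAddChar (-(x * ((l : ZMod (2 * m)) * y))) := by
    intro x
    have h2 := hc.fourier s x
    have := sum_stdAddChar_galois hl (ι := ZMod (2 * m) ⊕ ZMod (2 * m))
      (Sum.elim (fun r => oddExt m c r x) (fun y => -oddExt m c s y))
      (Sum.elim (fun r => -(r * s)) (fun y => -(x * y))) (by
        simp only [Fintype.sum_sum_type, Sum.elim_inl, Sum.elim_inr]
        push_cast
        simp_rw [neg_mul, Finset.sum_neg_distrib]
        rw [← h2, add_neg_eq_zero]
        exact Finset.sum_congr rfl fun r _ => mul_comm _ _)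
    simp only [Fintype.sum_sum_type, Sum.elim_inl, Sum.elim_inr] at this
    push_cast at this
    simp_rw [neg_mul, Finset.sum_neg_distrib] at this
    rw [add_neg_eq_zero] at this
    calc _ = ∑ r, (oddExt m c r x : ℂ) * ZMod.stdAddChar ((l : ZMod (2 * m)) * -(r * s)) :=
          Finset.sum_congr rfl fun r _ => by rw [mul_comm]; congr 2; ring
      _ = _ := this
      _ = _ := Finset.sum_congr rfl fun y _ => by congr 2; ring
  have h2 := eq_of_sum_stdAddChar_eq (f := fun y => (oddExt m c ((l : ZMod (2 * m)) * s) y : ℂ))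
    (g := fun y => (oddExt m c s y : ℂ)) (ZMod.unitOfCoprime l hl)
    (fun x => by rw [← hc.fourier, h1, ZMod.coe_unitOfCoprime]) y
  rw [ZMod.coe_unitOfCoprime] at h2
  exact_mod_cast h2

lemma IsModularInvariant.zsign_mul_eq (hc : IsModularInvariant m c) {a b l : ℕ}
    (ha : a ∈ Finset.Icc 1 (m - 1)) (hb : b ∈ Finset.Icc 1 (m - 1)) (hab : c a b ≠ 0)
    (hl : l.Coprime (2 * m)) :
    zsign ((l * a : ℕ) : ZMod (2 * m)) = zsign ((l * b : ℕ) : ZMod (2 * m)) := by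
  have h := hc.oddExt_mul hl (a : ZMod (2 * m)) (b : ZMod (2 * m))
  rw [oddExt_natCast c ha hb, oddExt, ← Nat.cast_mul, ← Nat.cast_mul] at h
  have hpos : (0 : ℤ) < c a b := by exact_mod_cast Nat.pos_of_ne_zero hab
  rw [← h] at hpos
  have hz : ∀ x : ZMod (2 * m), zsign x = 0 ∨ zsign x = 1 ∨ zsign x = -1 := fun x => by
    rw [zsign]; split_ifs <;> simp
  have hc0 : (0 : ℤ) ≤ c (zabs ((l * a : ℕ) : ZMod (2 * m))) (zabs ((l * b : ℕ) : ZMod (2 * m))) :=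
    Int.natCast_nonneg _
  rcases hz ((l * a : ℕ) : ZMod (2 * m)) with h1 | h1 | h1 <;>
  rcases hz ((l * b : ℕ) : ZMod (2 * m)) with h2 | h2 | h2 <;>
    rw [h1, h2] at hpos ⊢ <;> linarith

/-- Entries are transported along multiplication by a unit, up to the signs of the indices. -/
lemma IsModularInvariant.eq_of_zabs (hc : IsModularInvariant m c) {a b l : ℕ}
    (ha : a ∈ Finset.Icc 1 (m - 1)) (hb : b ∈ Finset.Icc 1 (m - 1)) (hl : l.Coprime (2 * m)) :
    (c a b : ℤ) = zsign ((l * a : ℕ) : ZMod (2 * m)) * zsign ((l * b : ℕ) : ZMod (2 * m)) *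
      c (zabs ((l * a : ℕ) : ZMod (2 * m))) (zabs ((l * b : ℕ) : ZMod (2 * m))) := by
  have h := hc.oddExt_mul hl (a : ZMod (2 * m)) (b : ZMod (2 * m))
  rw [oddExt_natCast c ha hb, ← Nat.cast_mul, ← Nat.cast_mul] at h
  rw [← h, oddExt]

lemma IsModularInvariant.four_mul_dvd (hc : IsModularInvariant m c) {a b : ℕ}
    (ha : a ∈ Finset.Icc 1 (m - 1)) (hb : b ∈ Finset.Icc 1 (m - 1)) (hab : c a b ≠ 0) :
    (4 * m : ℤ) ∣ (a : ℤ) ^ 2 - (b : ℤ) ^ 2 := by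
  refine hc.dvd a b ?_
  rw [Int.cast_natCast, Int.cast_natCast, oddExt_natCast c ha hb]
  exact_mod_cast hab

/-- The `S`-matrix relation: a modular invariant commutes with the matrix `sin(π a b / m)`. -/
lemma IsModularInvariant.sin_comm (hc : IsModularInvariant m c) {a b : ℕ}
    (ha : a ∈ Finset.Icc 1 (m - 1)) (hb : b ∈ Finset.Icc 1 (m - 1)) :
    ∑ x ∈ Finset.Icc 1 (m - 1), Real.sin (Real.pi * (a * x) / m) * c x b =
      ∑ x ∈ Finset.Icc 1 (m - 1), c a x * Real.sin (Real.pi * (x * b) / m) := by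
  have hm0 : (m : ℂ) ≠ 0 := by exact_mod_cast NeZero.ne m
  have hsin : ∀ r s : ℕ, ZMod.stdAddChar (-((r : ZMod (2 * m)) * (s : ZMod (2 * m)))) -
      ZMod.stdAddChar ((r : ZMod (2 * m)) * (s : ZMod (2 * m))) =
      -(2 * Complex.I) * (Real.sin (Real.pi * (r * s) / m) : ℂ) := by
    intro r s
    have h1 := ZMod.stdAddChar_coe (N := 2 * m) (-(r * s : ℕ))
    have h2 := ZMod.stdAddChar_coe (N := 2 * m) (r * s : ℕ)
    push_cast at h1 h2
    rw [h1, h2, Complex.ofReal_sin, Complex.sin]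
    push_cast
    have e1 : (2 * Real.pi * Complex.I * (-(r * s)) / (2 * m) : ℂ) =
      -(Real.pi * (r * s) / m) * Complex.I := by field_simp
    have e2 : (2 * Real.pi * Complex.I * (r * s) / (2 * m) : ℂ) =
      (Real.pi * (r * s) / m) * Complex.I := by field_simp
    rw [e1, e2]
    linear_combination (Complex.exp (-(Real.pi * (r * s) / m : ℂ) * Complex.I) -
      Complex.exp ((Real.pi * (r * s) / m : ℂ) * Complex.I)) * Complex.I_sq
  have hpair : ∀ (f : ZMod (2 * m) → ℂ) (s : ℕ), (∀ x, f (-x) = -f x) →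
      ∑ r : ZMod (2 * m), f r * ZMod.stdAddChar (-(r * (s : ZMod (2 * m)))) = -(2 * Complex.I) *
        ∑ r ∈ Finset.Icc 1 (m - 1), f (r : ZMod (2 * m)) * (Real.sin (Real.pi * (r * s) / m) : ℂ) := by
    intro f s hf
    rw [sum_mul_eq_half_odd hf, sum_zmod_mul_of_odd hf (fun x => by rw [neg_neg]; ring),
      Finset.mul_sum, Finset.mul_sum, Finset.mul_sum]
    refine Finset.sum_congr rfl fun r _ => ?_
    rw [neg_mul, neg_neg, hsin]
    ring
  have h := hc.fourier (a : ZMod (2 * m)) (b : ZMod (2 * m))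
  have h1 := hpair (fun r => (oddExt m c r (b : ZMod (2 * m)) : ℂ)) a (fun x => by
    rw [oddExt_neg_left]; push_cast; rfl)
  have h2 := hpair (fun y => (oddExt m c (a : ZMod (2 * m)) y : ℂ)) b (fun x => by
    rw [oddExt_neg_right]; push_cast; rfl)
  have h3 : ∑ r, (oddExt m c r (b : ZMod (2 * m)) : ℂ) * ZMod.stdAddChar (-(r * (a : ZMod (2 * m)))) =
      ∑ y, (oddExt m c (a : ZMod (2 * m)) y : ℂ) * ZMod.stdAddChar (-(y * (b : ZMod (2 * m)))) := by
    calc _ = _ := Finset.sum_congr rfl fun r _ => mul_comm _ _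
      _ = _ := h
      _ = _ := Finset.sum_congr rfl fun y _ => by rw [mul_comm y]
  rw [h1, h2] at h3
  have h4 := mul_left_cancel₀ (neg_ne_zero.mpr (mul_ne_zero two_ne_zero Complex.I_ne_zero)) h3
  have h5 : ∀ x ∈ Finset.Icc 1 (m - 1), oddExt m c (x : ZMod (2 * m)) (b : ZMod (2 * m)) = c x b :=
    fun x hx => oddExt_natCast c hx hb
  have h6 : ∀ x ∈ Finset.Icc 1 (m - 1), oddExt m c (a : ZMod (2 * m)) (x : ZMod (2 * m)) = c a x :=
    fun x hx => oddExt_natCast c ha hx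
  apply Complex.ofReal_injective
  push_cast
  calc _ = _ := Finset.sum_congr rfl fun x hx => by
        rw [← Int.cast_natCast (c x b), ← h5 x hx, mul_comm (a : ℂ), mul_comm]; push_cast; rfl
    _ = _ := h4
    _ = _ := Finset.sum_congr rfl fun x hx => by
        rw [h6 x hx]; push_cast; rfl

/-! ### The first row of a modular invariant -/

/-- The Galois condition on an index `a` in the first row: multiplication by `l` takes `a` to the
interval `(0, n)` modulo `2n`, for each `l ∈ (0, n)` coprime to `2n`. -/
def GaloisPositive (n a : ℤ) : Prop :=
  ∀ l q : ℤ, 0 < l → l < n → Odd l → IsCoprime l n → n < l * a - 2 * n * q →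
    l * a - 2 * n * q < 2 * n → False

/-- The Galois condition is invariant under the reflection `a ↦ n - a`, as `l n ≡ n` modulo `2n`. -/
lemma GaloisPositive.sub {n a : ℤ} (h : GaloisPositive n a) : GaloisPositive n (n - a) := by
  intro l q h0 h1 h2 h3 h4 h5
  obtain ⟨j, rfl⟩ := h2
  refine h (2 * j + 1) (j - q - 1) h0 h1 ⟨j, rfl⟩ h3 ?_ ?_ <;> linarith

lemma exists_pow_mul_near {b a N : ℤ} (hb : 1 < b) (ha : 0 < a) (haN : a ≤ N) :
    ∃ j : ℕ, b ^ j * a ≤ N ∧ N < b ^ (j + 1) * a := by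
  obtain ⟨j, h1, h2⟩ := exists_nat_pow_near (x := N / a) (y := b)
    ((Int.le_ediv_iff_mul_le ha).mpr (by linarith)) hb
  exact ⟨j, (Int.le_ediv_iff_mul_le ha).mp h1, (Int.ediv_lt_iff_lt_mul ha).mp h2⟩

lemma isCoprime_two_of_odd {n : ℤ} (h : Odd n) : IsCoprime 2 n := by
  obtain ⟨j, rfl⟩ := h
  exact ⟨-j, 1, by ring⟩

lemma isCoprime_two_pow_of_odd {n : ℤ} (h : Odd n) (j : ℕ) : IsCoprime (2 ^ j) n :=
  (isCoprime_two_of_odd h).pow_left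

lemma isCoprime_of_dvd_sq_sub_one {n a : ℤ} (h : n ∣ a ^ 2 - 1) : IsCoprime a n := by
  obtain ⟨j, hj⟩ := h
  exact ⟨a, -j, by linear_combination hj⟩

/-- The case of odd `n`.  If `2^j a < n < 2^(j+1) a`, the multiplier `l = n - 2^(j+1)` violates the
Galois condition, since `l a ≡ n - 2^(j+1) a` modulo `2n`. -/
lemma GaloisPositive.of_odd {n a : ℤ} (hn : Odd n) (ha0 : 0 < a) (han : a < n)
    (hT : 4 * n ∣ a ^ 2 - 1) (h : GaloisPositive n a) : a = 1 := by
  have hodd : Odd a := by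
    obtain ⟨t, ht⟩ := hT
    have h1 : Odd (a ^ 2) := ⟨2 * n * t, by linear_combination ht⟩
    exact (Int.odd_pow' two_ne_zero).mp h1
  by_contra hne
  obtain ⟨k, hk⟩ := hodd
  have hk1 : 1 ≤ k := by omega
  obtain ⟨j, h1, h2⟩ := exists_pow_mul_near (b := 2) one_lt_two ha0 han.le
  have h3 : (2 : ℤ) ^ j * a ≠ n := by
    intro h3
    rcases Nat.eq_zero_or_pos j with rfl | hj
    · linarith
    · obtain ⟨i, rfl⟩ := Nat.exists_eq_add_of_lt hj
      obtain ⟨t, ht⟩ := hn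
      rw [zero_add, pow_succ] at h3
      have : 2 * (2 ^ i * a) = 2 * t + 1 := by linarith
      omega
  have h4 : (2 : ℤ) ^ j * a < n := lt_of_le_of_ne h1 h3
  have h5 : (0 : ℤ) < 2 ^ j := by positivity
  rw [pow_succ] at h2
  refine h (n - 2 ^ j * 2) (k - 1) (by nlinarith) (by linarith) ?_ ?_ ?_ ?_
  · obtain ⟨t, ht⟩ := hn
    exact ⟨t - 2 ^ j, by linear_combination ht⟩
  · have := (isCoprime_two_pow_of_odd hn (j + 1)).neg_left.add_mul_left_left 1
    rw [pow_succ] at this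
    rwa [show -(2 ^ j * 2) + n * 1 = n - 2 ^ j * 2 by ring] at this
  · rw [hk] at h4 ⊢; nlinarith
  · rw [hk] at h2 ⊢; nlinarith

/-- The case of `n = 2n'` with `n'` odd and `a ≡ 1 mod 4`.  If `2^j a < n' < 2^(j+1) a`, the
multiplier `l = n' + 2^(j+1)` violates the Galois condition, since `n' a ≡ n'` modulo `2n`. -/
lemma GaloisPositive.eq_one_of_one_mod_four {n' a : ℤ} (hn : Odd n') (ha0 : 0 < a) (han : a < n')
    (ha4 : 4 ∣ a - 1) (h : GaloisPositive (2 * n') a) : a = 1 := by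
  by_contra hne
  obtain ⟨k, hk⟩ := ha4
  have hk1 : 1 ≤ k := by omega
  obtain ⟨j, h1, h2⟩ := exists_pow_mul_near (b := 2) one_lt_two ha0 han.le
  have h3 : (2 : ℤ) ^ j * a ≠ n' := by
    intro h3
    rcases Nat.eq_zero_or_pos j with rfl | hj
    · linarith
    · obtain ⟨i, rfl⟩ := Nat.exists_eq_add_of_lt hj
      obtain ⟨t, ht⟩ := hn
      rw [zero_add, pow_succ] at h3
      have : 2 * (2 ^ i * a) = 2 * t + 1 := by linarith
      omega
  have h4 : (2 : ℤ) ^ j * a < n' := lt_of_le_of_ne h1 h3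
  have h5 : (0 : ℤ) < 2 ^ j := by positivity
  rw [pow_succ] at h2
  have hak : a = 4 * k + 1 := by linarith
  have h6 : (n' + 2 ^ j * 2) * a - 2 * (2 * n') * k = n' + 2 * (2 ^ j * a) := by rw [hak]; ring
  have hodd : Odd (n' + 2 ^ j * 2) := by
    obtain ⟨t, ht⟩ := hn
    exact ⟨t + 2 ^ j, by linear_combination ht⟩
  refine h (n' + 2 ^ j * 2) k (by linarith) (by nlinarith) hodd ?_ ?_ ?_
  · refine IsCoprime.mul_right (isCoprime_two_of_odd hodd).symm ?_
    have := (isCoprime_two_pow_of_odd hn (j + 1)).add_mul_left_left 1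
    rw [pow_succ] at this
    rwa [show 2 ^ j * 2 + n' * 1 = n' + 2 ^ j * 2 by ring] at this
  · rw [h6]; linarith
  · rw [h6]; linarith

/-- For `n = 2n'` with `n'` odd, the Galois condition on `a ≡ 3 mod 4` says that `u a` stays away
from `0` modulo `2n'`, for small `u`. -/
lemma GaloisPositive.three_mod_four {n' a : ℤ} (hn : Odd n') (ha4 : 4 ∣ a - 3)
    (h : GaloisPositive (2 * n') a) {u : ℤ} (q : ℤ) (hu0 : 0 < u) (hun : 2 * u < n')
    (hu : IsCoprime u n') (h1 : -n' < 2 * (u * a - 2 * n' * q))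
    (h2 : 2 * (u * a - 2 * n' * q) < n') : False := by
  obtain ⟨k, hk⟩ := ha4
  have hodd : Odd (n' + 2 * u) := by
    obtain ⟨t, ht⟩ := hn
    exact ⟨t + u, by linear_combination ht⟩
  have h6 : (n' + 2 * u) * a - 2 * (2 * n') * (k + q) = 3 * n' + 2 * (u * a - 2 * n' * q) := by
    linear_combination n' * hk
  refine h (n' + 2 * u) (k + q) (by linarith) (by linarith) hodd ?_ ?_ ?_
  · refine IsCoprime.mul_right (isCoprime_two_of_odd hodd).symm ?_
    have := ((isCoprime_two_of_odd hn).mul_left hu).add_mul_left_left 1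
    rwa [show 2 * u + n' * 1 = n' + 2 * u by ring] at this
  · rw [h6]; linarith
  · rw [h6]; linarith

lemma four_pow_mod_three (j : ℕ) : ∃ t : ℤ, 4 ^ j = 3 * t + 1 := by
  have : (3 : ℤ) ∣ 4 ^ j - 1 := by simpa using sub_dvd_pow_sub_pow (4 : ℤ) 1 j
  obtain ⟨t, ht⟩ := this
  exact ⟨t, by linarith⟩

/-- The case of `n = 2n'` with `n'` odd and `a ≡ 3 mod 4`.  The multiples of `a` by `1`, `2`, `4`
confine `a` to an interval around `2n'/3`, and the multiple by `3` shows that `3 ∣ n'`.  If `a` differs from `2n'/3`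
by more than `1`, its multiples by powers of `2` drift away from the multiples of `2n'/3` until one
of them is too close to `0` modulo `2n'`. -/
lemma GaloisPositive.eq_of_three_mod_four {n' a : ℤ} (hn : Odd n') (ha0 : 0 < a) (han : a < n')
    (ha4 : 4 ∣ a - 3) (hT : 8 * n' ∣ a ^ 2 - 1) (h : GaloisPositive (2 * n') a) :
    n' = 15 ∧ a = 11 := by
  have ha3 : 3 ≤ a := by omega
  obtain ⟨N, hN⟩ := hn
  have hn : Odd n' := ⟨N, hN⟩
  have K := fun u q => GaloisPositive.three_mod_four hn ha4 h (u := u) q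
  have hn5 : 5 ≤ n' := by omega
  have hco2 := isCoprime_two_of_odd hn
  have k1 : n' ≤ 2 * a := by
    by_contra! hlt
    exact K 1 0 one_pos (by linarith) isCoprime_one_left (by linarith) (by linarith)
  have k2 : 4 * a ≤ 3 * n' := by
    by_contra! hlt
    exact K 2 1 two_pos (by linarith) hco2 (by linarith) (by linarith)
  have hn9 : 9 ≤ n' := by
    by_contra! hlt
    have : n' = 5 ∨ n' = 7 := by omega
    rcases this with rfl | rfl
    · obtain rfl : a = 3 := by omega
      norm_num at hT
    · omega
  have hco4 : ∀ j : ℕ, IsCoprime (4 ^ j) n' := fun j =>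
    IsCoprime.pow_left (by simpa using hco2.mul_left hco2)
  have k4 : 5 * n' ≤ 8 * a := by
    by_contra! hlt
    exact K 4 1 (by norm_num) (by linarith) (by simpa using hco4 1) (by linarith) (by linarith)
  have h3 : (3 : ℤ) ∣ n' := by
    by_contra h3
    have hco3 : IsCoprime 3 n' := (Int.prime_three.coprime_iff_not_dvd).mpr h3
    exact K 3 1 (by norm_num) (by linarith) hco3 (by linarith) (by linarith)
  obtain ⟨p, rfl⟩ := h3
  obtain ⟨δ, hδ⟩ : ∃ δ, a = 2 * p + δ := ⟨a - 2 * p, by ring⟩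
  have hcases : δ = 1 ∨ δ = -1 ∨ 3 ≤ δ ∨ δ ≤ -3 := by omega
  rcases hcases with rfl | rfl | hd | hd
  · -- `a² - 1 = 4p(p+1)` is divisible by `24p`
    obtain ⟨t, ht⟩ := hT
    have h5 : p * (p + 1) = p * (6 * t) := by rw [hδ] at ht; linarith
    have h6 : p + 1 = 6 * t := mul_left_cancel₀ (by omega) h5
    have ht1 : t = 1 := by
      by_contra hne
      have ht2 : 2 ≤ t := by omega
      have hp : p = 6 * t - 1 := by linarith
      have hco : IsCoprime (6 * t - 4) (3 * p) := by
        refine IsCoprime.mul_right ⟨-1, 2 * t - 1, by ring⟩ ?_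
        rw [hp]
        -- `gcd(6t-4, 6t-1) = gcd(3, 6t-1) = 1`
        exact ⟨-(2 * t), 2 * t - 1, by ring⟩
      refine K (6 * t - 4) (2 * t - 1) (by linarith) (by linarith) hco ?_ ?_ <;>
        rw [hδ, hp] <;> nlinarith
    omega
  · obtain ⟨t, ht⟩ := hT
    have h5 : p * (p - 1) = p * (6 * t) := by rw [hδ] at ht; linarith
    have h6 : p - 1 = 6 * t := mul_left_cancel₀ (by omega) h5
    omega
  · -- `u = 2·4^(j+1)` satisfies `u a ≡ -2p + u δ` modulo `6p`
    obtain ⟨j, h5, h6⟩ := exists_pow_mul_near (b := 4) (a := 2 * (2 * (3 * δ))) (N := 3 * p)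
      (by norm_num) (by linarith) (by linarith)
    obtain ⟨t, ht⟩ := four_pow_mod_three (j + 1)
    have h7 : (0 : ℤ) < 4 ^ j := by positivity
    have h8 : (4 : ℤ) ^ (j + 1) = 4 * 4 ^ j := by ring
    exfalso
    refine K (2 * 4 ^ (j + 1)) (2 * t + 1) (by positivity) (by rw [h8]; nlinarith)
      (hco2.mul_left (hco4 _)) ?_ ?_
    · have e1 : 2 * (2 * 4 ^ (j + 1) * a - 2 * (3 * p) * (2 * t + 1)) =
          4 * (4 ^ (j + 1) * δ) + 4 * (2 * p) * (4 ^ (j + 1) - 3 * t - 1) - 4 * p := by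
        rw [hδ]; ring
      rw [e1, ht]
      rw [ht] at h6
      nlinarith
    · have e1 : 2 * (2 * 4 ^ (j + 1) * a - 2 * (3 * p) * (2 * t + 1)) =
          4 * (4 ^ (j + 1) * δ) + 4 * (2 * p) * (4 ^ (j + 1) - 3 * t - 1) - 4 * p := by
        rw [hδ]; ring
      rw [e1, ht, ← ht, h8]
      nlinarith
  · -- `u = 4^(j+1)` satisfies `u a ≡ 2p + u δ` modulo `6p`
    obtain ⟨j, h5, h6⟩ := exists_pow_mul_near (b := 4) (a := 2 * (3 * -δ)) (N := 3 * p)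
      (by norm_num) (by linarith) (by linarith)
    obtain ⟨t, ht⟩ := four_pow_mod_three (j + 1)
    have h7 : (0 : ℤ) < 4 ^ j := by positivity
    have h8 : (4 : ℤ) ^ (j + 1) = 4 * 4 ^ j := by ring
    have e1 : 2 * (4 ^ (j + 1) * a - 2 * (3 * p) * t) =
          2 * (4 ^ (j + 1) * δ) + 4 * p * (4 ^ (j + 1) - 3 * t) := by
        rw [hδ]; ring
    have e2 : (4 : ℤ) ^ (j + 1) - 3 * t = 1 := by linarith
    exfalso
    refine K (4 ^ (j + 1)) t (by positivity) (by rw [h8]; nlinarith) (hco4 _) ?_ ?_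
    · rw [e1, e2, h8]; nlinarith
    · rw [e1, e2]; nlinarith

/-- The multiplier `l = N - 1` restricts `a ≡ 1 mod 4`, since `N a ≡ N` modulo `4N`. -/
lemma GaloisPositive.lt_half {N a : ℤ} (hN : Even N) (ha4 : 4 ∣ a - 1)
    (hN0 : 2 ≤ N) (han : a < 2 * N) (h : GaloisPositive (2 * N) a) : a < N := by
  obtain ⟨k, hk⟩ := ha4
  obtain ⟨t, ht⟩ := hN
  by_contra! hle
  have h6 : (N - 1) * a - 2 * (2 * N) * (k - 1) = 5 * N - a := by linear_combination N * hk
  refine h (N - 1) (k - 1) (by linarith) (by linarith) ⟨t - 1, by linarith⟩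
    (IsCoprime.mul_right ⟨-1, t, by linarith⟩ ⟨-1, 1, by ring⟩) ?_ ?_
  · rw [h6]; linarith
  · rw [h6]
    have : a ≠ N := by omega
    omega

/-- The multiplier `l = N - 1` restricts `a ≡ 3 mod 4`, since `N a ≡ 3N` modulo `4N`. -/
lemma GaloisPositive.gt_half {N a : ℤ} (hN : Even N) (ha4 : 4 ∣ a - 3)
    (ha0 : 0 < a) (hN0 : 2 ≤ N) (h : GaloisPositive (2 * N) a) : N < a := by
  obtain ⟨k, hk⟩ := ha4
  obtain ⟨t, ht⟩ := hN
  by_contra! hle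
  have h6 : (N - 1) * a - 2 * (2 * N) * k = 3 * N - a := by linear_combination N * hk
  refine h (N - 1) k (by linarith) (by linarith) ⟨t - 1, by linarith⟩
    (IsCoprime.mul_right ⟨-1, t, by linarith⟩ ⟨-1, 1, by ring⟩) ?_ ?_
  · rw [h6]
    have : a ≠ N := by omega
    omega
  · rw [h6]; linarith

/-- The case of `n = 2^s n'` divisible by `4`, where `a` is normalised to `a ≡ 1 mod 4`.  Here
`P = 2^(s-2)`. -/
lemma GaloisPositive.of_four_dvd {P n' a : ℤ} {s : ℕ} (hP : P = 2 ^ s) (hn : Odd n') (hn0 : 0 < n')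
    (ha0 : 0 < a) (han : a < 2 * P * n') (ha4 : 4 ∣ a - 1) (hT : 8 * (P * n') ∣ a ^ 2 - 1)
    (h : GaloisPositive (4 * P * n') a) :
    a = 1 ∨ (a = 5 ∧ P * n' = 3) := by
  have hP0 : 0 < P := by rw [hP]; positivity
  have hco2 := isCoprime_two_of_odd hn
  obtain ⟨N, hN⟩ := hn
  have hn : Odd n' := ⟨N, hN⟩
  -- an odd `l` that is coprime to `n'` is coprime to `n`
  have hcop : ∀ l : ℤ, Odd l → IsCoprime l n' → IsCoprime l (4 * P * n') := by
    intro l h1 h2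
    have h3 := (isCoprime_two_of_odd h1).symm
    refine IsCoprime.mul_right (IsCoprime.mul_right ?_ ?_) h2
    · simpa using h3.mul_right h3
    · rw [hP]; exact h3.pow_right
  obtain ⟨k, hk⟩ := ha4
  have hak : a = 4 * k + 1 := by linarith
  -- `2^s` divides `a - 1`, since `a + 1 ≡ 2 mod 4`
  have hPk : P ∣ k := by
    have h1 : P ∣ k * (2 * k + 1) := by
      obtain ⟨t, ht⟩ := hT
      refine ⟨n' * t, ?_⟩
      rw [hak] at ht
      linarith
    have h2 : IsCoprime P (2 * k + 1) := by
      rw [hP]; exact isCoprime_two_pow_of_odd ⟨k, rfl⟩ s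
    exact h2.dvd_of_dvd_mul_right h1
  obtain ⟨w, hw⟩ := hPk
  have haw : a = 4 * P * w + 1 := by rw [hak, hw]; ring
  rcases Int.even_or_odd' w with ⟨v, hv | hv⟩
  · -- the multiplier `(2P + 1) n' + 2^(j+1)`, where `(2P + 1) n' a ≡ (2P + 1) n'` modulo `2n`
    left
    by_contra hne
    have hv1 : 1 ≤ v := by
      have h1 : 0 < P * v := by
        by_contra! hle
        rw [hv] at haw
        have : a = 8 * (P * v) + 1 := by rw [haw]; ring
        omega
      exact pos_of_mul_pos_right h1 hP0.le
    have ha9 : 8 * P + 1 ≤ a := by rw [haw, hv]; nlinarith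
    obtain ⟨j, h1, h2⟩ := exists_pow_mul_near (b := 2) one_lt_two ha0 han.le
    have h3 : (2 : ℤ) ^ j * a ≠ 2 * P * n' := by
      -- otherwise `a`, which is coprime to `n`, would divide `n / 2`
      intro h3
      have hu : IsUnit a := by
        have h4 : IsCoprime a (8 * (P * n')) := isCoprime_of_dvd_sq_sub_one hT
        refine h4.isUnit_of_dvd' dvd_rfl ⟨4 * 2 ^ j, ?_⟩
        linear_combination (-4) * h3
      rcases Int.isUnit_iff.mp hu with h5 | h5 <;> omega
    have h4 : (2 : ℤ) ^ j * a < 2 * P * n' := lt_of_le_of_ne h1 h3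
    have h5 : (0 : ℤ) < 2 ^ j := by positivity
    rw [pow_succ] at h2
    have hodd : Odd (2 * P * n' + n' + 2 ^ j * 2) := ⟨P * n' + N + 2 ^ j, by rw [hN]; ring⟩
    have h6 : (2 * P * n' + n' + 2 ^ j * 2) * a - 2 * (4 * P * n') * (2 * P * v + v) =
        2 * P * n' + n' + 2 * (2 ^ j * a) := by rw [haw, hv]; ring
    have h7 : 9 * 2 ^ j ≤ 2 ^ j * a := by nlinarith
    have h8 : n' ≤ P * n' := by nlinarith
    refine h _ (2 * P * v + v) (by positivity) (by linarith) hodd (hcop _ hodd ?_) ?_ ?_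
    · have := (isCoprime_two_pow_of_odd hn (j + 1)).add_mul_left_left (2 * P + 1)
      rwa [show 2 ^ (j + 1) + n' * (2 * P + 1) = 2 * P * n' + n' + 2 ^ j * 2 by ring] at this
    · rw [h6]; linarith
    · rw [h6]; linarith
  · -- here `c n' a ≡ c n' + n mod 2n` for odd `c`
    right
    have h6 : ∀ c : ℤ, (c * 2 + 1) * n' * a = (c * 2 + 1) * n' + 4 * P * n' +
        2 * (4 * P * n') * (c + 2 * c * v + v) := by
      intro c; rw [haw, hv]; ring
    -- the multiplier `(4P - 1) n' - 2`
    have k1 : 4 * P * n' - n' ≤ 2 * a := by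
      by_contra! hlt
      have hodd : Odd (4 * P * n' - n' - 2) := ⟨2 * P * n' - N - 2, by rw [hN]; ring⟩
      have h7 := h6 (2 * P - 1)
      have h8 : (4 * P * n' - n' - 2) * a - 2 * (4 * P * n') *
          (2 * P - 1 + 2 * (2 * P - 1) * v + v) = 8 * P * n' - n' - 2 * a := by
        linear_combination h7
      have h9 : n' ≤ P * n' := by nlinarith
      refine h _ _ (by linarith) (by linarith) hodd (hcop _ hodd ?_)
        (lt_of_lt_of_eq ?_ h8.symm) (lt_of_eq_of_lt h8 ?_)
      · have := hco2.neg_left.add_mul_left_left (4 * P - 1)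
        rwa [show -2 + n' * (4 * P - 1) = 4 * P * n' - n' - 2 by ring] at this
      · linarith
      · linarith
    -- the multiplier `3n' + 4`
    have k2 : 4 * P * n' ≤ 3 * n' + 4 := by
      by_contra! hlt
      have hodd : Odd (3 * n' + 4) := ⟨3 * N + 3, by rw [hN]; ring⟩
      have h7 := h6 1
      have h8 : (3 * n' + 4) * a - 2 * (4 * P * n') * (1 + 2 * 1 * v + v + 1) =
          3 * n' + 4 * a - 4 * P * n' := by
        linear_combination h7
      have h9 : n' ≤ P * n' := by nlinarith
      refine h _ _ (by linarith) (by linarith) hodd (hcop _ hodd ?_)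
        (lt_of_lt_of_eq ?_ h8.symm) (lt_of_eq_of_lt h8 ?_)
      · have := (hco2.mul_left hco2).add_mul_left_left 3
        rwa [show 2 * 2 + n' * 3 = 3 * n' + 4 by ring] at this
      · linarith
      · linarith
    have hP1 : P = 1 := by
      by_contra hne
      have : 2 ≤ P := by omega
      nlinarith
    subst hP1
    have : n' = 1 ∨ n' = 3 := by omega
    rcases this with rfl | rfl
    · omega
    · omega

/-- The indices that can occur in the first row of a modular invariant. -/
theorem galoisPositive_classification {n a : ℤ} (ha0 : 0 < a) (han : a < n)
    (hT : 4 * n ∣ a ^ 2 - 1) (h : GaloisPositive n a) :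
    a = 1 ∨ (a = n - 1 ∧ 4 ∣ n - 2) ∨ (n = 12 ∧ a = 7) ∨ (n = 30 ∧ (a = 11 ∨ a = 19)) := by
  have hodd : Odd a := by
    obtain ⟨t, ht⟩ := hT
    have h1 : Odd (a ^ 2) := ⟨2 * n * t, by linear_combination ht⟩
    exact (Int.odd_pow' two_ne_zero).mp h1
  have hlast : a = n - 1 → n ≠ 2 → 4 ∣ n - 2 := by
    rintro rfl hn2
    have h1 : n * 4 ∣ n * (n - 2) := by
      convert hT using 1 <;> ring
    exact (mul_dvd_mul_iff_left (by omega)).mp h1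
  rcases Int.even_or_odd' n with ⟨N, hN | hN⟩
  · rcases Int.even_or_odd N with hN2 | hN2
    · -- `4 ∣ n`
      obtain ⟨M, hM⟩ := hN2
      have hM0 : 0 < M := by omega
      obtain ⟨s, n', hn', hMn⟩ : ∃ (s : ℕ) (n' : ℤ), Odd n' ∧ M = 2 ^ s * n' := by
        obtain ⟨s, x, hx, hMx⟩ := Nat.exists_eq_two_pow_mul_odd (n := M.toNat) (by omega)
        refine ⟨s, x, (Int.odd_coe_nat x).mpr hx, ?_⟩
        rw [← Int.toNat_of_nonneg hM0.le, hMx]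
        push_cast
        rfl
      have hn'0 : 0 < n' := by
        have : (0 : ℤ) < 2 ^ s := by positivity
        rw [hMn] at hM0
        exact pos_of_mul_pos_right hM0 this.le
      have hnP : n = 4 * 2 ^ s * n' := by rw [hN, hM, hMn]; ring
      have hmod : 4 ∣ a - 1 ∨ 4 ∣ a - 3 := by
        obtain ⟨t, ht⟩ := hodd
        omega
      subst hN
      rcases hmod with h4 | h4
      · have hlt := h.lt_half ⟨M, hM⟩ h4 (by omega) han
        rcases GaloisPositive.of_four_dvd rfl hn' hn'0 ha0 (by
            rw [hM, hMn] at hlt; linarith) h4 (by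
            refine Dvd.dvd.trans ⟨2, ?_⟩ hT
            rw [hnP]; ring) (hnP ▸ h) with h5 | ⟨h5, h6⟩
        · exact Or.inl h5
        · have h7 : 2 * N = 12 := by rw [hnP, mul_assoc, h6]; norm_num
          rw [h5, h7] at hT
          norm_num at hT
      · have hlt := h.gt_half ⟨M, hM⟩ h4 ha0 (by omega)
        rcases GaloisPositive.of_four_dvd (a := 2 * N - a) rfl hn' hn'0 (by omega) (by
            rw [hM, hMn] at hlt ⊢; linarith) (by omega) (by
            obtain ⟨t, ht⟩ := hT
            refine ⟨2 ^ (s + 1) * n' + 2 * t - a, ?_⟩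
            have h8 : (2 * N - a) ^ 2 - 1 = (2 * N) ^ 2 - 2 * (2 * N) * a + (a ^ 2 - 1) := by ring
            rw [h8, ht, hnP]; ring) (by rw [← hnP]; exact h.sub) with h5 | ⟨h5, h6⟩
        · right; left
          exact ⟨by linarith, hlast (by linarith) (by omega)⟩
        · have h7 : 2 * N = 12 := by rw [hnP, mul_assoc, h6]; norm_num
          right; right; left
          exact ⟨h7, by omega⟩
    · -- `n ≡ 2 mod 4`
      subst hN
      have key : ∀ b : ℤ, 0 < b → b < N → Odd b → 8 * N ∣ b ^ 2 - 1 → GaloisPositive (2 * N) b →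
          b = 1 ∨ (N = 15 ∧ b = 11) := by
        intro b hb0 hbN hbodd hbT hb
        have hmod : 4 ∣ b - 1 ∨ 4 ∣ b - 3 := by
          obtain ⟨t, ht⟩ := hbodd
          omega
        rcases hmod with h4 | h4
        · exact Or.inl (hb.eq_one_of_one_mod_four hN2 hb0 hbN h4)
        · exact Or.inr (hb.eq_of_three_mod_four hN2 hb0 hbN h4 hbT)
      have hT' : 8 * N ∣ a ^ 2 - 1 := by convert hT using 1; ring
      rcases lt_trichotomy a N with hlt | heq | hgt
      · rcases key a ha0 hlt hodd hT' h with h1 | ⟨h1, h2⟩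
        · exact Or.inl h1
        · right; right; right
          exact ⟨by omega, Or.inl h2⟩
      · left
        have hu : IsUnit a := by
          have h4 : IsCoprime a (8 * N) := isCoprime_of_dvd_sq_sub_one hT'
          exact h4.isUnit_of_dvd' dvd_rfl ⟨8, by rw [heq]; ring⟩
        rcases Int.isUnit_iff.mp hu with h5 | h5 <;> omega
      · obtain ⟨x, hx⟩ := hodd
        obtain ⟨y, hy⟩ := hN2
        rcases key (2 * N - a) (by omega) (by omega) ⟨N - x - 1, by omega⟩ (by
            obtain ⟨t, ht⟩ := hT'
            refine ⟨t + (y - x), ?_⟩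
            have h8 : (2 * N - a) ^ 2 - 1 = 4 * N * (N - a) + (a ^ 2 - 1) := by ring
            rw [h8, ht, show N - a = 2 * (y - x) by omega]; ring) h.sub with h1 | ⟨h1, h2⟩
        · right; left
          exact ⟨by omega, by omega⟩
        · right; right; right
          exact ⟨by omega, Or.inr (by omega)⟩
  · exact Or.inl (h.of_odd ⟨N, hN⟩ ha0 han hT)

/-! ### Sine values -/

/-- `sin(π x / m)`; up to normalisation, the entries of the `S`-matrix are `sineVal m (a * b)`. -/
def sineVal (m : ℕ) (x : ℤ) : ℝ := Real.sin (Real.pi * x / m)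

lemma sineVal_neg {m : ℕ} (x : ℤ) : sineVal m (-x) = -sineVal m x := by
  rw [sineVal, sineVal, ← Real.sin_neg]; push_cast; congr 1; ring

section sineVal

variable {m : ℕ} [NeZero m]

lemma sineVal_add_mul (x k : ℤ) : sineVal m (x + k * (2 * m)) = sineVal m x := by
  have hm0 : (m : ℝ) ≠ 0 := by exact_mod_cast NeZero.ne m
  rw [sineVal, sineVal, ← Real.sin_add_int_mul_two_pi (Real.pi * x / m) k]
  congr 1
  push_cast
  field_simp

lemma sineVal_add_self (x : ℤ) : sineVal m (x + m) = -sineVal m x := by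
  have hm0 : (m : ℝ) ≠ 0 := by exact_mod_cast NeZero.ne m
  rw [sineVal, sineVal, ← Real.sin_add_pi (Real.pi * x / m)]
  congr 1
  push_cast
  field_simp

lemma sineVal_eq {x y : ℤ} (h : 2 * (m : ℤ) ∣ x - y ∨ 2 * (m : ℤ) ∣ x + y - m) :
    sineVal m x = sineVal m y := by
  rcases h with ⟨k, hk⟩ | ⟨k, hk⟩
  · rw [show x = y + k * (2 * m) by linear_combination hk, sineVal_add_mul]
  · rw [show x = -y + m + k * (2 * m) by linear_combination hk, sineVal_add_mul, sineVal_add_self,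
      sineVal_neg, neg_neg]

lemma sineVal_eq_neg {x y : ℤ} (h : 2 * (m : ℤ) ∣ x + y ∨ 2 * (m : ℤ) ∣ x - y - m) :
    sineVal m x = -sineVal m y := by
  rcases h with ⟨k, hk⟩ | ⟨k, hk⟩
  · rw [show x = -y + k * (2 * m) by linear_combination hk, sineVal_add_mul, sineVal_neg]
  · rw [show x = y + m + k * (2 * m) by linear_combination hk, sineVal_add_mul, sineVal_add_self]

lemma sineVal_pos {x : ℤ} (h0 : 0 < x) (h1 : x < m) : 0 < sineVal m x := by
  have hm0 : (0 : ℝ) < m := by exact_mod_cast NeZero.pos m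
  have h0' : (0 : ℝ) < x := by exact_mod_cast h0
  have h1' : (x : ℝ) < m := by exact_mod_cast h1
  refine Real.sin_pos_of_pos_of_lt_pi (by positivity) ?_
  rw [div_lt_iff₀ hm0]
  exact mul_lt_mul_of_pos_left h1' Real.pi_pos

lemma sineVal_lt {x y : ℤ} (h0 : 0 ≤ x) (h1 : x < y) (h2 : x + y < m) :
    sineVal m x < sineVal m y := by
  have hm0 : (0 : ℝ) < m := by exact_mod_cast NeZero.pos m
  have h0' : (0 : ℝ) ≤ x := by exact_mod_cast h0
  have h1' : (x : ℝ) < y := by exact_mod_cast h1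
  have h2' : (x + y : ℝ) < m := by exact_mod_cast h2
  have hpi := Real.pi_pos
  rw [← sub_pos, sineVal, sineVal, Real.sin_sub_sin]
  have e1 : (Real.pi * y / m - Real.pi * x / m) / 2 = Real.pi * ((y - x) / (2 * m)) := by
    field_simp
  have e2 : (Real.pi * y / m + Real.pi * x / m) / 2 = Real.pi * ((x + y) / (2 * m)) := by
    field_simp; ring
  have h3 : (y - x : ℝ) / (2 * m) < 1 / 2 := by
    rw [div_lt_div_iff₀ (by positivity) two_pos]; linarith
  have h4 : (x + y : ℝ) / (2 * m) < 1 / 2 := by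
    rw [div_lt_div_iff₀ (by positivity) two_pos]; linarith
  have h5 : 0 < (y - x : ℝ) / (2 * m) := div_pos (by linarith) (by positivity)
  have h6 : 0 < (x + y : ℝ) / (2 * m) := div_pos (by linarith) (by positivity)
  rw [e1, e2]
  refine mul_pos (mul_pos two_pos (Real.sin_pos_of_pos_of_lt_pi (by positivity) ?_))
    (Real.cos_pos_of_mem_Ioo ⟨?_, ?_⟩) <;> nlinarith

lemma sineVal_inj {x y : ℤ} (hx0 : 0 < x) (hx : x < m) (hy0 : 0 < y) (hy : y < m)
    (h : sineVal m x = sineVal m y) : x = y ∨ x + y = m := by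
  have hrefl : ∀ z : ℤ, sineVal m (m - z) = sineVal m z := fun z =>
    sineVal_eq (Or.inr ⟨0, by ring⟩)
  by_contra! hne
  rcases lt_trichotomy (x + y) m with h1 | h1 | h1
  · rcases lt_or_gt_of_ne hne.1 with h2 | h2
    · exact (sineVal_lt hx0.le h2 h1).ne h
    · exact (sineVal_lt hy0.le h2 (by linarith)).ne h.symm
  · exact hne.2 h1
  · rw [← hrefl x, ← hrefl y] at h
    rcases lt_or_gt_of_ne hne.1 with h2 | h2
    · exact (sineVal_lt (x := m - y) (y := m - x) (by linarith) (by linarith) (by linarith)).ne h.symm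
    · exact (sineVal_lt (x := m - x) (y := m - y) (by linarith) (by linarith) (by linarith)).ne h

end sineVal

/-! ### First consequences for modular invariants -/

section invariant

variable {m : ℕ} [NeZero m] {c : ℕ → ℕ → ℕ}

lemma IsModularInvariant.transpose (hc : IsModularInvariant m c) :
    IsModularInvariant m fun a b => c b a := by
  have h : ∀ x y, oddExt m (fun a b => c b a) x y = oddExt m c y x := fun x y => by
    rw [oddExt, oddExt]; ring
  refine ⟨hc.one_one, fun s x => ?_, fun s x hsx => ?_⟩
  · simp_rw [h]
    calc _ = _ := Finset.sum_congr rfl fun y _ => by rw [mul_comm, mul_comm y]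
      _ = _ := (hc.fourier x s).symm
      _ = _ := Finset.sum_congr rfl fun y _ => by rw [mul_comm, mul_comm y]
  · rw [h] at hsx
    rw [← neg_sub]
    exact (hc.dvd x s hsx).neg_right

lemma IsModularInvariant.sineVal_comm (hc : IsModularInvariant m c) {a b : ℕ}
    (ha : a ∈ Finset.Icc 1 (m - 1)) (hb : b ∈ Finset.Icc 1 (m - 1)) :
    ∑ x ∈ Finset.Icc 1 (m - 1), c x b * sineVal m (a * x) =
      ∑ x ∈ Finset.Icc 1 (m - 1), c a x * sineVal m (x * b) := by
  have h := hc.sin_comm ha hb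
  simp only [sineVal]
  push_cast
  rw [← h]
  exact Finset.sum_congr rfl fun x _ => mul_comm _ _

/-- The total weight of a column, in terms of the first row. -/
lemma IsModularInvariant.column_sum (hc : IsModularInvariant m c) {b : ℕ}
    (hb : b ∈ Finset.Icc 1 (m - 1)) :
    ∑ x ∈ Finset.Icc 1 (m - 1), c x b * sineVal m x =
      ∑ x ∈ Finset.Icc 1 (m - 1), c 1 x * sineVal m (x * b) := by
  have h1 : 1 ∈ Finset.Icc 1 (m - 1) := by rw [Finset.mem_Icc] at hb ⊢; omega
  rw [← hc.sineVal_comm h1 hb]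
  simp

lemma sineVal_pos_of_mem {x : ℕ} (hx : x ∈ Finset.Icc 1 (m - 1)) : 0 < sineVal m x := by
  rw [Finset.mem_Icc] at hx
  exact sineVal_pos (by omega) (by omega)

lemma IsModularInvariant.eq_of_mul_mod (hc : IsModularInvariant m c) {a b a' b' l : ℕ}
    (ha : a ∈ Finset.Icc 1 (m - 1)) (hb : b ∈ Finset.Icc 1 (m - 1))
    (ha' : a' ∈ Finset.Icc 1 (m - 1)) (hb' : b' ∈ Finset.Icc 1 (m - 1)) (hl : l.Coprime (2 * m))
    (h1 : l * a % (2 * m) = a') (h2 : l * b % (2 * m) = b') : c a' b' = c a b := by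
  have h := hc.eq_of_zabs ha hb hl
  have e1 : ((l * a : ℕ) : ZMod (2 * m)) = a' := by rw [← h1, ZMod.natCast_mod]
  have e2 : ((l * b : ℕ) : ZMod (2 * m)) = b' := by rw [← h2, ZMod.natCast_mod]
  rw [e1, e2, zsign_natCast ha', zsign_natCast hb', zabs_natCast ha', zabs_natCast hb'] at h
  have : (c a b : ℤ) = c a' b' := by rw [h]; ring
  exact_mod_cast this.symm

/-- The possible non-zero entries of the first row. -/
lemma IsModularInvariant.row_one (hc : IsModularInvariant m c) {b : ℕ}
    (hb : b ∈ Finset.Icc 1 (m - 1)) (h : c 1 b ≠ 0) :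
    b = 1 ∨ (b = m - 1 ∧ m % 4 = 2) ∨ (m = 12 ∧ b = 7) ∨ (m = 30 ∧ (b = 11 ∨ b = 19)) := by
  have hb' := Finset.mem_Icc.mp hb
  have h1 : 1 ∈ Finset.Icc 1 (m - 1) := by rw [Finset.mem_Icc]; omega
  have hT : (4 * m : ℤ) ∣ (b : ℤ) ^ 2 - 1 := by
    have := hc.four_mul_dvd h1 hb h
    rw [← neg_sub] at this
    simpa using (dvd_neg.mp this)
  have hG : GaloisPositive m b := by
    intro l q hl0 hlm hodd hco h2 h3
    lift l to ℕ using hl0.le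
    have hcop : l.Coprime (2 * m) := by
      refine Nat.Coprime.mul_right ?_ (Nat.isCoprime_iff_coprime.mp hco)
      exact (Nat.coprime_two_right).mpr ((Int.odd_coe_nat l).mp hodd)
    have h4 := hc.zsign_mul_eq h1 hb h hcop
    rw [mul_one, zsign_natCast (by rw [Finset.mem_Icc]; omega)] at h4
    have h5 : ((l * b : ℕ) : ZMod (2 * m)).val = (l * b - 2 * m * q : ℤ).toNat := by
      rw [ZMod.val_natCast]
      zify
      rw [Int.toNat_of_nonneg (by linarith)]
      rw [show (l * b : ℤ) = (l * b - 2 * m * q) + 2 * m * q by ring, Int.add_mul_emod_self_left,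
        Int.emod_eq_of_lt (by linarith) (by linarith)]
      ring
    rw [zsign, h5] at h4
    -- multiplication by `l` keeps `1` in `(0, m)` and takes `b` to `(m, 2m)`
    split_ifs at h4 <;> omega
  rcases galoisPositive_classification (by omega) (by omega) hT hG with h2 | ⟨h2, h3⟩ | h2 | h2 <;>
    omega

end invariant

/-! ### Modular invariants whose first row is concentrated at `1` -/

variable {m : ℕ} [NeZero m] {c : ℕ → ℕ → ℕ}

/-- If the rows and columns of a non-negative matrix scale the positive vector `w` at most by `K`,
then `c cᵀ` scales it at most by `K²`. -/
lemma sum_mul_transpose_le {I : Finset ℕ} {w : ℕ → ℝ} {K : ℝ} (hK : 0 ≤ K)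
    (hcol : ∀ b ∈ I, ∑ x ∈ I, c x b * w x ≤ K * w b)
    (hrow : ∀ a ∈ I, ∑ x ∈ I, c a x * w x ≤ K * w a) {a : ℕ} (ha : a ∈ I) :
    ∑ b ∈ I, ((∑ x ∈ I, c a x * c b x : ℕ) : ℝ) * w b ≤ K ^ 2 * w a := by
  calc _ = ∑ x ∈ I, c a x * ∑ b ∈ I, c b x * w b := by
        push_cast
        simp_rw [Finset.sum_mul, Finset.mul_sum]
        rw [Finset.sum_comm]
        exact Finset.sum_congr rfl fun x _ => Finset.sum_congr rfl fun b _ => by ring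
    _ ≤ ∑ x ∈ I, c a x * (K * w x) := Finset.sum_le_sum fun x hx =>
        mul_le_mul_of_nonneg_left (hcol x hx) (Nat.cast_nonneg _)
    _ = K * ∑ x ∈ I, c a x * w x := by
        rw [Finset.mul_sum]; exact Finset.sum_congr rfl fun x _ => by ring
    _ ≤ K * (K * w a) := mul_le_mul_of_nonneg_left (hrow a ha) hK
    _ = _ := by ring

lemma exists_ne_zero_of_sum_pos {I : Finset ℕ} {f : ℕ → ℕ} {w : ℕ → ℝ}
    (h : 0 < ∑ x ∈ I, f x * w x) : ∃ x ∈ I, f x ≠ 0 := by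
  by_contra! h0
  rw [Finset.sum_eq_zero fun x hx => by rw [h0 x hx]; simp] at h
  exact lt_irrefl _ h

/-- In a sum of non-negative terms, all terms outside of `T` vanish if `T` exhausts the sum. -/
lemma eq_zero_of_sum_le {I T : Finset ℕ} {f : ℕ → ℕ} {w : ℕ → ℝ} (hw : ∀ x ∈ I, 0 < w x)
    (hT : T ⊆ I) (h : ∑ x ∈ I, f x * w x ≤ ∑ x ∈ T, f x * w x) {y : ℕ} (hy : y ∈ I)
    (hyT : y ∉ T) : f y = 0 := by
  rw [← Finset.sum_sdiff hT] at h
  have hnn : ∀ x ∈ I \ T, 0 ≤ (f x : ℝ) * w x := fun x hx =>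
    mul_nonneg (Nat.cast_nonneg _) (hw x (Finset.mem_sdiff.mp hx).1).le
  have h1 : ∑ x ∈ I \ T, (f x : ℝ) * w x = 0 :=
    le_antisymm (by linarith) (Finset.sum_nonneg hnn)
  have h2 := (Finset.sum_eq_zero_iff_of_nonneg hnn).mp h1 y (Finset.mem_sdiff.mpr ⟨hy, hyT⟩)
  exact_mod_cast (mul_eq_zero.mp h2).resolve_right (hw y hy).ne'

omit [NeZero m] in
lemma reflect_mem {x : ℕ} (hx : x ∈ Finset.Icc 1 (m - 1)) : m - x ∈ Finset.Icc 1 (m - 1) := by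
  rw [Finset.mem_Icc] at hx ⊢; omega

lemma sineVal_reflect {x : ℕ} (hx : x ∈ Finset.Icc 1 (m - 1)) :
    sineVal m ((m - x : ℕ) : ℤ) = sineVal m x := by
  rw [Finset.mem_Icc] at hx
  exact sineVal_eq (Or.inr ⟨0, by omega⟩)

lemma eq_or_add_eq_of_sineVal_eq {x y : ℕ} (hx : x ∈ Finset.Icc 1 (m - 1))
    (hy : y ∈ Finset.Icc 1 (m - 1)) (h : sineVal m x = sineVal m y) : x = y ∨ x + y = m := by
  rw [Finset.mem_Icc] at hx hy
  have := sineVal_inj (m := m) (x := x) (y := y) (by omega) (by omega) (by omega) (by omega) h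
  omega

/-- If both the first row and the first column are concentrated at `1`, each row has exactly one
non-zero entry; it equals `1` and sits on the diagonal or on the antidiagonal. -/
lemma exists_unique_entry
    (hcol : ∀ b ∈ Finset.Icc 1 (m - 1),
      ∑ x ∈ Finset.Icc 1 (m - 1), c x b * sineVal m x = sineVal m b)
    (hrow : ∀ a ∈ Finset.Icc 1 (m - 1),
      ∑ x ∈ Finset.Icc 1 (m - 1), c a x * sineVal m x = sineVal m a)
    {a : ℕ} (ha : a ∈ Finset.Icc 1 (m - 1)) :
    ∃ p ∈ Finset.Icc 1 (m - 1), (p = a ∨ p + a = m) ∧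
      ∀ x ∈ Finset.Icc 1 (m - 1), c a x = if x = p then 1 else 0 := by
  set I := Finset.Icc 1 (m - 1) with hI
  have hsq := sum_mul_transpose_le (c := c) (I := I) (w := fun x => sineVal m x) zero_le_one
    (fun b hb => by rw [one_mul]; exact (hcol b hb).le)
    (fun b hb => by rw [one_mul]; exact (hrow b hb).le) ha
  have hle : ∑ x ∈ I, c a x * c a x ≤ 1 := by
    have h1 : ((∑ x ∈ I, c a x * c a x : ℕ) : ℝ) * sineVal m a ≤ 1 * sineVal m a := by
      refine le_trans ?_ (hsq.trans (by rw [one_pow]))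
      exact Finset.single_le_sum (f := fun b => ((∑ x ∈ I, c a x * c b x : ℕ) : ℝ) * sineVal m b)
        (fun b hb => mul_nonneg (Nat.cast_nonneg _) (sineVal_pos_of_mem hb).le) ha
    exact_mod_cast le_of_mul_le_mul_right h1 (sineVal_pos_of_mem ha)
  obtain ⟨p, hp, hp0⟩ := exists_ne_zero_of_sum_pos (f := c a) (w := fun x => sineVal m x)
    ((sineVal_pos_of_mem ha).trans_eq (hrow a ha).symm)
  rw [← Finset.add_sum_erase I _ hp] at hle
  have hp1 : c a p = 1 := by
    have : 1 ≤ c a p := Nat.one_le_iff_ne_zero.mpr hp0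
    nlinarith [Nat.zero_le (∑ x ∈ I.erase p, c a x * c a x)]
  have hsum : ∑ x ∈ I.erase p, c a x * c a x = 0 := by rw [hp1] at hle; omega
  have hx0 : ∀ x ∈ I, x ≠ p → c a x = 0 := fun x hx hxp => by
    have := Finset.sum_eq_zero_iff.mp hsum x (Finset.mem_erase.mpr ⟨hxp, hx⟩)
    simpa using this
  have hform : ∀ x ∈ I, c a x = if x = p then 1 else 0 := fun x hx => by
    split_ifs with h
    · rw [h, hp1]
    · exact hx0 x hx h
  refine ⟨p, hp, ?_, hform⟩
  have h2 := hrow a ha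
  rw [Finset.sum_eq_single p (fun x hx hxp => by rw [hx0 x hx hxp]; simp) (fun h => absurd hp h),
    hp1, Nat.cast_one, one_mul] at h2
  exact eq_or_add_eq_of_sineVal_eq hp ha h2

lemma IsModularInvariant.column_sum_of_delta (hc : IsModularInvariant m c)
    (h : ∀ x ∈ Finset.Icc 1 (m - 1), x ≠ 1 → c 1 x = 0) {b : ℕ}
    (hb : b ∈ Finset.Icc 1 (m - 1)) :
    ∑ x ∈ Finset.Icc 1 (m - 1), c x b * sineVal m x = sineVal m b := by
  have h1 : 1 ∈ Finset.Icc 1 (m - 1) := by rw [Finset.mem_Icc] at hb ⊢; omega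
  rw [hc.column_sum hb, Finset.sum_eq_single 1 (fun x hx hx1 => by rw [h x hx hx1]; simp)
    (fun h => absurd h1 h), hc.one_one]
  simp

/-- The invariants whose first row is concentrated at `1` have type `A`, or type `D` with `4 ∣ m`.
They are permutations, and the relation with the `S`-matrix determines the image of `a` from the
image `p2` of `2`. -/
lemma IsModularInvariant.eq_of_delta (hc : IsModularInvariant m c)
    (h : ∀ x ∈ Finset.Icc 1 (m - 1), x ≠ 1 → c 1 x = 0) :
    (∀ a ∈ Finset.Icc 1 (m - 1), ∀ b ∈ Finset.Icc 1 (m - 1), c a b = if a = b then 1 else 0) ∨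
    (m % 4 = 0 ∧ 8 ≤ m ∧ ∀ a ∈ Finset.Icc 1 (m - 1), ∀ b ∈ Finset.Icc 1 (m - 1),
      c a b = if a % 2 = 1 then (if a = b then 1 else 0) else (if a + b = m then 1 else 0)) := by
  by_cases hm3 : 3 ≤ m
  swap
  · left
    intro a ha b hb
    rw [Finset.mem_Icc] at ha hb
    obtain rfl : a = 1 := by omega
    obtain rfl : b = 1 := by omega
    rw [hc.one_one, if_pos rfl]
  set I := Finset.Icc 1 (m - 1) with hI
  have hmem : ∀ x, x ∈ I ↔ 1 ≤ x ∧ x ≤ m - 1 := fun x => Finset.mem_Icc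
  have h1 : 1 ∈ I := by rw [hmem]; omega
  have h2 : 2 ∈ I := by rw [hmem]; omega
  have hcol := fun b (hb : b ∈ I) => hc.column_sum_of_delta h hb
  have h' : ∀ x ∈ I, x ≠ 1 → c x 1 = 0 := fun x hx hx1 =>
    eq_zero_of_sum_le (f := fun x => c x 1) (w := fun x => sineVal m x) (T := {1})
      (fun x hx => sineVal_pos_of_mem hx) (Finset.singleton_subset_iff.mpr h1)
      (by rw [hcol 1 h1, Finset.sum_singleton, hc.one_one]; simp) hx (by simpa using hx1)
  have hrow := fun b (hb : b ∈ I) => hc.transpose.column_sum_of_delta h' hb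
  have hperm := fun a (ha : a ∈ I) => exists_unique_entry hcol hrow ha
  obtain ⟨p2, hp2, hp2', hc2⟩ := exists_unique_entry (c := fun a b => c b a) hrow hcol h2
  -- the `(a, 2)` entry of the relation with the `S`-matrix
  have hS : ∀ a ∈ I, ∀ p ∈ I, (∀ x ∈ I, c a x = if x = p then 1 else 0) →
      sineVal m (a * p2) = sineVal m (p * 2) := by
    intro a ha p hp hform
    have := hc.sineVal_comm ha h2
    rw [Finset.sum_eq_single p2 (fun x hx hxp => by rw [hc2 x hx, if_neg hxp]; simp)
      (fun h => absurd hp2 h), Finset.sum_eq_single p (fun x hx hxp => by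
      rw [hform x hx, if_neg hxp]; simp) (fun h => absurd hp h), hc2 p2 hp2, hform p hp,
      if_pos rfl, if_pos rfl] at this
    simpa using this
  have hdouble : ∀ a ∈ I, sineVal m (a * 2) = 0 → a + a = m := by
    intro a ha h0
    rw [hmem] at ha
    rcases lt_trichotomy (a + a) m with h3 | h3 | h3
    · exact absurd h0 (sineVal_pos (by omega) (by omega)).ne'
    · exact h3
    · have h4 : sineVal m (a * 2) = -sineVal m (2 * a - m) := sineVal_eq_neg (Or.inr ⟨0, by ring⟩)
      rw [h4, neg_eq_zero] at h0
      exact absurd h0 (sineVal_pos (by omega) (by omega)).ne'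
  have hflip : ∀ a p : ℕ, p + a = m → sineVal m (p * 2) = -sineVal m (a * 2) := fun a p hp =>
    sineVal_eq_neg (Or.inl ⟨1, by push_cast [← hp]; ring⟩)
  by_cases hp22 : p2 = 2
  · subst hp22
    left
    intro a ha b hb
    obtain ⟨p, hp, hpa, hform⟩ := hperm a ha
    have hpa' : p = a := by
      rcases hpa with h3 | h3
      · exact h3
      · have h4 := hS a ha p hp hform
        rw [hflip a p h3] at h4
        have := hdouble a ha (by push_cast at h4; linarith)
        omega
    rw [hform b hb, hpa']
    simp only [eq_comm]
  · have hp2m := hp2'.resolve_left hp22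
    right
    have hc2' : c p2 2 ≠ 0 := by
      have : c p2 2 = _ := hc2 p2 hp2
      rw [this]; simp
    have hm4 : m % 4 = 0 := by
      obtain ⟨t, ht⟩ := hc.four_mul_dvd hp2 h2 hc2'
      obtain ⟨q, hq⟩ : ∃ q : ℤ, q = p2 := ⟨_, rfl⟩
      have hm' : (m : ℤ) = q + 2 := by omega
      have h5 : (m : ℤ) * (q - 2) = m * (4 * t) := by
        push_cast at ht
        rw [← hq] at ht
        rw [mul_left_comm, ← mul_assoc, ← ht, hm']
        ring
      have h6 := mul_left_cancel₀ (by exact_mod_cast NeZero.ne m) h5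
      omega
    refine ⟨hm4, by omega, fun a ha b hb => ?_⟩
    obtain ⟨p, hp, hpa, hform⟩ := hperm a ha
    have h4 := hS a ha p hp hform
    have hp2z : (p2 : ℤ) = m - 2 := by omega
    rw [hp2z] at h4
    rw [hform b hb]
    by_cases hodd : a % 2 = 1
    · rw [if_pos hodd]
      have h5 : sineVal m (a * (m - 2)) = sineVal m (a * 2) :=
        sineVal_eq (Or.inr ⟨(a / 2 : ℕ), by
          have : (a : ℤ) = 2 * (a / 2 : ℕ) + 1 := by omega
          linear_combination (m : ℤ) * this⟩)
      have hpa' : p = a := by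
        rcases hpa with h3 | h3
        · exact h3
        · rw [hflip a p h3, h5] at h4
          have := hdouble a ha (by linarith)
          omega
      rw [hpa']
      simp only [eq_comm]
    · rw [if_neg hodd]
      have h5 : sineVal m (a * (m - 2)) = -sineVal m (a * 2) :=
        sineVal_eq_neg (Or.inl ⟨(a / 2 : ℕ), by
          have : (a : ℤ) = 2 * (a / 2 : ℕ) := by omega
          linear_combination (m : ℤ) * this⟩)
      have hpa' : p + a = m := by
        rcases hpa with rfl | h3
        · rw [h5] at h4
          exact hdouble p ha (by linarith)
        · exact h3
      have : b = p ↔ a + b = m := by omega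
      simp only [this]

/-! ### Modular invariants of type `D` and `E₇` -/

variable {m h : ℕ} [NeZero m] {c : ℕ → ℕ → ℕ}

/-- A modular invariant whose first row has exactly the two non-zero entries at `1` and `m - 1`; the
middle index is `h = m / 2`. -/
structure IsFoldedInvariant (m h : ℕ) [NeZero m] (c : ℕ → ℕ → ℕ) : Prop where
  isModularInvariant : IsModularInvariant m c
  two_mul : m = 2 * h
  odd : h % 2 = 1
  three_le : 3 ≤ h
  row_one : ∀ x ∈ Finset.Icc 1 (m - 1), x ≠ 1 → x ≠ m - 1 → c 1 x = 0
  last : c 1 (m - 1) ≠ 0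

namespace IsFoldedInvariant

omit [NeZero m] in
lemma mem_iff {x : ℕ} : x ∈ Finset.Icc 1 (m - 1) ↔ 1 ≤ x ∧ x ≤ m - 1 := Finset.mem_Icc

lemma one_mem (H : IsFoldedInvariant m h c) : 1 ∈ Finset.Icc 1 (m - 1) := by
  have := H.two_mul; have := H.three_le; rw [mem_iff]; omega

lemma last_mem (H : IsFoldedInvariant m h c) : m - 1 ∈ Finset.Icc 1 (m - 1) := by
  have := H.two_mul; have := H.three_le; rw [mem_iff]; omega

lemma mid_mem (H : IsFoldedInvariant m h c) : h ∈ Finset.Icc 1 (m - 1) := by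
  have := H.two_mul; have := H.three_le; rw [mem_iff]; omega

lemma column_sum_aux (H : IsFoldedInvariant m h c) {b : ℕ} (hb : b ∈ Finset.Icc 1 (m - 1)) :
    ∑ x ∈ Finset.Icc 1 (m - 1), c x b * sineVal m x =
      sineVal m b + c 1 (m - 1) * sineVal m ((m - 1) * b) := by
  have h3 := H.three_le
  have h2 := H.two_mul
  rw [H.isModularInvariant.column_sum hb, ← Finset.sum_subset (s₁ := {1, m - 1}),
    Finset.sum_pair (by omega), H.isModularInvariant.one_one]
  · push_cast [show 1 ≤ m by omega]
    simp
  · intro x hx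
    rw [Finset.mem_insert, Finset.mem_singleton] at hx
    rcases hx with rfl | rfl
    · exact H.one_mem
    · exact H.last_mem
  · intro x hx hx'
    rw [Finset.mem_insert, Finset.mem_singleton, not_or] at hx'
    rw [H.row_one x hx hx'.1 hx'.2]; simp

lemma column_sum_nonneg (b : ℕ) :
    0 ≤ ∑ x ∈ Finset.Icc 1 (m - 1), c x b * sineVal m x :=
  Finset.sum_nonneg fun _ hx => mul_nonneg (Nat.cast_nonneg _) (sineVal_pos_of_mem hx).le

/-- The sum over column `2` is `(1 - c 1 (m-1)) sin(2π/m)`, and it is non-negative. -/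
lemma last_eq (H : IsFoldedInvariant m h c) : c 1 (m - 1) = 1 := by
  have h3 := H.three_le
  have h2 := H.two_mul
  have h2m : 2 ∈ Finset.Icc 1 (m - 1) := by rw [mem_iff]; omega
  have h1 := H.column_sum_aux h2m
  have h4 := column_sum_nonneg (m := m) (c := c) 2
  rw [h1, sineVal_eq_neg (x := (m - 1) * (2 : ℕ)) (y := (2 : ℕ)) (Or.inl ⟨1, by push_cast; ring⟩)]
    at h4
  have hpos := sineVal_pos_of_mem h2m
  have h5 : (c 1 (m - 1) : ℝ) * sineVal m (2 : ℕ) ≤ 1 * sineVal m (2 : ℕ) := by linarith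
  have h6 : c 1 (m - 1) ≤ 1 := by exact_mod_cast le_of_mul_le_mul_right h5 hpos
  have := H.last
  omega

lemma column_sum_odd (H : IsFoldedInvariant m h c) {b : ℕ} (hb : b ∈ Finset.Icc 1 (m - 1))
    (hodd : b % 2 = 1) : ∑ x ∈ Finset.Icc 1 (m - 1), c x b * sineVal m x = 2 * sineVal m b := by
  rw [H.column_sum_aux hb, H.last_eq, sineVal_eq (x := (m - 1) * b) (y := b)
    (Or.inr ⟨(b / 2 : ℕ), by
      have : (b : ℤ) = 2 * (b / 2 : ℕ) + 1 := by omega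
      linear_combination (m : ℤ) * this⟩)]
  push_cast; ring

lemma column_even (H : IsFoldedInvariant m h c) {a b : ℕ} (ha : a ∈ Finset.Icc 1 (m - 1))
    (hb : b ∈ Finset.Icc 1 (m - 1)) (heven : b % 2 = 0) : c a b = 0 := by
  have h1 := H.column_sum_aux hb
  rw [H.last_eq, sineVal_eq_neg (x := (m - 1) * b) (y := b)
    (Or.inl ⟨(b / 2 : ℕ), by
      have : (b : ℤ) = 2 * (b / 2 : ℕ) := by omega
      linear_combination (m : ℤ) * this⟩)] at h1
  refine eq_zero_of_sum_le (f := fun x => c x b) (w := fun x => sineVal m x) (T := ∅)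
    (fun x hx => sineVal_pos_of_mem hx) (Finset.empty_subset _) ?_ ha (Finset.notMem_empty _)
  rw [Finset.sum_empty, h1]
  push_cast; linarith

/-- The sum over the first column is `2 sin(π/m)`, which leaves room for just one further entry; it
sits where the sine is as small as at `1`. -/
lemma transpose (H : IsFoldedInvariant m h c) : IsFoldedInvariant m h fun a b => c b a := by
  have h3 := H.three_le
  have h2 := H.two_mul
  have hsum := H.column_sum_odd H.one_mem rfl
  obtain ⟨x, hx, hx0⟩ : ∃ x ∈ (Finset.Icc 1 (m - 1)).erase 1, c x 1 ≠ 0 := by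
    refine exists_ne_zero_of_sum_pos (w := fun x => sineVal m x) ?_
    rw [← Finset.add_sum_erase _ _ H.one_mem, H.isModularInvariant.one_one] at hsum
    have := sineVal_pos_of_mem H.one_mem
    push_cast at hsum this ⊢
    linarith
  rw [Finset.mem_erase] at hx
  have hx1 := mem_iff.mp hx.2
  have hterm : ∀ y ∈ Finset.Icc 1 (m - 1), y ≠ 1 →
      (c 1 1 : ℝ) * sineVal m (1 : ℕ) + c y 1 * sineVal m y ≤ 2 * sineVal m (1 : ℕ) := by
    intro y hy hy1
    rw [← hsum, ← Finset.sum_pair (f := fun y => (c y 1 : ℝ) * sineVal m y) (Ne.symm hy1)]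
    refine Finset.sum_le_sum_of_subset_of_nonneg ?_ fun z hz _ =>
      mul_nonneg (Nat.cast_nonneg _) (sineVal_pos_of_mem hz).le
    intro z hz
    rw [Finset.mem_insert, Finset.mem_singleton] at hz
    rcases hz with rfl | rfl
    exacts [H.one_mem, hy]
  have hzero : ∀ y ∈ Finset.Icc 1 (m - 1), y ≠ 1 → y ≠ m - 1 → c y 1 = 0 := by
    intro y hy hy1 hylast
    by_contra hne
    have h5 := hterm y hy hy1
    rw [H.isModularInvariant.one_one] at h5
    have h6 : sineVal m (1 : ℕ) < sineVal m y := by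
      have := mem_iff.mp hy
      exact sineVal_lt (by omega) (by omega) (by omega)
    have h7 : (1 : ℝ) ≤ c y 1 := by exact_mod_cast Nat.one_le_iff_ne_zero.mpr hne
    have h8 := sineVal_pos_of_mem hy
    push_cast at h5 h6
    nlinarith
  refine ⟨H.isModularInvariant.transpose, h2, H.odd, h3, hzero, ?_⟩
  have hxl : x = m - 1 := by
    by_contra hne
    exact hx0 (hzero x hx.2 hx.1 hne)
  rwa [hxl] at hx0

/-- The columns are invariant under the reflection `b ↦ m - b`.  Translation by `m` multiplies the
Fourier transform of a row by `(-1)^x`, and even columns vanish. -/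
lemma reflect_column (H : IsFoldedInvariant m h c) {a b : ℕ} (ha : a ∈ Finset.Icc 1 (m - 1))
    (hb : b ∈ Finset.Icc 1 (m - 1)) : c a (m - b) = c a b := by
  have hchar : ∀ x : ℤ, ZMod.stdAddChar ((x : ZMod (2 * m)) * (m : ZMod (2 * m))) =
      ((-1 : ℂ)) ^ (x.natAbs) := by
    intro x
    have h1 := ZMod.stdAddChar_coe (N := 2 * m) (x * m)
    have hm0 : (m : ℂ) ≠ 0 := by exact_mod_cast NeZero.ne m
    push_cast at h1
    rw [h1, show (2 * Real.pi * Complex.I * (x * m) / (2 * m) : ℂ) = x * (Real.pi * Complex.I) by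
      field_simp, Complex.exp_int_mul, Complex.exp_pi_mul_I]
    rcases Int.natAbs_eq x with h2 | h2
    · nth_rw 1 [h2]; rw [zpow_natCast]
    · nth_rw 1 [h2]; rw [zpow_neg, zpow_natCast, ← inv_pow]; norm_num
  have hzero : ∀ r : ZMod (2 * m), ∀ x : ℤ, Even x → oddExt m c r (x : ZMod (2 * m)) = 0 := by
    intro r x hx
    obtain ⟨t, rfl⟩ := hx
    have key : ∀ s ∈ Finset.Icc 1 (m - 1), oddExt m c (s : ZMod (2 * m))
        ((t + t : ℤ) : ZMod (2 * m)) = 0 := by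
      intro s hs
      rcases zmod_cases ((t + t : ℤ) : ZMod (2 * m)) with h1 | h1 | ⟨y, hy, h1⟩
      · rw [h1, oddExt, zsign_zero]; ring
      · rw [h1, oddExt, zsign_self]; ring
      · have hye : y % 2 = 0 := by
          rcases h1 with h1 | h1
          · have h2 : ((t + t - y : ℤ) : ZMod (2 * m)) = 0 := by
              push_cast at h1 ⊢
              rw [h1, sub_self]
            obtain ⟨w, hw⟩ := (ZMod.intCast_zmod_eq_zero_iff_dvd _ _).mp h2
            push_cast at hw
            have h3 : (y : ℤ) = 2 * (t - m * w) := by linear_combination -hw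
            omega
          · have h2 : ((t + t + y : ℤ) : ZMod (2 * m)) = 0 := by
              push_cast at h1 ⊢
              rw [h1, neg_add_cancel]
            obtain ⟨w, hw⟩ := (ZMod.intCast_zmod_eq_zero_iff_dvd _ _).mp h2
            push_cast at hw
            have h3 : (y : ℤ) = 2 * (m * w - t) := by linear_combination hw
            omega
        have h3 : oddExt m c (s : ZMod (2 * m)) (y : ZMod (2 * m)) = 0 := by
          rw [oddExt_natCast c hs hy, H.column_even hs hy hye, Nat.cast_zero]
        rcases h1 with h1 | h1
        · rw [h1, h3]
        · rw [h1, oddExt_neg_right, h3, neg_zero]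
    rcases zmod_cases r with rfl | rfl | ⟨s, hs, rfl | rfl⟩
    · rw [oddExt, zsign_zero]; ring
    · rw [oddExt, zsign_self]; ring
    · exact key s hs
    · rw [oddExt_neg_left, key s hs, neg_zero]
  have hshift := eq_of_sum_stdAddChar_eq (N := 2 * m)
    (f := fun y => (oddExt m c (a : ZMod (2 * m)) (y + m) : ℂ))
    (g := fun y => -(oddExt m c (a : ZMod (2 * m)) y : ℂ)) 1 (fun x => by
      obtain ⟨x, rfl⟩ := ZMod.intCast_surjective x
      have h1 : ∑ y, (oddExt m c (a : ZMod (2 * m)) (y + m) : ℂ) *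
          ZMod.stdAddChar (-((x : ZMod (2 * m)) * y)) =
          (-1 : ℂ) ^ x.natAbs * ∑ y, (oddExt m c (a : ZMod (2 * m)) y : ℂ) *
            ZMod.stdAddChar (-((x : ZMod (2 * m)) * y)) := by
        rw [← Equiv.sum_comp (Equiv.addRight (m : ZMod (2 * m))) fun y =>
          (oddExt m c (a : ZMod (2 * m)) y : ℂ) * ZMod.stdAddChar (-((x : ZMod (2 * m)) * y)),
          Finset.mul_sum]
        refine Finset.sum_congr rfl fun y _ => ?_
        have h2 : -((x : ZMod (2 * m)) * y) =
            -((x : ZMod (2 * m)) * (y + (m : ZMod (2 * m)))) + (x : ZMod (2 * m)) * m := by ring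
        rw [Equiv.coe_addRight, h2, AddChar.map_add_eq_mul, hchar]
        ring
      simp only [Units.val_one, one_mul, neg_mul, Finset.sum_neg_distrib]
      rw [h1]
      rcases Int.even_or_odd x with hx | hx
      · rw [← H.isModularInvariant.fourier]
        simp [hzero _ x hx]
      · rw [Odd.neg_one_pow (Int.natAbs_odd.mpr hx), neg_one_mul]) (b : ZMod (2 * m))
  simp only [Units.val_one, one_mul] at hshift
  have hb' := mem_iff.mp hb
  have h1 : (b : ZMod (2 * m)) + m = -((m - b : ℕ) : ZMod (2 * m)) := by
    rw [Nat.cast_sub (by omega)]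
    linear_combination (-1 : ZMod (2 * m)) * (neg_natCast_self m)
  rw [h1, oddExt_neg_right, oddExt_natCast c ha (reflect_mem hb), oddExt_natCast c ha hb] at hshift
  push_cast at hshift
  exact_mod_cast neg_injective hshift

lemma reflect_row (H : IsFoldedInvariant m h c) {a b : ℕ} (ha : a ∈ Finset.Icc 1 (m - 1))
    (hb : b ∈ Finset.Icc 1 (m - 1)) : c (m - a) b = c a b := H.transpose.reflect_column hb ha

lemma row_even (H : IsFoldedInvariant m h c) {a b : ℕ} (ha : a ∈ Finset.Icc 1 (m - 1))
    (hb : b ∈ Finset.Icc 1 (m - 1)) (heven : a % 2 = 0) : c a b = 0 :=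
  H.transpose.column_even hb ha heven

lemma row_sum_odd (H : IsFoldedInvariant m h c) {a : ℕ} (ha : a ∈ Finset.Icc 1 (m - 1))
    (hodd : a % 2 = 1) : ∑ x ∈ Finset.Icc 1 (m - 1), c a x * sineVal m x = 2 * sineVal m a :=
  H.transpose.column_sum_odd ha hodd

lemma column_sum_le (H : IsFoldedInvariant m h c) {b : ℕ} (hb : b ∈ Finset.Icc 1 (m - 1)) :
    ∑ x ∈ Finset.Icc 1 (m - 1), c x b * sineVal m x ≤ 2 * sineVal m b := by
  rcases Nat.mod_two_eq_zero_or_one b with h0 | h1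
  · rw [Finset.sum_eq_zero fun x hx => by rw [H.column_even hx hb h0]; simp]
    have := sineVal_pos_of_mem hb
    linarith
  · exact (H.column_sum_odd hb h1).le

/-- A row of odd index `a ≠ h` is concentrated on `{a, m - a}` or on the middle index `h`. -/
lemma row_cases (H : IsFoldedInvariant m h c) {a : ℕ} (ha : a ∈ Finset.Icc 1 (m - 1))
    (hodd : a % 2 = 1) (hah : a ≠ h) :
    (∀ x ∈ Finset.Icc 1 (m - 1), c a x = if x = a ∨ x + a = m then 1 else 0) ∨
    ((∀ x ∈ Finset.Icc 1 (m - 1), c a x = if x = h then 1 else 0) ∧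
      sineVal m h = 2 * sineVal m a) := by
  have h3 := H.three_le
  have h2 := H.two_mul
  have ha' := mem_iff.mp ha
  set I := Finset.Icc 1 (m - 1) with hI
  have hpos := sineVal_pos_of_mem ha
  have hsq := sum_mul_transpose_le (c := c) (I := I) (w := fun x => sineVal m x) zero_le_two
    (fun b hb => H.column_sum_le hb) (fun b hb => H.transpose.column_sum_le hb) ha
  have hle : ∑ x ∈ I, c a x * c a x ≤ 2 := by
    have h1 : ∑ b ∈ ({a, m - a} : Finset ℕ),
        ((∑ x ∈ I, c a x * c b x : ℕ) : ℝ) * sineVal m b ≤ 2 ^ 2 * sineVal m a := by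
      refine le_trans ?_ hsq
      refine Finset.sum_le_sum_of_subset_of_nonneg ?_ fun b hb _ =>
        mul_nonneg (Nat.cast_nonneg _) (sineVal_pos_of_mem hb).le
      intro z hz
      rw [Finset.mem_insert, Finset.mem_singleton] at hz
      rcases hz with rfl | rfl
      exacts [ha, reflect_mem ha]
    rw [Finset.sum_pair (by omega), sineVal_reflect ha] at h1
    have h4 : ∑ x ∈ I, c a x * c (m - a) x = ∑ x ∈ I, c a x * c a x :=
      Finset.sum_congr rfl fun x hx => by rw [H.reflect_row ha hx]
    rw [h4] at h1
    have h5 : ((∑ x ∈ I, c a x * c a x : ℕ) : ℝ) * sineVal m a ≤ 2 * sineVal m a := by linarith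
    exact_mod_cast le_of_mul_le_mul_right h5 hpos
  have hrow := H.row_sum_odd ha hodd
  obtain ⟨x, hx, hx0⟩ := exists_ne_zero_of_sum_pos (f := c a) (w := fun x => sineVal m x)
    (by rw [hrow]; linarith)
  have hx' := mem_iff.mp hx
  have hsub : ∀ T ⊆ I, ∑ y ∈ T, c a y * c a y ≤ 2 := fun T hT =>
    (Finset.sum_le_sum_of_subset hT).trans hle
  have hge : ∀ y, c a y ≠ 0 → 1 ≤ c a y * c a y := fun y hy =>
    Nat.one_le_iff_ne_zero.mpr (mul_ne_zero hy hy)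
  by_cases hxh : x = h
  · right
    subst hxh
    have hx1 : c a x = 1 := by
      have := hsub {x} (Finset.singleton_subset_iff.mpr hx)
      rw [Finset.sum_singleton] at this
      have : c a x ≤ 1 := by nlinarith
      omega
    have hform : ∀ y ∈ I, c a y = if y = x then 1 else 0 := by
      intro y hy
      split_ifs with hyx
      · rw [hyx, hx1]
      · by_contra hne
        have hy' := mem_iff.mp hy
        have h5 := hsub {x, y, m - y} (by
          intro z hz
          simp only [Finset.mem_insert, Finset.mem_singleton] at hz
          rcases hz with rfl | rfl | rfl
          exacts [hx, hy, reflect_mem hy])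
        rw [Finset.sum_insert (by simp only [Finset.mem_insert, Finset.mem_singleton]; omega),
          Finset.sum_pair (by omega), H.reflect_column ha hy] at h5
        have := hge x hx0
        have := hge y hne
        omega
    refine ⟨hform, ?_⟩
    rw [← hrow, Finset.sum_eq_single x (fun y hy hyx => by rw [hform y hy, if_neg hyx]; simp)
      (fun h => absurd hx h), hx1, Nat.cast_one, one_mul]
  · left
    have hne : x ≠ m - x := by omega
    have hxr := reflect_mem hx
    have hcr := H.reflect_column ha hx
    have hx1 : c a x = 1 := by
      have := hsub {x, m - x} (by
        intro z hz
        rw [Finset.mem_insert, Finset.mem_singleton] at hz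
        rcases hz with rfl | rfl
        exacts [hx, hxr])
      rw [Finset.sum_pair hne, hcr] at this
      have : c a x ≤ 1 := by nlinarith
      omega
    have hform : ∀ y ∈ I, c a y = if y = x ∨ y + x = m then 1 else 0 := by
      intro y hy
      split_ifs with hyx
      · rcases hyx with rfl | hyx
        · exact hx1
        · rw [show y = m - x by omega, hcr, hx1]
      · by_contra hne0
        have h5 := hsub {x, m - x, y} (by
          intro z hz
          simp only [Finset.mem_insert, Finset.mem_singleton] at hz
          rcases hz with rfl | rfl | rfl
          exacts [hx, hxr, hy])
        rw [Finset.sum_insert (by simp only [Finset.mem_insert, Finset.mem_singleton]; omega),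
          Finset.sum_pair (by omega), hcr] at h5
        have := hge x hx0
        have := hge y hne0
        omega
    have h6 : ∑ y ∈ I, c a y * sineVal m y = 2 * sineVal m x := by
      rw [← Finset.sum_subset (s₁ := {x, m - x})]
      · rw [Finset.sum_pair hne, hcr, hx1, sineVal_reflect hx]; push_cast; ring
      · intro z hz
        rw [Finset.mem_insert, Finset.mem_singleton] at hz
        rcases hz with rfl | rfl
        exacts [hx, hxr]
      · intro y hy hyn
        rw [Finset.mem_insert, Finset.mem_singleton] at hyn
        rw [hform y hy, if_neg (by omega)]; simp
    have hxa : x = a ∨ x + a = m := eq_or_add_eq_of_sineVal_eq hx ha (by linarith)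
    intro y hy
    rw [hform y hy]
    have hiff : (y = x ∨ y + x = m) ↔ (y = a ∨ y + a = m) := by omega
    simp only [hiff]

lemma sineVal_mid (H : IsFoldedInvariant m h c) : sineVal m h = 1 := by
  have h0 : (h : ℝ) ≠ 0 := by have := H.three_le; positivity
  rw [sineVal, ← Real.sin_pi_div_two]
  congr 1
  have : (m : ℝ) = 2 * h := by exact_mod_cast H.two_mul
  rw [this]
  push_cast
  field_simp

/-- A row concentrated on the middle index has `sin(πa/m) = 1/2`. -/
lemma six_mul_eq (H : IsFoldedInvariant m h c) {a : ℕ} (ha : a ∈ Finset.Icc 1 (m - 1))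
    (hs : sineVal m h = 2 * sineVal m a) : 6 * a = m ∨ 6 * a = 5 * m := by
  have hm0 : (m : ℝ) ≠ 0 := by exact_mod_cast NeZero.ne m
  have ha' := mem_iff.mp ha
  have h1 : sineVal (6 * m) (6 * a : ℕ) = sineVal (6 * m) (m : ℕ) := by
    have e1 : sineVal (6 * m) (6 * a : ℕ) = sineVal m a := by
      rw [sineVal, sineVal]; congr 1; push_cast; field_simp
    have e2 : sineVal (6 * m) (m : ℕ) = 1 / 2 := by
      rw [sineVal, ← Real.sin_pi_div_six]; congr 1; push_cast; field_simp
    rw [e1, e2]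
    rw [H.sineVal_mid] at hs
    linarith
  have := sineVal_inj (m := 6 * m) (by omega) (by omega) (by omega) (by omega) h1
  omega

/-- If the central entry is `2`, the invariant has type `D`. -/
lemma eq_of_mid_eq_two (H : IsFoldedInvariant m h c) (hmid : c h h = 2) :
    ∀ a ∈ Finset.Icc 1 (m - 1), ∀ b ∈ Finset.Icc 1 (m - 1), c a b = if a % 2 = 1 then
      (if a = b then 1 else 0) + (if a + b = m then 1 else 0) else 0 := by
  intro a ha b hb
  have h2 := H.two_mul
  have hsub := Finset.singleton_subset_iff.mpr H.mid_mem
  by_cases hodd : a % 2 = 1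
  swap
  · rw [if_neg hodd]; exact H.row_even ha hb (by omega)
  rw [if_pos hodd]
  by_cases hah : a = h
  · subst hah
    by_cases hba : b = a
    · rw [hba, hmid, if_pos rfl, if_pos (by omega)]
    · rw [if_neg (Ne.symm hba), if_neg (by omega)]
      refine eq_zero_of_sum_le (f := c a) (w := fun x => sineVal m x) (T := {a})
        (fun x hx => sineVal_pos_of_mem hx) hsub ?_ hb (by simpa using hba)
      rw [H.row_sum_odd ha hodd, Finset.sum_singleton, hmid]
      simp
  · rcases H.row_cases ha hodd hah with h1 | ⟨h1, -⟩
    · rw [h1 b hb]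
      have : a = b → ¬ a + b = m := by omega
      by_cases h3 : a = b <;> by_cases h4 : a + b = m <;> simp_all [eq_comm, add_comm]
    · exfalso
      have h5 : c a h = 0 := by
        refine eq_zero_of_sum_le (f := fun x => c x h) (w := fun x => sineVal m x) (T := {h})
          (fun x hx => sineVal_pos_of_mem hx) hsub ?_ ha (by simpa using hah)
        rw [Finset.sum_singleton, hmid]
        simpa using H.column_sum_le H.mid_mem
      rw [h1 h H.mid_mem] at h5
      simp at h5

/-- If the central entry is not `2`, then `m = 18` and the third row is concentrated at `9`. -/
lemma third_row_of_mid_ne_two (H : IsFoldedInvariant m h c) (hmid : c h h ≠ 2) :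
    m = 18 ∧ ∀ x ∈ Finset.Icc 1 (m - 1), c 3 x = if x = h then 1 else 0 := by
  have h2 := H.two_mul
  have h3 := H.three_le
  have hho := H.odd
  -- some other row meets the middle column
  obtain ⟨a, ha, hah, ha0⟩ : ∃ a ∈ Finset.Icc 1 (m - 1), a ≠ h ∧ c a h ≠ 0 := by
    by_contra! hall
    have h4 := H.column_sum_odd H.mid_mem hho
    rw [Finset.sum_eq_single h (fun x hx hxh => by rw [hall x hx hxh]; simp)
      (fun h' => absurd H.mid_mem h')] at h4
    have h5 := mul_right_cancel₀ (sineVal_pos_of_mem H.mid_mem).ne' h4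
    exact hmid (by exact_mod_cast h5)
  have haodd : a % 2 = 1 := by
    by_contra hne
    exact ha0 (H.row_even ha H.mid_mem (by omega))
  have hrow : sineVal m h = 2 * sineVal m a := by
    rcases H.row_cases ha haodd hah with h1 | ⟨-, h1⟩
    · rw [h1 h H.mid_mem, if_neg (by omega)] at ha0
      exact absurd rfl ha0
    · exact h1
  -- after a reflection, `a = m / 6`
  obtain ⟨a, ha, ha6, ha0⟩ : ∃ a ∈ Finset.Icc 1 (m - 1), 6 * a = m ∧ c a h ≠ 0 := by
    rcases H.six_mul_eq ha hrow with h6 | h6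
    · exact ⟨a, ha, h6, ha0⟩
    · exact ⟨m - a, reflect_mem ha, by omega, by rwa [H.reflect_row ha H.mid_mem]⟩
  have ha' := mem_iff.mp ha
  have hform : ∀ x ∈ Finset.Icc 1 (m - 1), c a x = if x = h then 1 else 0 := by
    rcases H.row_cases ha (by omega) (by omega) with h1 | ⟨h1, -⟩
    · rw [h1 h H.mid_mem, if_neg (by omega)] at ha0
      exact absurd rfl ha0
    · exact h1
  obtain ⟨t, ht⟩ : ∃ t, a = 3 * t := by
    obtain ⟨s, hs⟩ := H.isModularInvariant.four_mul_dvd ha H.mid_mem ha0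
    have e1 : (h : ℤ) = 3 * a := by omega
    have e2 : (m : ℤ) = 6 * a := by omega
    rw [e1, e2] at hs
    have h5 : (a : ℤ) * (-8 * a) = a * (24 * s) := by linear_combination hs
    have h6 := mul_left_cancel₀ (by omega) h5
    exact ⟨a / 3, by omega⟩
  by_cases ht1 : t = 1
  · exact ⟨by omega, by rwa [ht, ht1] at hform⟩
  -- otherwise column `3` lies on `{3, m - 3}`, against the `(a, 3)` entry of the `S`-relation
  exfalso
  have h3m : 3 ∈ Finset.Icc 1 (m - 1) := by rw [mem_iff]; omega
  have hcol3 : ∀ x ∈ Finset.Icc 1 (m - 1), c x 3 = if x = 3 ∨ x + 3 = m then 1 else 0 := by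
    rcases H.transpose.row_cases h3m rfl (by omega) with h1 | ⟨-, h1⟩
    · exact h1
    · have := H.six_mul_eq h3m h1
      omega
  have hS := H.isModularInvariant.sineVal_comm ha h3m
  rw [Finset.sum_eq_single (f := fun x => (c a x : ℝ) * sineVal m (x * (3 : ℕ))) h (fun x hx hxh =>
    by rw [hform x hx, if_neg hxh]; simp) (fun h' => absurd H.mid_mem h'), hform h H.mid_mem,
    if_pos rfl, ← Finset.sum_subset (s₁ := {3, m - 3}), Finset.sum_pair (by omega),
    hcol3 3 h3m, hcol3 (m - 3) (by rw [mem_iff]; omega), if_pos (by omega), if_pos (by omega),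
    sineVal_eq (x := a * (3 : ℕ)) (y := h) (Or.inl ⟨0, by push_cast; omega⟩),
    sineVal_eq_neg (x := h * (3 : ℕ)) (y := h) (Or.inr ⟨0, by push_cast; omega⟩),
    sineVal_eq (x := a * (m - 3 : ℕ)) (y := h) (Or.inr ⟨(a / 2 : ℕ), by
      have e1 : ((m - 3 : ℕ) : ℤ) = m - 3 := by omega
      have e2 : (a : ℤ) = 2 * (a / 2 : ℕ) + 1 := by omega
      have e3 : (h : ℤ) = 3 * a := by omega
      rw [e1]
      linear_combination (m : ℤ) * e2 + e3⟩), H.sineVal_mid] at hS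
  · norm_num at hS
  · intro z hz
    rw [Finset.mem_insert, Finset.mem_singleton] at hz
    rcases hz with rfl | rfl
    exacts [h3m, by rw [mem_iff]; omega]
  · intro x hx hxn
    rw [Finset.mem_insert, Finset.mem_singleton] at hxn
    rw [hcol3 x hx, if_neg (by omega)]; simp

/-- If the central entry is not `2`, the invariant has type `E₇`. -/
lemma eq_E7_of_mid_ne_two (H : IsFoldedInvariant m h c) (hmid : c h h ≠ 2) :
    m = 18 ∧ ∀ a ∈ Finset.Icc 1 (m - 1), ∀ b ∈ Finset.Icc 1 (m - 1), c a b =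
      if a % 2 = 0 then 0 else if a = 3 ∨ a = 15 then (if b = 9 then 1 else 0) else
      if a = 9 then (if b = 3 ∨ b = 9 ∨ b = 15 then 1 else 0) else
      (if b = a ∨ b + a = 18 then 1 else 0) := by
  obtain ⟨rfl, hrow3⟩ := H.third_row_of_mid_ne_two hmid
  obtain ⟨-, hcol3⟩ := H.transpose.third_row_of_mid_ne_two hmid
  obtain rfl : h = 9 := by have := H.two_mul; omega
  have hmem : ∀ x, x ∈ Finset.Icc 1 (18 - 1) ↔ 1 ≤ x ∧ x ≤ 17 := fun x => mem_iff
  have h3m : 3 ∈ Finset.Icc 1 (18 - 1) := by rw [hmem]; omega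
  have h9m : 9 ∈ Finset.Icc 1 (18 - 1) := by rw [hmem]; omega
  have hrow15 : ∀ x ∈ Finset.Icc 1 (18 - 1), c 15 x = if x = 9 then 1 else 0 := fun x hx => by
    have := H.reflect_row h3m hx
    rw [← hrow3 x hx, ← this]
  have hcol15 : ∀ x ∈ Finset.Icc 1 (18 - 1), c x 15 = if x = 9 then 1 else 0 := fun x hx => by
    have := H.reflect_column hx h3m
    have h4 : c x 3 = _ := hcol3 x hx
    rw [← h4, ← this]
  have hother : ∀ a ∈ Finset.Icc 1 (18 - 1), a % 2 = 1 → a ≠ 3 → a ≠ 9 → a ≠ 15 →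
      ∀ x ∈ Finset.Icc 1 (18 - 1), c a x = if x = a ∨ x + a = 18 then 1 else 0 := by
    intro a ha hodd h3 h9 h15
    rcases H.row_cases ha hodd h9 with h1 | ⟨-, h1⟩
    · exact h1
    · have := H.six_mul_eq ha h1
      omega
  have hother' : ∀ a ∈ Finset.Icc 1 (18 - 1), a % 2 = 1 → a ≠ 3 → a ≠ 9 → a ≠ 15 →
      c 9 a = 0 := by
    intro a ha hodd h3 h9 h15
    rcases H.transpose.row_cases ha hodd h9 with h1 | ⟨-, h1⟩
    · have h4 : c 9 a = _ := h1 9 h9m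
      rw [h4, if_neg (by rw [hmem] at ha; omega)]
    · have := H.six_mul_eq ha h1
      omega
  have h99 : c 9 9 = 1 := by
    have h4 := H.row_sum_odd h9m rfl
    have e3 : sineVal 18 3 = 1 / 2 := by
      rw [sineVal, ← Real.sin_pi_div_six]; congr 1; push_cast; ring
    have e9 : sineVal 18 9 = 1 := by
      rw [sineVal, ← Real.sin_pi_div_two]; congr 1; push_cast; ring
    have e15 : sineVal 18 15 = 1 / 2 := by
      rw [← e3]; exact sineVal_eq (Or.inr ⟨0, by norm_num⟩)
    have f3 : c 9 3 = 1 := hcol3 9 h9m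
    have f15 : c 9 15 = 1 := hcol15 9 h9m
    rw [← Finset.sum_subset (s₁ := {3, 9, 15})] at h4
    · rw [Finset.sum_insert (by decide), Finset.sum_pair (by decide), f3, f15] at h4
      norm_num [e3, e9, e15] at h4
      have h5 : (c 9 9 : ℝ) = 1 := by linarith
      exact_mod_cast h5
    · intro z hz
      simp only [Finset.mem_insert, Finset.mem_singleton] at hz
      rw [hmem]; omega
    · intro x hx hxn
      simp only [Finset.mem_insert, Finset.mem_singleton, not_or] at hxn
      have : c 9 x = 0 := by
        rcases Nat.mod_two_eq_zero_or_one x with h0 | h1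
        · exact H.column_even h9m hx h0
        · exact hother' x hx h1 hxn.1 hxn.2.1 hxn.2.2
      rw [this]; simp
  refine ⟨rfl, fun a ha b hb => ?_⟩
  by_cases h0 : a % 2 = 0
  · rw [if_pos h0]; exact H.row_even ha hb h0
  rw [if_neg h0]
  by_cases h1 : a = 3 ∨ a = 15
  · rw [if_pos h1]
    rcases h1 with rfl | rfl
    exacts [hrow3 b hb, hrow15 b hb]
  rw [if_neg h1]
  by_cases h2 : a = 9
  · rw [if_pos h2, h2]
    split_ifs with h3
    · rcases h3 with rfl | rfl | rfl
      exacts [hcol3 9 h9m, h99, hcol15 9 h9m]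
    · rcases Nat.mod_two_eq_zero_or_one b with h4 | h4
      · exact H.column_even h9m hb h4
      · exact hother' b hb h4 (by omega) (by omega) (by omega)
  · rw [if_neg h2]
    exact hother a ha (by omega) (by omega) h2 (by omega) b hb

end IsFoldedInvariant

/-! ### The odd parts of the matrices `Ω^X` -/

/-- The entry of the odd part `Ω_{r,r'} - Ω_{-r,r'}` of `Ω = Ω_m(n)`. -/
def omegaOddEntry (m n : ℕ) (r r' : ℤ) : ℤ :=
  (if 2 * (n : ℤ) ∣ r + r' ∧ ((2 * m / n : ℕ) : ℤ) ∣ r - r' then 1 else 0) -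
    (if 2 * (n : ℤ) ∣ r - r' ∧ ((2 * m / n : ℕ) : ℤ) ∣ r + r' then 1 else 0)

/-- The entry of the odd part of `Ω^X`. -/
def ADE.oddEntry (m : ℕ) (X : ADE) (r r' : ℤ) : ℤ := ∑ n ∈ X.levels m, omegaOddEntry m n r r'

lemma omega_intCast {m n : ℕ} [NeZero m] (hnm : n ∣ m) (r r' : ℤ) :
    omega m n (r : ZMod (2 * m)) (r' : ZMod (2 * m)) =
      if 2 * (n : ℤ) ∣ r + r' ∧ ((2 * m / n : ℕ) : ℤ) ∣ r - r' then 1 else 0 := by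
  have h1 : 2 * n ∣ 2 * m := Nat.mul_dvd_mul_left 2 hnm
  have h2 : 2 * m / n ∣ 2 * m := Nat.div_dvd_of_dvd (hnm.mul_left 2)
  rw [omega, Matrix.of_apply, ← Int.cast_add, ← Int.cast_sub]
  refine if_congr (and_congr ?_ (dvd_val_intCast h2 _)) rfl rfl
  rw [dvd_val_intCast h1]
  push_cast
  rfl

lemma omega_sub_omega_neg {m n : ℕ} [NeZero m] (hnm : n ∣ m) (r r' : ℤ) :
    omega m n (r : ZMod (2 * m)) (r' : ZMod (2 * m)) - omega m n (-(r : ZMod (2 * m))) r' =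
      (omegaOddEntry m n r r' : ℂ) := by
  rw [← Int.cast_neg, omega_intCast hnm, omega_intCast hnm, omegaOddEntry]
  have h1 : 2 * (n : ℤ) ∣ -r + r' ↔ 2 * (n : ℤ) ∣ r - r' := by
    rw [← dvd_neg]; ring_nf
  have h2 : ((2 * m / n : ℕ) : ℤ) ∣ -r - r' ↔ ((2 * m / n : ℕ) : ℤ) ∣ r + r' := by
    rw [← dvd_neg]; ring_nf
  push_cast
  congr 1
  exact if_congr (and_congr h1 h2) rfl rfl

lemma ADE.omegaX_sub_omegaX_neg {m : ℕ} [NeZero m] {X : ADE} (hX : ∀ n ∈ X.levels m, n ∣ m)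
    (r r' : ℤ) : X.omegaX m (r : ZMod (2 * m)) (r' : ZMod (2 * m)) -
      X.omegaX m (-(r : ZMod (2 * m))) r' = (X.oddEntry m r r' : ℂ) := by
  rw [ADE.omegaX, ADE.oddEntry, Matrix.sum_apply, Matrix.sum_apply, ← Finset.sum_sub_distrib]
  push_cast
  exact Finset.sum_congr rfl fun n hn => omega_sub_omega_neg (hX n hn) r r'

lemma dvd_sub_iff_eq {m a b : ℕ} (ha : a ∈ Finset.Icc 1 (m - 1)) (hb : b ∈ Finset.Icc 1 (m - 1)) :
    (m : ℤ) ∣ (a : ℤ) - b ↔ a = b := by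
  rw [Finset.mem_Icc] at ha hb
  constructor
  · intro h
    have := Int.eq_zero_of_abs_lt_dvd h (by rw [abs_lt]; omega)
    omega
  · rintro rfl; simp

lemma dvd_add_iff_eq {m a b : ℕ} (ha : a ∈ Finset.Icc 1 (m - 1)) (hb : b ∈ Finset.Icc 1 (m - 1)) :
    (m : ℤ) ∣ (a : ℤ) + b ↔ a + b = m := by
  rw [Finset.mem_Icc] at ha hb
  constructor
  · intro h
    have h1 : (m : ℤ) ∣ (a : ℤ) + b - m := dvd_sub_self_right.mpr h
    have := Int.eq_zero_of_abs_lt_dvd h1 (by rw [abs_lt]; omega)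
    omega
  · intro h; exact ⟨1, by omega⟩

lemma omegaOddEntry_one {m a b : ℕ} (ha : a ∈ Finset.Icc 1 (m - 1))
    (hb : b ∈ Finset.Icc 1 (m - 1)) : omegaOddEntry m 1 a b = if a = b then 1 else 0 := by
  have h1 : ¬ ((2 * m : ℕ) : ℤ) ∣ (a : ℤ) + b := by
    intro h
    rw [Finset.mem_Icc] at ha hb
    have := Int.le_of_dvd (by omega) h
    omega
  have h2 : ((2 * m : ℕ) : ℤ) ∣ (a : ℤ) - b ↔ a = b := by
    constructor
    · intro h
      exact (dvd_sub_iff_eq ha hb).mp ((Dvd.intro_left 2 (by push_cast; ring)).trans h)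
    · rintro rfl; simp
  rw [omegaOddEntry, Nat.div_one, if_neg (c := 2 * ((1 : ℕ) : ℤ) ∣ (a : ℤ) - b ∧ _)
    (fun h => h1 h.2), sub_zero]
  refine if_congr ⟨fun h => h2.mp h.2, fun h => ⟨?_, h2.mpr h⟩⟩ rfl rfl
  rw [h]
  exact ⟨b, by push_cast; ring⟩

lemma omegaOddEntry_half {h a b : ℕ} (hh : h ≠ 0) (ha : a ∈ Finset.Icc 1 (2 * h - 1))
    (hb : b ∈ Finset.Icc 1 (2 * h - 1)) : omegaOddEntry (2 * h) h a b =
      (if a + b = 2 * h ∧ 4 ∣ (a : ℤ) - b then 1 else 0) -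
        (if a = b ∧ 4 ∣ (a : ℤ) + b then 1 else 0) := by
  have h1 : 2 * (2 * h) / h = 4 := by
    rw [show 2 * (2 * h) = 4 * h by ring]; exact Nat.mul_div_cancel _ (Nat.pos_of_ne_zero hh)
  have h2 := dvd_sub_iff_eq ha hb
  have h3 := dvd_add_iff_eq ha hb
  push_cast at h2 h3
  rw [omegaOddEntry, h1]
  exact congrArg₂ (· - ·) (if_congr (and_congr h3 Iff.rfl) rfl rfl)
    (if_congr (and_congr h2 Iff.rfl) rfl rfl)

lemma ADE.oddEntry_A {m n : ℕ} (hn : 1 ≤ n) {a b : ℕ} (ha : a ∈ Finset.Icc 1 (m - 1))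
    (hb : b ∈ Finset.Icc 1 (m - 1)) : (ADE.A n hn).oddEntry m a b = if a = b then 1 else 0 := by
  rw [ADE.oddEntry, ADE.levels, Finset.sum_singleton, omegaOddEntry_one ha hb]

lemma ADE.oddEntry_D {h n : ℕ} (hh : 2 ≤ h) (hn : 4 ≤ n) {a b : ℕ}
    (ha : a ∈ Finset.Icc 1 (2 * h - 1)) (hb : b ∈ Finset.Icc 1 (2 * h - 1)) :
    (ADE.D n hn).oddEntry (2 * h) a b = (if a = b then 1 else 0) +
      ((if a + b = 2 * h ∧ 4 ∣ (a : ℤ) - b then 1 else 0) -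
        (if a = b ∧ 4 ∣ (a : ℤ) + b then 1 else 0)) := by
  rw [ADE.oddEntry, ADE.levels, Nat.mul_div_cancel_left h two_pos, Finset.sum_pair (by omega),
    omegaOddEntry_one ha hb, omegaOddEntry_half (by omega) ha hb]

/-- For `m = 2h` with `h` odd, the odd part of `Ω^D` is supported on the odd rows, on the diagonal
and on the antidiagonal. -/
lemma ADE.oddEntry_D_of_odd {h n : ℕ} (hh : 2 ≤ h) (hodd : h % 2 = 1) (hn : 4 ≤ n) {a b : ℕ}
    (ha : a ∈ Finset.Icc 1 (2 * h - 1)) (hb : b ∈ Finset.Icc 1 (2 * h - 1)) :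
    (ADE.D n hn).oddEntry (2 * h) a b = if a % 2 = 1 then
      (if a = b then 1 else 0) + (if a + b = 2 * h then 1 else 0) else 0 := by
  rw [ADE.oddEntry_D hh hn ha hb]
  split_ifs <;> omega

/-- For `m = 2h` with `h` even, the odd part of `Ω^D` is the permutation that fixes the odd indices
and reflects the even ones. -/
lemma ADE.oddEntry_D_of_even {h n : ℕ} (hh : 2 ≤ h) (heven : h % 2 = 0) (hn : 4 ≤ n) {a b : ℕ}
    (ha : a ∈ Finset.Icc 1 (2 * h - 1)) (hb : b ∈ Finset.Icc 1 (2 * h - 1)) :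
    (ADE.D n hn).oddEntry (2 * h) a b = if a % 2 = 1 then
      (if a = b then 1 else 0) else (if a + b = 2 * h then 1 else 0) := by
  rw [ADE.oddEntry_D hh hn ha hb]
  split_ifs <;> omega

set_option maxRecDepth 10000 in
lemma ADE.oddEntry_E7 : ∀ a ∈ Finset.Icc 1 17, ∀ b ∈ Finset.Icc 1 17,
    ADE.E7.oddEntry 18 (a : ℕ) (b : ℕ) =
      if a % 2 = 0 then 0 else if a = 3 ∨ a = 15 then (if b = 9 then 1 else 0) else
      if a = 9 then (if b = 3 ∨ b = 9 ∨ b = 15 then 1 else 0) else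
      (if b = a ∨ b + a = 18 then 1 else 0) := by
  decide

set_option maxRecDepth 10000 in
/-- The values of the odd part of `Ω^{E₆}`.  Its zeros are at the indices where the first row pairs
to zero with the `S`-matrix, and at the pairs whose squares differ modulo `48`. -/
lemma ADE.oddEntry_E6 : ∀ a ∈ Finset.Icc 1 11, ∀ b ∈ Finset.Icc 1 11,
    (ADE.E6.oddEntry 12 (a : ℕ) (b : ℕ) = 0 ∧ (a ∈ ({2, 3, 6, 9, 10} : Finset ℕ) ∨
      b ∈ ({2, 3, 6, 9, 10} : Finset ℕ) ∨ ¬ (48 : ℤ) ∣ (a : ℤ) ^ 2 - (b : ℤ) ^ 2)) ∨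
    (ADE.E6.oddEntry 12 (a : ℕ) (b : ℕ) = 1 ∧
      ((a ∈ ({4, 8} : Finset ℕ) ∧ b ∈ ({4, 8} : Finset ℕ)) ∨
        (a ∈ ({1, 5, 7, 11} : Finset ℕ) ∧ (b = a ∨ b = a * 7 % 24)))) := by
  decide

set_option maxRecDepth 10000 in
/-- The values of the odd part of `Ω^{E₈}`, with zeros as for `E₆`. -/
lemma ADE.oddEntry_E8 : ∀ a ∈ Finset.Icc 1 29, ∀ b ∈ Finset.Icc 1 29,
    (ADE.E8.oddEntry 30 (a : ℕ) (b : ℕ) = 0 ∧ (a % 2 = 0 ∨ a % 3 = 0 ∨ a % 5 = 0 ∨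
      b % 2 = 0 ∨ b % 3 = 0 ∨ b % 5 = 0 ∨ ¬ (120 : ℤ) ∣ (a : ℤ) ^ 2 - (b : ℤ) ^ 2)) ∨
    (ADE.E8.oddEntry 30 (a : ℕ) (b : ℕ) = 1 ∧ a.gcd 60 = 1 ∧
      (b = a ∨ b = a * 11 % 60 ∨ b = a * 19 % 60 ∨ b = a * 29 % 60)) := by
  decide

/-! ### Modular invariants of type `E₆` -/

namespace IsModularInvariant

variable {c : ℕ → ℕ → ℕ}

lemma eq_zero_of_column_sum {m : ℕ} [NeZero m] {b : ℕ}
    (h : ∑ x ∈ Finset.Icc 1 (m - 1), c x b * sineVal m x = 0) {a : ℕ}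
    (ha : a ∈ Finset.Icc 1 (m - 1)) : c a b = 0 :=
  eq_zero_of_sum_le (f := fun x => c x b) (w := fun x => sineVal m x) (T := ∅)
    (fun _ hx => sineVal_pos_of_mem hx) (Finset.empty_subset _)
    (by rw [Finset.sum_empty]; exact h.le) ha (Finset.notMem_empty _)

/-- The column sums, where non-negativity for the column `2` forces `c 1 7 = 1`. -/
lemma E6_column_sum (hc : IsModularInvariant 12 c) (h7 : c 1 7 ≠ 0) {b : ℕ}
    (hb : b ∈ Finset.Icc 1 11) :
    ∑ x ∈ Finset.Icc 1 11, c x b * sineVal 12 x = sineVal 12 b + sineVal 12 (7 * b) := by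
  have hsum : ∀ b ∈ Finset.Icc 1 11, ∑ x ∈ Finset.Icc 1 11, c x b * sineVal 12 x =
      sineVal 12 b + c 1 7 * sineVal 12 (7 * b) := by
    intro b hb
    rw [hc.column_sum (b := b) hb, ← Finset.sum_subset (s₁ := {1, 7}),
      Finset.sum_pair (by decide), hc.one_one]
    · simp
    · decide
    · intro x hx hx'
      rw [Finset.mem_insert, Finset.mem_singleton, not_or] at hx'
      have : c 1 x = 0 := by
        by_contra hne
        have := hc.row_one hx hne
        omega
      rw [this]; simp
  have h2 := hsum 2 (by decide)
  have hnn : 0 ≤ ∑ x ∈ Finset.Icc 1 11, c x 2 * sineVal 12 x :=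
    Finset.sum_nonneg fun x hx =>
      mul_nonneg (Nat.cast_nonneg _) (sineVal_pos_of_mem (m := 12) hx).le
  rw [h2, sineVal_eq_neg (x := 7 * (2 : ℕ)) (y := (2 : ℕ)) (Or.inr ⟨0, by norm_num⟩)] at hnn
  have hpos := sineVal_pos_of_mem (m := 12) (x := 2) (by decide)
  have h5 : (c 1 7 : ℝ) * sineVal 12 (2 : ℕ) ≤ 1 * sineVal 12 (2 : ℕ) := by linarith
  have h6 : c 1 7 ≤ 1 := by exact_mod_cast le_of_mul_le_mul_right h5 hpos
  have h7' : c 1 7 = 1 := by omega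
  rw [hsum b hb, h7', Nat.cast_one, one_mul]

lemma E6_transpose (hc : IsModularInvariant 12 c) (h7 : c 1 7 ≠ 0) : c 7 1 ≠ 0 := by
  intro h0
  have h1 := hc.E6_column_sum h7 (b := 1) (by decide)
  rw [Finset.sum_eq_single 1, hc.one_one] at h1
  · have := sineVal_pos_of_mem (m := 12) (x := 7) (by decide)
    push_cast at h1 this
    norm_num at h1
    exact this.ne' h1
  · intro x hx hx1
    have : c x 1 = 0 := by
      by_contra hne
      have := hc.transpose.row_one hx hne
      have : x = 7 := by omega
      exact hne (this ▸ h0)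
    rw [this]; simp
  · intro h; exact absurd (by decide) h

lemma E6_column_zero (hc : IsModularInvariant 12 c) (h7 : c 1 7 ≠ 0) {a b : ℕ}
    (ha : a ∈ Finset.Icc 1 11) (hb : b ∈ ({2, 3, 6, 9, 10} : Finset ℕ)) : c a b = 0 := by
  have hb' : b ∈ Finset.Icc 1 11 :=
    (by decide : ({2, 3, 6, 9, 10} : Finset ℕ) ⊆ Finset.Icc 1 11) hb
  refine eq_zero_of_column_sum (m := 12) ?_ ha
  rw [hc.E6_column_sum h7 hb', sineVal_eq_neg (x := 7 * b) (y := b), add_neg_cancel]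
  revert b
  decide

/-- The modular invariants with `c 1 7 ≠ 0` have type `E₆`. -/
lemma eq_E6 (hc : IsModularInvariant 12 c) (h7 : c 1 7 ≠ 0) :
    ∀ a ∈ Finset.Icc 1 11, ∀ b ∈ Finset.Icc 1 11,
      (c a b : ℤ) = ADE.E6.oddEntry 12 (a : ℕ) (b : ℕ) := by
  have h7t := hc.E6_transpose h7
  have h17 : c 1 7 = 1 := by
    have h1 := hc.transpose.E6_column_sum h7t (b := 1) (by decide)
    have h2 := hc.column_sum (b := 1) (by decide)
    have hle : ∑ x ∈ ({1, 7} : Finset ℕ), (c 1 x : ℝ) * sineVal 12 x ≤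
        sineVal 12 (1 : ℕ) + sineVal 12 (7 * (1 : ℕ)) := by
      rw [← h1]
      exact Finset.sum_le_sum_of_subset_of_nonneg (by decide) fun x hx _ =>
        mul_nonneg (Nat.cast_nonneg _) (sineVal_pos_of_mem (m := 12) hx).le
    rw [Finset.sum_pair (by decide), hc.one_one] at hle
    have hpos := sineVal_pos_of_mem (m := 12) (x := 7) (by decide)
    push_cast at hle hpos
    norm_num at hle
    have h6 : c 1 7 ≤ 1 := by
      have : (c 1 7 : ℝ) ≤ 1 := by nlinarith
      exact_mod_cast this
    omega
  have hdvd : ∀ b ∈ ({4, 8} : Finset ℕ), ∀ x ∈ Finset.Icc 1 11, x ∉ ({4, 8} : Finset ℕ) →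
      ¬ (4 * (12 : ℕ) : ℤ) ∣ (x : ℤ) ^ 2 - (b : ℤ) ^ 2 := by decide
  -- the block `{4, 8}`
  have h48 : ∀ b ∈ ({4, 8} : Finset ℕ), c 4 b = 1 ∧ c 8 b = 1 := by
    intro b hb
    have hb' : b ∈ Finset.Icc 1 11 := (by decide : ({4, 8} : Finset ℕ) ⊆ Finset.Icc 1 11) hb
    have hz : ∀ x ∈ Finset.Icc 1 11, x ∉ ({4, 8} : Finset ℕ) → c x b = 0 := by
      intro x hx hx48
      by_contra hne
      exact hdvd b hb x hx hx48 (hc.four_mul_dvd hx hb' hne)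
    have h1 := hc.E6_column_sum h7 hb'
    have h2 := hc.sineVal_comm (a := 2) (by decide) hb'
    have e8 : sineVal 12 8 = sineVal 12 4 := sineVal_eq (Or.inr ⟨0, by norm_num⟩)
    have e16 : sineVal 12 16 = -sineVal 12 4 := sineVal_eq_neg (Or.inr ⟨0, by norm_num⟩)
    have eb : sineVal 12 b + sineVal 12 (7 * b) = 2 * sineVal 12 4 := by
      have e28 : sineVal 12 28 = sineVal 12 4 := sineVal_eq (Or.inl ⟨1, by norm_num⟩)
      have e56 : sineVal 12 56 = sineVal 12 4 := sineVal_eq (Or.inr ⟨2, by norm_num⟩)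
      rw [Finset.mem_insert, Finset.mem_singleton] at hb
      rcases hb with rfl | rfl
      · norm_num [e28]; ring
      · norm_num [e56, e8]; ring
    rw [← Finset.sum_subset (s₁ := {4, 8}) (by decide) (fun x hx hx' => by
      rw [hz x hx hx']; simp), Finset.sum_pair (by decide), eb] at h1
    rw [Finset.sum_eq_zero (s := Finset.Icc 1 (12 - 1)) (f := fun x =>
        (c 2 x : ℝ) * sineVal 12 (x * b)) (fun x hx => by
      have h3 : c 2 x = 0 := hc.transpose.E6_column_zero h7t hx (by decide)
      rw [h3]; simp), ← Finset.sum_subset (s₁ := {4, 8}) (by decide) (fun x hx hx' => by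
      rw [hz x hx hx']; simp), Finset.sum_pair (by decide)] at h2
    norm_num [e8, e16] at h1 h2
    have hpos := sineVal_pos_of_mem (m := 12) (x := 4) (by decide)
    push_cast at hpos
    have h3 : (c 4 b : ℝ) + c 8 b = 2 := by
      apply mul_right_cancel₀ hpos.ne'
      linarith
    have h4 : (c 4 b : ℝ) = c 8 b := by
      apply mul_right_cancel₀ hpos.ne'
      linarith
    have h5 : c 4 b + c 8 b = 2 := by exact_mod_cast h3
    have h6 : c 4 b = c 8 b := by exact_mod_cast h4
    omega
  intro a ha b hb
  rcases ADE.oddEntry_E6 a ha b hb with ⟨he, h | h | h⟩ | ⟨he, ⟨h1, h2⟩ | ⟨h1, h2⟩⟩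
  · rw [he]; exact_mod_cast hc.transpose.E6_column_zero h7t hb h
  · rw [he]; exact_mod_cast hc.E6_column_zero h7 ha h
  · rw [he]
    by_contra hne
    exact h (hc.four_mul_dvd ha hb (by exact_mod_cast hne))
  · rw [he]
    rw [Finset.mem_insert, Finset.mem_singleton] at h1
    rcases h1 with rfl | rfl
    exacts [by exact_mod_cast (h48 b h2).1, by exact_mod_cast (h48 b h2).2]
  · rw [he]
    have hcop : a.Coprime (2 * 12) := by
      clear h2 he
      revert h1
      clear ha
      revert a
      decide
    have ha24 : a % 24 = a := by rw [Finset.mem_Icc] at ha; omega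
    rcases h2 with h2 | h2
    · rw [hc.eq_of_mul_mod (a := 1) (b := 1) (by decide) (by decide) ha hb hcop
        (by omega) (by omega), hc.one_one, Nat.cast_one]
    · rw [hc.eq_of_mul_mod (a := 1) (b := 7) (by decide) (by decide) ha hb hcop
        (by omega) (by omega), h17, Nat.cast_one]

/-! ### Modular invariants of type `E₈` -/

lemma E8_column_sum_aux (hc : IsModularInvariant 30 c) {b : ℕ} (hb : b ∈ Finset.Icc 1 29) :
    ∑ x ∈ Finset.Icc 1 29, c x b * sineVal 30 x = sineVal 30 b + c 1 11 * sineVal 30 (11 * b) +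
      c 1 19 * sineVal 30 (19 * b) + c 1 29 * sineVal 30 (29 * b) := by
  rw [hc.column_sum (b := b) hb, ← Finset.sum_subset (s₁ := {1, 11, 19, 29}),
    Finset.sum_insert (by decide), Finset.sum_insert (by decide),
    Finset.sum_pair (by decide), hc.one_one]
  · push_cast; ring_nf
  · decide
  · intro x hx hx'
    simp only [Finset.mem_insert, Finset.mem_singleton, not_or] at hx'
    have : c 1 x = 0 := by
      by_contra hne
      have := hc.row_one hx hne
      omega
    rw [this]; simp

/-- Non-negativity of the column sums leaves a single possibility for the first row. -/
lemma E8_row_one (hc : IsModularInvariant 30 c) (h : c 1 11 ≠ 0 ∨ c 1 19 ≠ 0) :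
    c 1 11 = 1 ∧ c 1 19 = 1 ∧ c 1 29 = 1 := by
  have hnn : ∀ b ∈ Finset.Icc (1 : ℕ) 29, 0 ≤ sineVal 30 b + c 1 11 * sineVal 30 (11 * b) +
      c 1 19 * sineVal 30 (19 * b) + c 1 29 * sineVal 30 (29 * b) := fun b hb => by
    rw [← hc.E8_column_sum_aux hb]
    exact Finset.sum_nonneg fun x hx =>
      mul_nonneg (Nat.cast_nonneg _) (sineVal_pos_of_mem (m := 30) hx).le
  -- the columns `3`, `6`, `10` give linear inequalities with integral coefficients; the columns
  -- `4` and `2` exclude the two remaining solutions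
  have a3 := hnn 3 (by decide)
  have a6 := hnn 6 (by decide)
  have a10 := hnn 10 (by decide)
  have a4 := hnn 4 (by decide)
  have a2 := hnn 2 (by decide)
  have p3 := sineVal_pos_of_mem (m := 30) (x := 3) (by decide)
  have p6 := sineVal_pos_of_mem (m := 30) (x := 6) (by decide)
  have p10 := sineVal_pos_of_mem (m := 30) (x := 10) (by decide)
  have l4 : sineVal 30 4 < sineVal 30 14 := sineVal_lt (by norm_num) (by norm_num) (by norm_num)
  have l2 : sineVal 30 2 < sineVal 30 8 := sineVal_lt (by norm_num) (by norm_num) (by norm_num)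
  have e33 : sineVal 30 33 = -sineVal 30 3 := sineVal_eq_neg (Or.inr ⟨0, by norm_num⟩)
  have e57 : sineVal 30 57 = -sineVal 30 3 := sineVal_eq_neg (Or.inl ⟨1, by norm_num⟩)
  have e87 : sineVal 30 87 = sineVal 30 3 := sineVal_eq (Or.inr ⟨1, by norm_num⟩)
  have e66 : sineVal 30 66 = sineVal 30 6 := sineVal_eq (Or.inl ⟨1, by norm_num⟩)
  have e114 : sineVal 30 114 = -sineVal 30 6 := sineVal_eq_neg (Or.inl ⟨2, by norm_num⟩)
  have e174 : sineVal 30 174 = -sineVal 30 6 := sineVal_eq_neg (Or.inl ⟨3, by norm_num⟩)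
  have e110 : sineVal 30 110 = -sineVal 30 10 := sineVal_eq_neg (Or.inl ⟨2, by norm_num⟩)
  have e190 : sineVal 30 190 = sineVal 30 10 := sineVal_eq (Or.inl ⟨3, by norm_num⟩)
  have e290 : sineVal 30 290 = -sineVal 30 10 := sineVal_eq_neg (Or.inl ⟨5, by norm_num⟩)
  have e44 : sineVal 30 44 = -sineVal 30 14 := sineVal_eq_neg (Or.inr ⟨0, by norm_num⟩)
  have e38 : sineVal 30 38 = -sineVal 30 8 := sineVal_eq_neg (Or.inr ⟨0, by norm_num⟩)
  norm_num [e33, e57, e87] at a3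
  norm_num [e66, e114, e174] at a6
  norm_num [e110, e190, e290] at a10
  norm_num [e44] at a4
  norm_num [e38] at a2
  push_cast at p3 p6 p10
  have b3 : (c 1 11 : ℤ) + c 1 19 ≤ 1 + c 1 29 := by
    have : (c 1 11 : ℝ) + c 1 19 ≤ 1 + c 1 29 := le_of_mul_le_mul_right (by linarith) p3
    exact_mod_cast this
  have b6 : (c 1 19 : ℤ) + c 1 29 ≤ 1 + c 1 11 := by
    have : (c 1 19 : ℝ) + c 1 29 ≤ 1 + c 1 11 := le_of_mul_le_mul_right (by linarith) p6
    exact_mod_cast this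
  have b10 : (c 1 11 : ℤ) + c 1 29 ≤ 1 + c 1 19 := by
    have : (c 1 11 : ℝ) + c 1 29 ≤ 1 + c 1 19 := le_of_mul_le_mul_right (by linarith) p10
    exact_mod_cast this
  have x1 : ¬ (c 1 11 = 1 ∧ c 1 19 = 0 ∧ c 1 29 = 0) := by
    rintro ⟨y1, y2, y3⟩
    rw [y1, y2, y3] at a4
    norm_num at a4
    linarith
  have x2 : ¬ (c 1 11 = 0 ∧ c 1 19 = 1 ∧ c 1 29 = 0) := by
    rintro ⟨y1, y2, y3⟩
    rw [y1, y2, y3] at a2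
    norm_num at a2
    linarith
  omega

lemma E8_column_sum (hc : IsModularInvariant 30 c) (h : c 1 11 ≠ 0 ∨ c 1 19 ≠ 0) {b : ℕ}
    (hb : b ∈ Finset.Icc 1 29) :
    ∑ x ∈ Finset.Icc 1 29, c x b * sineVal 30 x = sineVal 30 b + sineVal 30 (11 * b) +
      sineVal 30 (19 * b) + sineVal 30 (29 * b) := by
  obtain ⟨h1, h2, h3⟩ := hc.E8_row_one h
  rw [hc.E8_column_sum_aux hb, h1, h2, h3]
  simp

lemma E8_column_zero (hc : IsModularInvariant 30 c) (h : c 1 11 ≠ 0 ∨ c 1 19 ≠ 0) {a b : ℕ}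
    (ha : a ∈ Finset.Icc 1 29) (hb : b ∈ Finset.Icc 1 29)
    (hb' : b % 2 = 0 ∨ b % 3 = 0 ∨ b % 5 = 0) : c a b = 0 := by
  refine eq_zero_of_column_sum (m := 30) ?_ ha
  rw [hc.E8_column_sum h hb]
  by_cases h2 : b % 2 = 0
  · rw [sineVal_eq_neg (x := 29 * b) (y := b) (Or.inl ⟨(b / 2 : ℕ), by push_cast; omega⟩),
      sineVal_eq_neg (x := 19 * b) (y := 11 * b) (Or.inl ⟨(b / 2 : ℕ), by push_cast; omega⟩)]
    ring
  by_cases h3 : b % 3 = 0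
  · rw [sineVal_eq_neg (x := 11 * b) (y := b) (Or.inr ⟨(b / 6 : ℕ), by push_cast; omega⟩),
      sineVal_eq_neg (x := 29 * b) (y := 19 * b) (Or.inr ⟨(b / 6 : ℕ), by push_cast; omega⟩)]
    ring
  · rw [sineVal_eq_neg (x := 11 * b) (y := b) (Or.inl ⟨(b / 5 : ℕ), by push_cast; omega⟩),
      sineVal_eq_neg (x := 29 * b) (y := 19 * b) (Or.inl ⟨(4 * (b / 5) : ℕ), by push_cast; omega⟩)]
    ring

lemma E8_transpose (hc : IsModularInvariant 30 c) (h : c 1 11 ≠ 0 ∨ c 1 19 ≠ 0) :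
    c 11 1 ≠ 0 ∨ c 19 1 ≠ 0 := by
  by_contra! h0
  have h1 := hc.E8_column_sum h (b := 1) (by decide)
  have p1 := sineVal_pos_of_mem (m := 30) (x := 1) (by decide)
  have l11 : sineVal 30 1 < sineVal 30 11 := sineVal_lt (by norm_num) (by norm_num) (by norm_num)
  have e19 : sineVal 30 19 = sineVal 30 11 := sineVal_eq (Or.inr ⟨0, by norm_num⟩)
  have e29 : sineVal 30 29 = sineVal 30 1 := sineVal_eq (Or.inr ⟨0, by norm_num⟩)
  rw [← Finset.sum_subset (s₁ := {1, 29}) (by decide) (fun x hx hx' => by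
    rw [Finset.mem_insert, Finset.mem_singleton, not_or] at hx'
    have : c x 1 = 0 := by
      by_contra hne
      have := hc.transpose.row_one hx hne
      have : x = 11 ∨ x = 19 := by omega
      rcases this with rfl | rfl
      exacts [hne h0.1, hne h0.2]
    rw [this]; simp), Finset.sum_pair (by decide), hc.one_one] at h1
  norm_num [e19, e29] at h1
  push_cast at p1
  -- the second row has non-negative weight, which bounds `c 29 1` by `1`
  have hnn : 0 ≤ sineVal 30 (2 : ℕ) + (c 29 1 : ℝ) * sineVal 30 (29 * (2 : ℕ)) := by
    have h2 := hc.transpose.E8_column_sum_aux (b := 2) (by decide)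
    have h3 : (0 : ℝ) ≤ ∑ x ∈ Finset.Icc 1 29, (c 2 x : ℝ) * sineVal 30 x :=
      Finset.sum_nonneg fun x hx =>
        mul_nonneg (Nat.cast_nonneg _) (sineVal_pos_of_mem (m := 30) hx).le
    rw [h2, h0.1, h0.2] at h3
    simpa using h3
  have e58 : sineVal 30 58 = -sineVal 30 2 := sineVal_eq_neg (Or.inl ⟨1, by norm_num⟩)
  have p2 := sineVal_pos_of_mem (m := 30) (x := 2) (by decide)
  norm_num [e58] at hnn
  push_cast at p2
  have h4 : (c 29 1 : ℝ) ≤ 1 := le_of_mul_le_mul_right (by linarith) p2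
  nlinarith

/-- The modular invariants with `c 1 11 ≠ 0` or `c 1 19 ≠ 0` have type `E₈`. -/
lemma eq_E8 (hc : IsModularInvariant 30 c) (h : c 1 11 ≠ 0 ∨ c 1 19 ≠ 0) :
    ∀ a ∈ Finset.Icc 1 29, ∀ b ∈ Finset.Icc 1 29,
      (c a b : ℤ) = ADE.E8.oddEntry 30 (a : ℕ) (b : ℕ) := by
  have ht := hc.E8_transpose h
  obtain ⟨h11, h19, h29⟩ := hc.E8_row_one h
  intro a ha b hb
  have hrow : a % 2 = 0 ∨ a % 3 = 0 ∨ a % 5 = 0 → c a b = 0 :=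
    hc.transpose.E8_column_zero ht hb ha
  have hcol := hc.E8_column_zero h ha hb
  rcases ADE.oddEntry_E8 a ha b hb with ⟨he, h1⟩ | ⟨he, hg, h1⟩
  · rw [he]
    by_contra hne
    have hne' : c a b ≠ 0 := by exact_mod_cast hne
    have := hc.four_mul_dvd ha hb hne'
    norm_num at this
    tauto
  · rw [he]
    have hcop : a.Coprime (2 * 30) := hg
    have ha60 : a % 60 = a := by rw [Finset.mem_Icc] at ha; omega
    rcases h1 with h2 | h2 | h2 | h2
    · rw [hc.eq_of_mul_mod (a := 1) (b := 1) (by decide) (by decide) ha hb hcop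
        (by omega) (by omega), hc.one_one, Nat.cast_one]
    · rw [hc.eq_of_mul_mod (a := 1) (b := 11) (by decide) (by decide) ha hb hcop
        (by omega) (by omega), h11, Nat.cast_one]
    · rw [hc.eq_of_mul_mod (a := 1) (b := 19) (by decide) (by decide) ha hb hcop
        (by omega) (by omega), h19, Nat.cast_one]
    · rw [hc.eq_of_mul_mod (a := 1) (b := 29) (by decide) (by decide) ha hb hcop
        (by omega) (by omega), h29, Nat.cast_one]

end IsModularInvariant

/-! ### Coxeter numbers -/

lemma ADE.HasCoxeterNumber.unique {X : ADE} {m m' : ℕ} (h : X.HasCoxeterNumber m)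
    (h' : X.HasCoxeterNumber m') : m = m' := by
  obtain ⟨a, ha, hmax, hm⟩ := h
  obtain ⟨a', ha', hmax', hm'⟩ := h'
  have h1 := hmax a' ha'
  have h2 := hmax' a ha
  rw [ADE.height, ADE.height] at h1 h2
  omega

/-- The entry of the Cartan matrix of the infinite linear Dynkin diagram. -/
def linearCartan (i j : ℕ) : ℤ := if i = j then 2 else if i + 1 = j ∨ j + 1 = i then -1 else 0

/-- `V_0² + ∑_{i < k} (V_{i+1} - V_i)²`, the square length of the coordinates `0, …, k` in the
standard realisation of the root lattices `A` and `D`. -/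
def stepSum (V : ℕ → ℤ) (k : ℕ) : ℤ := V 0 ^ 2 + ∑ i ∈ Finset.range k, (V (i + 1) - V i) ^ 2

lemma stepSum_succ (V : ℕ → ℤ) (k : ℕ) :
    stepSum V (k + 1) = stepSum V k + (V (k + 1) - V k) ^ 2 := by
  rw [stepSum, stepSum, Finset.sum_range_succ]; ring

lemma sum_linearCartan (V : ℕ → ℤ) (k : ℕ) :
    ∑ i ∈ Finset.range (k + 1), V i * linearCartan i (k + 1) = -V k := by
  rw [Finset.sum_eq_single k]
  · simp [linearCartan]
  · intro i hi hik
    rw [Finset.mem_range] at hi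
    rw [linearCartan, if_neg (by omega), if_neg (by omega), mul_zero]
  · intro h; exact absurd (Finset.self_mem_range_succ k) h

lemma linearCartan_comm (i j : ℕ) : linearCartan i j = linearCartan j i := by
  rw [linearCartan, linearCartan]; split_ifs <;> omega

lemma sum_sum_linearCartan (V : ℕ → ℤ) (k : ℕ) :
    ∑ i ∈ Finset.range (k + 1), ∑ j ∈ Finset.range (k + 1), V i * (linearCartan i j * V j) =
      stepSum V k + V k ^ 2 := by
  induction k with
  | zero => simp [stepSum, linearCartan]; ring
  | succ k ih =>
    rw [Finset.sum_range_succ]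
    simp_rw [Finset.sum_range_succ _ (k + 1)]
    rw [Finset.sum_add_distrib, ih, stepSum_succ]
    have h1 := sum_linearCartan V k
    have h2 : ∑ i ∈ Finset.range (k + 1), V i * (linearCartan i (k + 1) * V (k + 1)) =
        -V k * V (k + 1) := by
      rw [← h1, Finset.sum_mul]; exact Finset.sum_congr rfl fun i _ => by ring
    have h3 : ∑ j ∈ Finset.range (k + 1), V (k + 1) * (linearCartan (k + 1) j * V j) =
        -V k * V (k + 1) := by
      rw [← h1, Finset.sum_mul]
      exact Finset.sum_congr rfl fun i _ => by rw [linearCartan_comm (k + 1)]; ring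
    rw [h2, h3]
    simp only [linearCartan, if_true]
    ring

lemma le_stepSum (V : ℕ → ℤ) (k : ℕ) : V k ≤ stepSum V k := by
  induction k with
  | zero => rw [stepSum]; simpa using Int.le_self_sq (V 0)
  | succ k ih => rw [stepSum_succ]; linarith [Int.le_self_sq (V (k + 1) - V k)]

lemma stepSum_mono (V : ℕ → ℤ) : Monotone (stepSum V) :=
  monotone_nat_of_le_succ fun k => by rw [stepSum_succ]; linarith [sq_nonneg (V (k + 1) - V k)]

lemma add_stepSum_mono (V : ℕ → ℤ) : Monotone fun k => V k + stepSum V k :=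
  monotone_nat_of_le_succ fun k => by
    rw [stepSum_succ]
    have := Int.le_self_sq (-(V (k + 1) - V k))
    rw [neg_sq] at this
    linarith

/-- Extension of a vector by zero. -/
def extendZero {n : ℕ} (v : Fin n → ℤ) (k : ℕ) : ℤ := if h : k < n then v ⟨k, h⟩ else 0

lemma extendZero_coe {n : ℕ} (v : Fin n → ℤ) (i : Fin n) : extendZero v i = v i := by
  rw [extendZero, dif_pos i.2]

lemma sum_eq_sum_extendZero {n : ℕ} (v : Fin n → ℤ) :
    ∑ i, v i = ∑ i ∈ Finset.range n, extendZero v i := by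
  rw [← Fin.sum_univ_eq_sum_range]
  exact Finset.sum_congr rfl fun i _ => (extendZero_coe v i).symm

lemma dotProduct_mulVec_eq_sum_range {n : ℕ} {C : Matrix (Fin n) (Fin n) ℤ} {c : ℕ → ℕ → ℤ}
    (hC : ∀ i j, C i j = c i j) (v : Fin n → ℤ) :
    v ⬝ᵥ C.mulVec v = ∑ i ∈ Finset.range n, ∑ j ∈ Finset.range n,
      extendZero v i * (c i j * extendZero v j) := by
  rw [← Fin.sum_univ_eq_sum_range (fun i => ∑ j ∈ Finset.range n,
    extendZero v i * (c i j * extendZero v j)), dotProduct]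
  refine Finset.sum_congr rfl fun i _ => ?_
  rw [← Fin.sum_univ_eq_sum_range (fun j => extendZero v i * (c i j * extendZero v j)),
    Matrix.mulVec, dotProduct, Finset.mul_sum]
  exact Finset.sum_congr rfl fun j _ => by rw [extendZero_coe, extendZero_coe, hC]

lemma cartan_A_form (n : ℕ) (v : Fin (n + 1) → ℤ) :
    v ⬝ᵥ (CartanMatrix.A (n + 1)).mulVec v =
      stepSum (extendZero v) n + extendZero v n ^ 2 := by
  rw [dotProduct_mulVec_eq_sum_range (c := linearCartan) (fun i j => ?_), sum_sum_linearCartan]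
  simp only [CartanMatrix.A, Matrix.of_apply, linearCartan, Fin.ext_iff]

/-- The highest root is the sum of the simple roots, as the coordinates of a root of `A_n` are at
most `1`. -/
lemma ADE.hasCoxeterNumber_A (n : ℕ) (hn : 1 ≤ n) : (ADE.A n hn).HasCoxeterNumber (n + 1) := by
  obtain ⟨n, rfl⟩ : ∃ k, n = k + 1 := ⟨n - 1, by omega⟩
  have hones : ∀ k, k ≤ n → extendZero (fun _ : Fin (n + 1) => (1 : ℤ)) k = 1 := fun k hk => by
    rw [extendZero, dif_pos (by omega)]
  refine ⟨fun _ => 1, ?_, fun v hv => ?_, ?_⟩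
  · change (fun _ : Fin (n + 1) => (1 : ℤ)) ⬝ᵥ (CartanMatrix.A (n + 1)).mulVec (fun _ => 1) = 2
    rw [cartan_A_form, hones n le_rfl, stepSum, hones 0 (by omega), Finset.sum_eq_zero]
    · norm_num
    · intro i hi
      rw [Finset.mem_range] at hi
      rw [hones (i + 1) (by omega), hones i (by omega)]; norm_num
  · change Fin (n + 1) → ℤ at v
    replace hv : v ⬝ᵥ (CartanMatrix.A (n + 1)).mulVec v = 2 := hv
    rw [cartan_A_form] at hv
    change ∑ i : Fin (n + 1), v i ≤ ∑ _i : Fin (n + 1), 1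
    refine Finset.sum_le_sum fun i _ => ?_
    rw [← extendZero_coe v i]
    have h1 := le_stepSum (extendZero v) i
    have h2 := add_stepSum_mono (extendZero v) (show (i : ℕ) ≤ n by omega)
    have h3 := Int.le_self_sq (extendZero v n)
    dsimp only at h2
    linarith
  · change ((n + 1 + 1 : ℕ) : ℤ) = 1 + ∑ _i : Fin (n + 1), (1 : ℤ)
    simp; ring

lemma cartan_D_form (N : ℕ) (v : Fin (N + 3) → ℤ) :
    v ⬝ᵥ (CartanMatrix.D (N + 3)).mulVec v = stepSum (extendZero v) N +
      (extendZero v (N + 1) + extendZero v (N + 2) - extendZero v N) ^ 2 +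
      (extendZero v (N + 1) - extendZero v (N + 2)) ^ 2 := by
  -- the last vertex is joined to vertex `N` of the linear diagram `0, …, N + 1`
  let d : ℕ → ℤ := fun i => if i = N then -1 else 0
  let c : ℕ → ℕ → ℤ := fun i j => if i = N + 2 then (if j = N + 2 then 2 else d j) else
    if j = N + 2 then d i else linearCartan i j
  have hc : ∀ i j : Fin (N + 3), CartanMatrix.D (N + 3) i j = c i j := by
    intro i j
    have := i.2
    have := j.2
    simp only [CartanMatrix.D, Matrix.of_apply, Fin.ext_iff, c, d, linearCartan]
    split_ifs <;> first | rfl | omega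
  rw [dotProduct_mulVec_eq_sum_range hc]
  set V := extendZero v
  have hd : ∑ i ∈ Finset.range (N + 2), V i * d i = -V N := by
    rw [Finset.sum_eq_single N]
    · simp [d]
    · intro i _ hi; simp [d, hi]
    · intro h; exact absurd (Finset.mem_range.mpr (by omega)) h
  rw [Finset.sum_range_succ]
  simp_rw [Finset.sum_range_succ _ (N + 2)]
  rw [Finset.sum_add_distrib]
  have h1 : ∑ i ∈ Finset.range (N + 2), ∑ j ∈ Finset.range (N + 2), V i * (c i j * V j) =
      stepSum V (N + 1) + V (N + 1) ^ 2 := by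
    rw [← sum_sum_linearCartan]
    refine Finset.sum_congr rfl fun i hi => Finset.sum_congr rfl fun j hj => ?_
    rw [Finset.mem_range] at hi hj
    simp only [c]
    rw [if_neg (by omega), if_neg (by omega)]
  have h2 : ∑ i ∈ Finset.range (N + 2), V i * (c i (N + 2) * V (N + 2)) = -V N * V (N + 2) := by
    rw [← hd, Finset.sum_mul]
    refine Finset.sum_congr rfl fun i hi => ?_
    rw [Finset.mem_range] at hi
    simp only [c, if_true]
    rw [if_neg (by omega)]
    ring
  have h3 : ∑ j ∈ Finset.range (N + 2), V (N + 2) * (c (N + 2) j * V j) = -V N * V (N + 2) := by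
    rw [← hd, Finset.sum_mul]
    refine Finset.sum_congr rfl fun i hi => ?_
    rw [Finset.mem_range] at hi
    simp only [c, if_true]
    rw [if_neg (by omega)]
    ring
  have h4 : c (N + 2) (N + 2) = 2 := by simp [c]
  rw [h1, h2, h3, h4, stepSum_succ]
  ring

/-- The coordinates of a root of `D_n` are at most `1` at the three ends of the diagram and at most
`2` elsewhere. -/
lemma ADE.hasCoxeterNumber_D (n : ℕ) (hn : 4 ≤ n) :
    (ADE.D n hn).HasCoxeterNumber (2 * n - 2) := by
  obtain ⟨N, rfl⟩ : ∃ k, n = k + 4 := ⟨n - 4, by omega⟩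
  let a : Fin (N + 4) → ℤ := fun i => if (i : ℕ) = 0 ∨ N + 2 ≤ (i : ℕ) then 1 else 2
  have ha : ∀ k, k < N + 4 → extendZero a k = if k = 0 ∨ N + 2 ≤ k then 1 else 2 := fun k hk => by
    rw [extendZero, dif_pos hk]
  have hsum : ∀ v : Fin (N + 4) → ℤ, ∑ i, v i = extendZero v 0 +
      ∑ i ∈ Finset.range (N + 1), extendZero v (i + 1) + extendZero v (N + 2) +
        extendZero v (N + 3) := by
    intro v
    rw [sum_eq_sum_extendZero, Finset.sum_range_succ, Finset.sum_range_succ,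
      Finset.sum_range_succ' _ (N + 1)]
    ring
  have hsuma : ∑ i, a i = 2 * N + 5 := by
    rw [hsum, Finset.sum_congr rfl (g := fun _ => (2 : ℤ))]
    · rw [ha 0 (by omega), ha (N + 2) (by omega), ha (N + 3) (by omega), if_pos (by omega),
        if_pos (by omega), if_pos (by omega)]
      simp; ring
    · intro i hi
      rw [Finset.mem_range] at hi
      rw [ha (i + 1) (by omega), if_neg (by omega)]
  refine ⟨a, ?_, fun v hv => ?_, ?_⟩
  · change a ⬝ᵥ (CartanMatrix.D (N + 1 + 3)).mulVec a = 2
    rw [cartan_D_form, stepSum, Finset.sum_range_succ', Finset.sum_eq_zero]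
    · have e0 : extendZero a 0 = 1 := by rw [ha 0 (by omega), if_pos (by omega)]
      have e1 : extendZero a (0 + 1) = 2 := by rw [ha _ (by omega), if_neg (by omega)]
      have e2 : extendZero a (N + 1) = 2 := by rw [ha _ (by omega), if_neg (by omega)]
      have e3 : extendZero a (N + 1 + 1) = 1 := by rw [ha _ (by omega), if_pos (by omega)]
      have e4 : extendZero a (N + 1 + 2) = 1 := by rw [ha _ (by omega), if_pos (by omega)]
      rw [e0, e1, e2, e3, e4]
      norm_num
    · intro i hi
      rw [Finset.mem_range] at hi
      rw [ha (i + 1) (by omega), ha (i + 1 + 1) (by omega), if_neg (by omega), if_neg (by omega)]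
      norm_num
  · change Fin (N + 4) → ℤ at v
    replace hv : v ⬝ᵥ (CartanMatrix.D (N + 1 + 3)).mulVec v = 2 := hv
    rw [cartan_D_form] at hv
    change ∑ i, v i ≤ ∑ i, a i
    rw [hsuma, hsum v]
    set V := extendZero v
    have hle : stepSum V (N + 1) ≤ 2 := by
      linarith [sq_nonneg (V (N + 1 + 1) + V (N + 1 + 2) - V (N + 1)),
        sq_nonneg (V (N + 1 + 1) - V (N + 1 + 2))]
    have h0 : V 0 ≤ 1 := by
      have h1 := stepSum_mono V (Nat.zero_le (N + 1))
      have h2 : stepSum V 0 = V 0 ^ 2 := by simp [stepSum]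
      nlinarith
    have h1 : ∑ i ∈ Finset.range (N + 1), V (i + 1) ≤ ∑ _i ∈ Finset.range (N + 1), 2 :=
      Finset.sum_le_sum fun i hi => by
        rw [Finset.mem_range] at hi
        exact (le_stepSum V (i + 1)).trans ((stepSum_mono V (by omega)).trans hle)
    rw [Finset.sum_const, Finset.card_range] at h1
    have h2 := le_stepSum V (N + 1)
    have h3 := Int.le_self_sq (V (N + 1 + 1) + V (N + 1 + 2) - V (N + 1))
    have h4 := Int.le_self_sq (V (N + 1 + 1) - V (N + 1 + 2))
    have h5 := Int.le_self_sq (-(V (N + 1 + 1) - V (N + 1 + 2)))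
    rw [neg_sq] at h5
    have h6 : V (N + 2) ≤ 1 := by
      have : 2 * V (N + 1 + 1) ≤ 2 := by linarith
      change V (N + 1 + 1) ≤ 1
      linarith
    have h7 : V (N + 3) ≤ 1 := by
      have : 2 * V (N + 1 + 2) ≤ 2 := by linarith
      change V (N + 1 + 2) ≤ 1
      linarith
    simp at h1
    linarith
  · change ((2 * (N + 4) - 2 : ℕ) : ℤ) = 1 + ∑ i, a i
    rw [hsuma]; omega

/-- If the heights of the vectors of square length `2` are bounded, one of them has maximal height,
and it is dominant: reflections in simple roots do not increase its height. -/
lemma exists_dominant {n : ℕ} {C : Matrix (Fin n) (Fin n) ℤ} (hsymm : ∀ i j, C i j = C j i)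
    (hdiag : ∀ i, C i i = 2) {B : ℤ} (hB : ∀ v, v ⬝ᵥ C.mulVec v = 2 → ∑ i, v i ≤ B)
    {v₀ : Fin n → ℤ} (hv₀ : v₀ ⬝ᵥ C.mulVec v₀ = 2) :
    ∃ a, a ⬝ᵥ C.mulVec a = 2 ∧ (∀ v, v ⬝ᵥ C.mulVec v = 2 → ∑ i, v i ≤ ∑ i, a i) ∧
      ∀ i, 0 ≤ C.mulVec a i := by
  obtain ⟨_, ⟨a, ha, rfl⟩, hmax⟩ := Int.exists_greatest_of_bdd
    (P := fun z => ∃ v, v ⬝ᵥ C.mulVec v = 2 ∧ ∑ i, v i = z)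
    ⟨B, by rintro _ ⟨v, hv, rfl⟩; exact hB v hv⟩ ⟨_, v₀, hv₀, rfl⟩
  refine ⟨a, ha, fun v hv => hmax _ ⟨v, hv, rfl⟩, fun i => ?_⟩
  by_contra! hneg
  set s := C.mulVec a i with hs
  have hrefl : (a - Pi.single i s) ⬝ᵥ C.mulVec (a - Pi.single i s) = 2 := by
    have h1 : C.mulVec (Pi.single i s) = fun j => C j i * s := by
      ext j; simp [Matrix.mulVec_single]
    have h2 : a ⬝ᵥ (fun j => C j i * s) = s * s := by
      have : ∑ j, a j * C j i = s := by
        rw [hs, Matrix.mulVec, dotProduct]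
        exact Finset.sum_congr rfl fun j _ => by rw [hsymm i j, mul_comm]
      rw [dotProduct]
      simp_rw [← mul_assoc]
      rw [← Finset.sum_mul, this]
    rw [Matrix.mulVec_sub, h1, dotProduct_sub, sub_dotProduct, sub_dotProduct, ha, h2,
      single_dotProduct, single_dotProduct, hdiag, ← hs]
    ring
  have h3 := hmax _ ⟨_, hrefl, rfl⟩
  simp only [Pi.sub_apply, Finset.sum_sub_distrib, Finset.sum_pi_single', Finset.mem_univ,
    if_true] at h3
  linarith

/-- The quadratic form of the root lattice `E₈` is positive, by completion of squares starting from
the three ends of the diagram. -/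
lemma e8_form_nonneg (x₁ x₂ x₃ x₄ x₅ x₆ x₇ x₈ : ℤ) :
    0 ≤ 2 * (x₁ ^ 2 + x₂ ^ 2 + x₃ ^ 2 + x₄ ^ 2 + x₅ ^ 2 + x₆ ^ 2 + x₇ ^ 2 + x₈ ^ 2) -
      2 * (x₁ * x₃ + x₂ * x₄ + x₃ * x₄ + x₄ * x₅ + x₅ * x₆ + x₆ * x₇ + x₇ * x₈) := by
  linarith [sq_nonneg (2 * x₁ - x₃), sq_nonneg (2 * x₂ - x₄), sq_nonneg (2 * x₈ - x₇),
    sq_nonneg (3 * x₇ - 2 * x₆), sq_nonneg (4 * x₆ - 3 * x₅), sq_nonneg (5 * x₅ - 4 * x₄),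
    sq_nonneg (3 * x₃ - 2 * x₄), sq_nonneg x₄]

/-- The heights of the roots of `E₈`, and hence those of `E₇` and `E₆`, are bounded: pair with twice
the Weyl vector. -/
lemma e8_height_le {x₁ x₂ x₃ x₄ x₅ x₆ x₇ x₈ : ℤ}
    (h : 2 * (x₁ ^ 2 + x₂ ^ 2 + x₃ ^ 2 + x₄ ^ 2 + x₅ ^ 2 + x₆ ^ 2 + x₇ ^ 2 + x₈ ^ 2) -
      2 * (x₁ * x₃ + x₂ * x₄ + x₃ * x₄ + x₄ * x₅ + x₅ * x₆ + x₆ * x₇ + x₇ * x₈) = 2) :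
    x₁ + x₂ + x₃ + x₄ + x₅ + x₆ + x₇ + x₈ ≤ 1000 := by
  linarith [e8_form_nonneg (x₁ - 92) (x₂ - 136) (x₃ - 182) (x₄ - 270) (x₅ - 220) (x₆ - 168)
    (x₇ - 114) (x₈ - 58)]

lemma eq_zero_of_mul_le_two {x w : ℤ} (hw : 0 ≤ w) (hx : 3 * w ≤ x) (h : x * w ≤ 2) : w = 0 := by
  nlinarith

lemma le_one_of_mul_le_two {x w : ℤ} (hx : w < x ∨ w = 0) (h : x * w ≤ 2) : w ≤ 1 := by
  rcases hx with hx | hx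
  · by_contra! hlt
    nlinarith
  · omega

/-- A dominant root `a` with `w = C a` satisfies `∑ a_i w_i = 2`, where `a = C⁻¹ w`.  The diagonal
of `C⁻¹` is `4/3, 2, 10/3, 6, 10/3, 4/3`; an entry of at least `3` forces `w_i = 0`, and one
greater than `1` forces `w_i ≤ 1`.  A single vector `w` remains, that of the highest root. -/
lemma ADE.hasCoxeterNumber_E6 : ADE.E6.HasCoxeterNumber 12 := by
  have hmul : ∀ (v : Fin 6 → ℤ) (i : Fin 6), CartanMatrix.E₆.mulVec v i =
      ![2 * v 0 - v 2, 2 * v 1 - v 3, 2 * v 2 - v 0 - v 3, 2 * v 3 - v 1 - v 2 - v 4,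
        2 * v 4 - v 3 - v 5, 2 * v 5 - v 4] i := fun v i => by
    fin_cases i <;>
      simp [Fin.sum_univ_six, Matrix.mulVec, dotProduct, CartanMatrix.E₆] <;> ring!
  have hform : ∀ v : Fin 6 → ℤ, v ⬝ᵥ CartanMatrix.E₆.mulVec v =
      2 * (v 0 ^ 2 + v 1 ^ 2 + v 2 ^ 2 + v 3 ^ 2 + v 4 ^ 2 + v 5 ^ 2) -
        2 * (v 0 * v 2 + v 1 * v 3 + v 2 * v 3 + v 3 * v 4 + v 4 * v 5) := fun v => by
    simp only [dotProduct, hmul, Fin.sum_univ_six]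
    simp
    ring
  obtain ⟨a, ha, hmax, hdom⟩ := exists_dominant (n := 6) (C := CartanMatrix.E₆)
    (fun i j => CartanMatrix.E₆_isSymm.apply j i) CartanMatrix.E₆_diag
    (B := 1000) (fun v hv => by
      rw [hform] at hv
      have := e8_height_le (x₁ := v 0) (x₂ := v 1) (x₃ := v 2) (x₄ := v 3)
        (x₅ := v 4) (x₆ := v 5) (x₇ := 0) (x₈ := 0) (by linarith)
      rw [Fin.sum_univ_six]
      linarith) (v₀ := Pi.single 0 1) (by rw [hform]; decide)
  refine ⟨a, ha, hmax, ?_⟩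
  change ((12 : ℕ) : ℤ) = 1 + ∑ i : Fin 6, a i
  simp only [dotProduct, hmul, Fin.sum_univ_six] at ha
  simp only [hmul] at hdom
  rw [Fin.sum_univ_six]
  obtain ⟨w0, h0⟩ : ∃ w, w = 2 * a 0 - a 2 := ⟨_, rfl⟩
  obtain ⟨w1, h1⟩ : ∃ w, w = 2 * a 1 - a 3 := ⟨_, rfl⟩
  obtain ⟨w2, h2⟩ : ∃ w, w = 2 * a 2 - a 0 - a 3 := ⟨_, rfl⟩
  obtain ⟨w3, h3⟩ : ∃ w, w = 2 * a 3 - a 1 - a 2 - a 4 := ⟨_, rfl⟩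
  obtain ⟨w4, h4⟩ : ∃ w, w = 2 * a 4 - a 3 - a 5 := ⟨_, rfl⟩
  obtain ⟨w5, h5⟩ : ∃ w, w = 2 * a 5 - a 4 := ⟨_, rfl⟩
  have p0 : 0 ≤ w0 := h0 ▸ hdom 0
  have p1 : 0 ≤ w1 := h1 ▸ hdom 1
  have p2 : 0 ≤ w2 := h2 ▸ hdom 2
  have p3 : 0 ≤ w3 := h3 ▸ hdom 3
  have p4 : 0 ≤ w4 := h4 ▸ hdom 4
  have p5 : 0 ≤ w5 := h5 ▸ hdom 5
  replace ha : a 0 * w0 + a 1 * w1 + a 2 * w2 + a 3 * w3 + a 4 * w4 + a 5 * w5 = 2 := by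
    rw [h0, h1, h2, h3, h4, h5]; exact ha
  have q0 : 0 ≤ a 0 * w0 := mul_nonneg (by linarith) p0
  have q1 : 0 ≤ a 1 * w1 := mul_nonneg (by linarith) p1
  have q2 : 0 ≤ a 2 * w2 := mul_nonneg (by linarith) p2
  have q3 : 0 ≤ a 3 * w3 := mul_nonneg (by linarith) p3
  have q4 : 0 ≤ a 4 * w4 := mul_nonneg (by linarith) p4
  have q5 : 0 ≤ a 5 * w5 := mul_nonneg (by linarith) p5
  have z2 : w2 = 0 :=
    eq_zero_of_mul_le_two (x := a 2) p2 (by linarith) (by linarith)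
  have z3 : w3 = 0 :=
    eq_zero_of_mul_le_two (x := a 3) p3 (by linarith) (by linarith)
  have z4 : w4 = 0 :=
    eq_zero_of_mul_le_two (x := a 4) p4 (by linarith) (by linarith)
  subst z2 z3 z4
  have o0 : w0 ≤ 1 := le_one_of_mul_le_two (x := a 0) (by omega) (by linarith)
  have o1 : w1 ≤ 1 := le_one_of_mul_le_two (x := a 1) (by omega) (by linarith)
  have o5 : w5 ≤ 1 := le_one_of_mul_le_two (x := a 5) (by omega) (by linarith)
  have c0 : w0 = 0 ∨ w0 = 1 := by omega
  have c1 : w1 = 0 ∨ w1 = 1 := by omega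
  have c5 : w5 = 0 ∨ w5 = 1 := by omega
  rcases c0 with rfl | rfl <;> rcases c1 with rfl | rfl <;> rcases c5 with rfl | rfl <;> omega

/-- As for `E₆`; here the diagonal of `C⁻¹` is `2, 7/2, 6, 12, 15/2, 4, 3/2`. -/
lemma ADE.hasCoxeterNumber_E7 : ADE.E7.HasCoxeterNumber 18 := by
  have hmul : ∀ (v : Fin 7 → ℤ) (i : Fin 7), CartanMatrix.E₇.mulVec v i =
      ![2 * v 0 - v 2, 2 * v 1 - v 3, 2 * v 2 - v 0 - v 3, 2 * v 3 - v 1 - v 2 - v 4,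
        2 * v 4 - v 3 - v 5, 2 * v 5 - v 4 - v 6, 2 * v 6 - v 5] i := fun v i => by
    fin_cases i <;>
      simp [Fin.sum_univ_seven, Matrix.mulVec, dotProduct, CartanMatrix.E₇] <;> ring!
  have hform : ∀ v : Fin 7 → ℤ, v ⬝ᵥ CartanMatrix.E₇.mulVec v =
      2 * (v 0 ^ 2 + v 1 ^ 2 + v 2 ^ 2 + v 3 ^ 2 + v 4 ^ 2 + v 5 ^ 2 + v 6 ^ 2) -
        2 * (v 0 * v 2 + v 1 * v 3 + v 2 * v 3 + v 3 * v 4 + v 4 * v 5 + v 5 * v 6) := fun v => by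
    simp only [dotProduct, hmul, Fin.sum_univ_seven]
    simp
    ring
  obtain ⟨a, ha, hmax, hdom⟩ := exists_dominant (n := 7) (C := CartanMatrix.E₇)
    (fun i j => CartanMatrix.E₇_isSymm.apply j i) CartanMatrix.E₇_diag
    (B := 1000) (fun v hv => by
      rw [hform] at hv
      have := e8_height_le (x₁ := v 0) (x₂ := v 1) (x₃ := v 2) (x₄ := v 3)
        (x₅ := v 4) (x₆ := v 5) (x₇ := v 6) (x₈ := 0) (by linarith)
      rw [Fin.sum_univ_seven]
      linarith) (v₀ := Pi.single 0 1) (by rw [hform]; decide)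
  refine ⟨a, ha, hmax, ?_⟩
  change ((18 : ℕ) : ℤ) = 1 + ∑ i : Fin 7, a i
  simp only [dotProduct, hmul, Fin.sum_univ_seven] at ha
  simp only [hmul] at hdom
  rw [Fin.sum_univ_seven]
  obtain ⟨w0, h0⟩ : ∃ w, w = 2 * a 0 - a 2 := ⟨_, rfl⟩
  obtain ⟨w1, h1⟩ : ∃ w, w = 2 * a 1 - a 3 := ⟨_, rfl⟩
  obtain ⟨w2, h2⟩ : ∃ w, w = 2 * a 2 - a 0 - a 3 := ⟨_, rfl⟩
  obtain ⟨w3, h3⟩ : ∃ w, w = 2 * a 3 - a 1 - a 2 - a 4 := ⟨_, rfl⟩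
  obtain ⟨w4, h4⟩ : ∃ w, w = 2 * a 4 - a 3 - a 5 := ⟨_, rfl⟩
  obtain ⟨w5, h5⟩ : ∃ w, w = 2 * a 5 - a 4 - a 6 := ⟨_, rfl⟩
  obtain ⟨w6, h6⟩ : ∃ w, w = 2 * a 6 - a 5 := ⟨_, rfl⟩
  have p0 : 0 ≤ w0 := h0 ▸ hdom 0
  have p1 : 0 ≤ w1 := h1 ▸ hdom 1
  have p2 : 0 ≤ w2 := h2 ▸ hdom 2
  have p3 : 0 ≤ w3 := h3 ▸ hdom 3
  have p4 : 0 ≤ w4 := h4 ▸ hdom 4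
  have p5 : 0 ≤ w5 := h5 ▸ hdom 5
  have p6 : 0 ≤ w6 := h6 ▸ hdom 6
  replace ha : a 0 * w0 + a 1 * w1 + a 2 * w2 + a 3 * w3 + a 4 * w4 + a 5 * w5 + a 6 * w6 = 2 := by
    rw [h0, h1, h2, h3, h4, h5, h6]; exact ha
  have q0 : 0 ≤ a 0 * w0 := mul_nonneg (by linarith) p0
  have q1 : 0 ≤ a 1 * w1 := mul_nonneg (by linarith) p1
  have q2 : 0 ≤ a 2 * w2 := mul_nonneg (by linarith) p2
  have q3 : 0 ≤ a 3 * w3 := mul_nonneg (by linarith) p3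
  have q4 : 0 ≤ a 4 * w4 := mul_nonneg (by linarith) p4
  have q5 : 0 ≤ a 5 * w5 := mul_nonneg (by linarith) p5
  have q6 : 0 ≤ a 6 * w6 := mul_nonneg (by linarith) p6
  have z1 : w1 = 0 :=
    eq_zero_of_mul_le_two (x := a 1) p1 (by linarith) (by linarith)
  have z2 : w2 = 0 :=
    eq_zero_of_mul_le_two (x := a 2) p2 (by linarith) (by linarith)
  have z3 : w3 = 0 :=
    eq_zero_of_mul_le_two (x := a 3) p3 (by linarith) (by linarith)
  have z4 : w4 = 0 :=
    eq_zero_of_mul_le_two (x := a 4) p4 (by linarith) (by linarith)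
  have z5 : w5 = 0 :=
    eq_zero_of_mul_le_two (x := a 5) p5 (by linarith) (by linarith)
  subst z1 z2 z3 z4 z5
  have o0 : w0 ≤ 1 := le_one_of_mul_le_two (x := a 0) (by omega) (by linarith)
  have o6 : w6 ≤ 1 := le_one_of_mul_le_two (x := a 6) (by omega) (by linarith)
  have c0 : w0 = 0 ∨ w0 = 1 := by omega
  have c6 : w6 = 0 ∨ w6 = 1 := by omega
  rcases c0 with rfl | rfl <;> rcases c6 with rfl | rfl <;> omega

/-- As for `E₆`; here the diagonal of `C⁻¹` is `4, 8, 14, 30, 20, 12, 6, 2`. -/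
lemma ADE.hasCoxeterNumber_E8 : ADE.E8.HasCoxeterNumber 30 := by
  have hmul : ∀ (v : Fin 8 → ℤ) (i : Fin 8), CartanMatrix.E₈.mulVec v i =
      ![2 * v 0 - v 2, 2 * v 1 - v 3, 2 * v 2 - v 0 - v 3, 2 * v 3 - v 1 - v 2 - v 4,
        2 * v 4 - v 3 - v 5, 2 * v 5 - v 4 - v 6, 2 * v 6 - v 5 - v 7, 2 * v 7 - v 6] i := fun v i => by
    fin_cases i <;>
      simp [Fin.sum_univ_eight, Matrix.mulVec, dotProduct, CartanMatrix.E₈] <;> ring!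
  have hform : ∀ v : Fin 8 → ℤ, v ⬝ᵥ CartanMatrix.E₈.mulVec v =
      2 * (v 0 ^ 2 + v 1 ^ 2 + v 2 ^ 2 + v 3 ^ 2 + v 4 ^ 2 + v 5 ^ 2 + v 6 ^ 2 + v 7 ^ 2) -
        2 * (v 0 * v 2 + v 1 * v 3 + v 2 * v 3 + v 3 * v 4 + v 4 * v 5 + v 5 * v 6 +
          v 6 * v 7) := fun v => by
    simp only [dotProduct, hmul, Fin.sum_univ_eight]
    simp
    ring
  obtain ⟨a, ha, hmax, hdom⟩ := exists_dominant (n := 8) (C := CartanMatrix.E₈)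
    (fun i j => CartanMatrix.E₈_isSymm.apply j i) CartanMatrix.E₈_diag
    (B := 1000) (fun v hv => by
      rw [hform] at hv
      have := e8_height_le (x₁ := v 0) (x₂ := v 1) (x₃ := v 2) (x₄ := v 3)
        (x₅ := v 4) (x₆ := v 5) (x₇ := v 6) (x₈ := v 7) (by linarith)
      rw [Fin.sum_univ_eight]
      linarith) (v₀ := Pi.single 0 1) (by rw [hform]; decide)
  refine ⟨a, ha, hmax, ?_⟩
  change ((30 : ℕ) : ℤ) = 1 + ∑ i : Fin 8, a i
  simp only [dotProduct, hmul, Fin.sum_univ_eight] at ha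
  simp only [hmul] at hdom
  rw [Fin.sum_univ_eight]
  obtain ⟨w0, h0⟩ : ∃ w, w = 2 * a 0 - a 2 := ⟨_, rfl⟩
  obtain ⟨w1, h1⟩ : ∃ w, w = 2 * a 1 - a 3 := ⟨_, rfl⟩
  obtain ⟨w2, h2⟩ : ∃ w, w = 2 * a 2 - a 0 - a 3 := ⟨_, rfl⟩
  obtain ⟨w3, h3⟩ : ∃ w, w = 2 * a 3 - a 1 - a 2 - a 4 := ⟨_, rfl⟩
  obtain ⟨w4, h4⟩ : ∃ w, w = 2 * a 4 - a 3 - a 5 := ⟨_, rfl⟩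
  obtain ⟨w5, h5⟩ : ∃ w, w = 2 * a 5 - a 4 - a 6 := ⟨_, rfl⟩
  obtain ⟨w6, h6⟩ : ∃ w, w = 2 * a 6 - a 5 - a 7 := ⟨_, rfl⟩
  obtain ⟨w7, h7⟩ : ∃ w, w = 2 * a 7 - a 6 := ⟨_, rfl⟩
  have p0 : 0 ≤ w0 := h0 ▸ hdom 0
  have p1 : 0 ≤ w1 := h1 ▸ hdom 1
  have p2 : 0 ≤ w2 := h2 ▸ hdom 2
  have p3 : 0 ≤ w3 := h3 ▸ hdom 3
  have p4 : 0 ≤ w4 := h4 ▸ hdom 4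
  have p5 : 0 ≤ w5 := h5 ▸ hdom 5
  have p6 : 0 ≤ w6 := h6 ▸ hdom 6
  have p7 : 0 ≤ w7 := h7 ▸ hdom 7
  replace ha : a 0 * w0 + a 1 * w1 + a 2 * w2 + a 3 * w3 + a 4 * w4 + a 5 * w5 + a 6 * w6 +
      a 7 * w7 = 2 := by
    rw [h0, h1, h2, h3, h4, h5, h6, h7]; exact ha
  have q0 : 0 ≤ a 0 * w0 := mul_nonneg (by linarith) p0
  have q1 : 0 ≤ a 1 * w1 := mul_nonneg (by linarith) p1
  have q2 : 0 ≤ a 2 * w2 := mul_nonneg (by linarith) p2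
  have q3 : 0 ≤ a 3 * w3 := mul_nonneg (by linarith) p3
  have q4 : 0 ≤ a 4 * w4 := mul_nonneg (by linarith) p4
  have q5 : 0 ≤ a 5 * w5 := mul_nonneg (by linarith) p5
  have q6 : 0 ≤ a 6 * w6 := mul_nonneg (by linarith) p6
  have q7 : 0 ≤ a 7 * w7 := mul_nonneg (by linarith) p7
  have z0 : w0 = 0 :=
    eq_zero_of_mul_le_two (x := a 0) p0 (by linarith) (by linarith)
  have z1 : w1 = 0 :=
    eq_zero_of_mul_le_two (x := a 1) p1 (by linarith) (by linarith)
  have z2 : w2 = 0 :=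
    eq_zero_of_mul_le_two (x := a 2) p2 (by linarith) (by linarith)
  have z3 : w3 = 0 :=
    eq_zero_of_mul_le_two (x := a 3) p3 (by linarith) (by linarith)
  have z4 : w4 = 0 :=
    eq_zero_of_mul_le_two (x := a 4) p4 (by linarith) (by linarith)
  have z5 : w5 = 0 :=
    eq_zero_of_mul_le_two (x := a 5) p5 (by linarith) (by linarith)
  have z6 : w6 = 0 :=
    eq_zero_of_mul_le_two (x := a 6) p6 (by linarith) (by linarith)
  subst z0 z1 z2 z3 z4 z5 z6
  have o7 : w7 ≤ 1 := le_one_of_mul_le_two (x := a 7) (by omega) (by linarith)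
  have : w7 = 0 ∨ w7 = 1 := by omega
  rcases this with rfl | rfl <;> omega

/-! ### The ADE classification of modular invariants -/

lemma ADE.HasCoxeterNumber.levels_dvd {X : ADE} {m : ℕ} (hX : X.HasCoxeterNumber m) :
    ∀ n ∈ X.levels m, n ∣ m := by
  cases X with
  | A n hn => simp [ADE.levels]
  | D n hn =>
    obtain rfl := hX.unique (ADE.hasCoxeterNumber_D n hn)
    rw [show 2 * n - 2 = 2 * (n - 1) by omega]
    simp [ADE.levels]
  | E6 => obtain rfl := hX.unique ADE.hasCoxeterNumber_E6; decide
  | E7 => obtain rfl := hX.unique ADE.hasCoxeterNumber_E7; decide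
  | E8 => obtain rfl := hX.unique ADE.hasCoxeterNumber_E8; decide

lemma ADE.HasCoxeterNumber.oddEntry_nonneg {X : ADE} {m : ℕ} (hX : X.HasCoxeterNumber m)
    {a b : ℕ} (ha : a ∈ Finset.Icc 1 (m - 1)) (hb : b ∈ Finset.Icc 1 (m - 1)) :
    0 ≤ X.oddEntry m a b := by
  cases X with
  | A n hn => rw [ADE.oddEntry_A hn ha hb]; split_ifs <;> norm_num
  | D n hn =>
    obtain rfl := hX.unique (ADE.hasCoxeterNumber_D n hn)
    rw [show 2 * n - 2 = 2 * (n - 1) by omega] at ha hb ⊢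
    rcases Nat.mod_two_eq_zero_or_one (n - 1) with h | h
    · rw [ADE.oddEntry_D_of_even (by omega) h hn ha hb]; split_ifs <;> norm_num
    · rw [ADE.oddEntry_D_of_odd (by omega) h hn ha hb]; split_ifs <;> norm_num
  | E6 =>
    obtain rfl := hX.unique ADE.hasCoxeterNumber_E6
    rcases ADE.oddEntry_E6 a ha b hb with h | h <;> rw [h.1]; norm_num
  | E7 =>
    obtain rfl := hX.unique ADE.hasCoxeterNumber_E7
    rw [ADE.oddEntry_E7 a ha b hb]; split_ifs <;> norm_num
  | E8 =>
    obtain rfl := hX.unique ADE.hasCoxeterNumber_E8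
    rcases ADE.oddEntry_E8 a ha b hb with h | h <;> rw [h.1]; norm_num

lemma ADE.HasCoxeterNumber.oddEntry_one_one {X : ADE} {m : ℕ} (hX : X.HasCoxeterNumber m)
    (hm : 2 ≤ m) : X.oddEntry m 1 1 = 1 := by
  have h1 : 1 ∈ Finset.Icc 1 (m - 1) := by rw [Finset.mem_Icc]; omega
  cases X with
  | A n hn => exact ADE.oddEntry_A hn h1 h1
  | D n hn =>
    obtain rfl := hX.unique (ADE.hasCoxeterNumber_D n hn)
    rw [show 2 * n - 2 = 2 * (n - 1) by omega] at h1 ⊢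
    rcases Nat.mod_two_eq_zero_or_one (n - 1) with h | h
    · exact ADE.oddEntry_D_of_even (by omega) h hn h1 h1
    · have := ADE.oddEntry_D_of_odd (by omega) h hn h1 h1
      rw [if_neg (show ¬ 1 + 1 = 2 * (n - 1) by omega)] at this
      exact this
  | E6 => obtain rfl := hX.unique ADE.hasCoxeterNumber_E6; decide
  | E7 => obtain rfl := hX.unique ADE.hasCoxeterNumber_E7; decide
  | E8 => obtain rfl := hX.unique ADE.hasCoxeterNumber_E8; decide

/-- The classification of modular invariants: the first row decides between the types. -/
theorem IsModularInvariant.exists_ADE {m : ℕ} [NeZero m] {c : ℕ → ℕ → ℕ}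
    (hc : IsModularInvariant m c) (hm : 2 ≤ m) : ∃ X : ADE, X.HasCoxeterNumber m ∧
      ∀ a ∈ Finset.Icc 1 (m - 1), ∀ b ∈ Finset.Icc 1 (m - 1), (c a b : ℤ) = X.oddEntry m a b := by
  by_cases h6 : m = 12 ∧ c 1 7 ≠ 0
  · obtain ⟨rfl, h7⟩ := h6
    exact ⟨ADE.E6, ADE.hasCoxeterNumber_E6, hc.eq_E6 h7⟩
  by_cases h8 : m = 30 ∧ (c 1 11 ≠ 0 ∨ c 1 19 ≠ 0)
  · obtain ⟨rfl, h8⟩ := h8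
    exact ⟨ADE.E8, ADE.hasCoxeterNumber_E8, hc.eq_E8 h8⟩
  have hrow : ∀ x ∈ Finset.Icc 1 (m - 1), c 1 x ≠ 0 → x = 1 ∨ (x = m - 1 ∧ m % 4 = 2) := by
    intro x hx hcx
    rcases hc.row_one hx hcx with h | h | ⟨h, rfl⟩ | ⟨h, rfl | rfl⟩
    · exact Or.inl h
    · exact Or.inr h
    · exact absurd ⟨h, hcx⟩ h6
    · exact absurd ⟨h, Or.inl hcx⟩ h8
    · exact absurd ⟨h, Or.inr hcx⟩ h8
  by_cases hlast : c 1 (m - 1) ≠ 0 ∧ m % 4 = 2 ∧ 6 ≤ m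
  · obtain ⟨h1, h2, h3⟩ := hlast
    obtain ⟨h, rfl⟩ : ∃ h, m = 2 * h := ⟨m / 2, by omega⟩
    have H : IsFoldedInvariant (2 * h) h c := ⟨hc, rfl, by omega, by omega, fun x hx hx1 hx2 => by
      by_contra h0
      rcases hrow x hx h0 with h4 | h4
      · exact hx1 h4
      · exact hx2 h4.1, h1⟩
    by_cases hmid : c h h = 2
    · refine ⟨ADE.D (h + 1) (by omega), ?_, fun a ha b hb => ?_⟩
      · have := ADE.hasCoxeterNumber_D (h + 1) (by omega)
        rwa [show 2 * (h + 1) - 2 = 2 * h by omega] at this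
      · rw [ADE.oddEntry_D_of_odd (by omega) (by omega) _ ha hb,
          H.eq_of_mid_eq_two hmid a ha b hb]
        push_cast
        rfl
    · obtain ⟨h18, hval⟩ := H.eq_E7_of_mid_ne_two hmid
      obtain rfl : h = 9 := by omega
      refine ⟨ADE.E7, ADE.hasCoxeterNumber_E7, fun a ha b hb => ?_⟩
      have := ADE.oddEntry_E7 a ha b hb
      change _ = ADE.E7.oddEntry 18 a b
      rw [this, hval a ha b hb]
      push_cast
      rfl
  · have hdelta : ∀ x ∈ Finset.Icc 1 (m - 1), x ≠ 1 → c 1 x = 0 := by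
      intro x hx hx1
      by_contra h0
      rcases hrow x hx h0 with h | ⟨rfl, h⟩
      · exact hx1 h
      · exact hlast ⟨h0, h, by omega⟩
    rcases hc.eq_of_delta hdelta with h | ⟨h4, h8', h⟩
    · refine ⟨ADE.A (m - 1) (by omega), ?_, fun a ha b hb => ?_⟩
      · have := ADE.hasCoxeterNumber_A (m - 1) (by omega)
        rwa [show m - 1 + 1 = m by omega] at this
      · rw [ADE.oddEntry_A _ ha hb, h a ha b hb]; push_cast; rfl
    · obtain ⟨g, rfl⟩ : ∃ g, m = 2 * g := ⟨m / 2, by omega⟩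
      refine ⟨ADE.D (g + 1) (by omega), ?_, fun a ha b hb => ?_⟩
      · have := ADE.hasCoxeterNumber_D (g + 1) (by omega)
        rwa [show 2 * (g + 1) - 2 = 2 * g by omega] at this
      · rw [ADE.oddEntry_D_of_even (by omega) (by omega) _ ha hb, h a ha b hb]
        push_cast
        rfl

/-! ### The action of `Ω^X` on vectors of theta coefficients -/

lemma omegaOddEntry_neg_right (m n : ℕ) (r r' : ℤ) :
    omegaOddEntry m n r (-r') = -omegaOddEntry m n r r' := by
  simp only [omegaOddEntry, sub_neg_eq_add, ← sub_eq_add_neg, neg_sub]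

lemma ADE.oddEntry_neg_right (m : ℕ) (X : ADE) (r r' : ℤ) :
    X.oddEntry m r (-r') = -X.oddEntry m r r' := by
  simp only [ADE.oddEntry, omegaOddEntry_neg_right, Finset.sum_neg_distrib]

/-- The odd part of `Ω^X` is determined by its entries with indices in `1, …, m - 1`. -/
lemma ADE.oddExt_eq_omegaX {m : ℕ} [NeZero m] {X : ADE} (hX : ∀ n ∈ X.levels m, n ∣ m)
    {c : ℕ → ℕ → ℕ} (hc : ∀ a ∈ Finset.Icc 1 (m - 1), ∀ b ∈ Finset.Icc 1 (m - 1),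
      (c a b : ℤ) = X.oddEntry m a b) (x y : ZMod (2 * m)) :
    (oddExt m c x y : ℂ) = X.omegaX m x y - X.omegaX m (-x) y := by
  let G : ZMod (2 * m) → ZMod (2 * m) → ℂ := fun x y =>
    (oddExt m c x y : ℂ) - (X.omegaX m x y - X.omegaX m (-x) y)
  have hleft : ∀ y x, G (-x) y = -G x y := by
    intro y x
    simp only [G, oddExt_neg_left, neg_neg]
    push_cast
    ring
  have hright : ∀ x y, G x (-y) = -G x y := by
    intro x y
    obtain ⟨r, rfl⟩ := ZMod.intCast_surjective x
    obtain ⟨s, rfl⟩ := ZMod.intCast_surjective y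
    have := ADE.omegaX_sub_omegaX_neg hX r (-s)
    rw [ADE.oddEntry_neg_right] at this
    simp only [G, oddExt_neg_right]
    push_cast at this ⊢
    rw [this, ADE.omegaX_sub_omegaX_neg hX]
    ring
  rw [← sub_eq_zero]
  change G x y = 0
  rcases zmod_cases x with rfl | rfl | ⟨r, hr, hx⟩
  · exact odd_zero (f := fun x => G x y) (hleft y)
  · exact odd_self (f := fun x => G x y) (hleft y)
  rcases zmod_cases y with rfl | rfl | ⟨s, hs, hy⟩
  · exact odd_zero (hright x)
  · exact odd_self (hright x)
  have hpos : G r s = 0 := by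
    have := ADE.omegaX_sub_omegaX_neg hX r s
    push_cast at this
    simp only [G]
    rw [this, oddExt_natCast c hr hs, ← hc r hr s hs, sub_self]
  have hpos' : G x s = 0 := by
    rcases hx with rfl | rfl
    · exact hpos
    · rw [hleft, hpos, neg_zero]
  rcases hy with rfl | rfl
  · exact hpos'
  · rw [hright, hpos', neg_zero]

lemma thetaSum_omegaX {m : ℕ} [NeZero m] {X : ADE} (hX : ∀ n ∈ X.levels m, n ∣ m)
    (h : ZMod (2 * m) → ℍ → ℂ) :
    thetaSum m h (X.omegaX m) = X.eichlerZagierX m (thetaSum m h 1) := by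
  ext τ z
  rw [ADE.eichlerZagierX, Finset.sum_congr rfl fun n hn => by rw [← thetaSum_omega (hX n hn)]]
  simp_rw [thetaSum_eq]
  rw [Finset.sum_comm]
  refine Finset.sum_congr rfl fun x _ => ?_
  rw [← Finset.sum_mul, Finset.sum_comm]
  simp_rw [ADE.omegaX, Matrix.sum_apply, Finset.mul_sum]

/-- Against an odd vector, a matrix acts through its odd part. -/
lemma sum_mul_congr_of_odd {m : ℕ} [NeZero m] {f : ZMod (2 * m) → ℂ} (hf : ∀ x, f (-x) = -f x)
    {Ω : Matrix (ZMod (2 * m)) (ZMod (2 * m)) ℂ} {F : ZMod (2 * m) → ZMod (2 * m) → ℂ}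
    (hF : ∀ r x, Ω r x - Ω (-r) x = F r x) (x : ZMod (2 * m)) :
    ∑ r, f r * Ω r x = 1 / 2 * ∑ r, f r * F r x := by
  rw [sum_mul_eq_half_odd hf]
  simp_rw [hF]

end JacobiADE

end

/-- `thetaSum m h 1` is the original form `hᵀ · θ_m`. -/
theorem theorem2p1 (m : ℕ) [NeZero m] (hm : 2 ≤ m) :
    (∀ X : ADE, X.HasCoxeterNumber m →
      ∃ c : ℕ → ℕ → ℕ, c 1 1 = 1 ∧
        ∀ k : ℤ, Odd k → ∀ h : ZMod (2 * m) → ℍ → ℂ, IsJacobiForm k m (thetaSum m h 1) →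
          IsJacobiForm k m (thetaSum m h (X.omegaX m)) ∧
          HasThetaCoefficients m h c (thetaSum m h (X.omegaX m)) ∧
          thetaSum m h (X.omegaX m) = X.eichlerZagierX m (thetaSum m h 1)) ∧
    (∀ k : ℤ, Odd k → ∀ Ω : Matrix (ZMod (2 * m)) (ZMod (2 * m)) ℂ,
      (∀ h : ZMod (2 * m) → ℍ → ℂ, HasExponentialGrowth h →
        IsJacobiForm k m (thetaSum m h 1) →
          IsJacobiForm k m (thetaSum m h Ω) ∧
          ∃ c : ℕ → ℕ → ℕ, c 1 1 = 1 ∧ HasThetaCoefficients m h c (thetaSum m h Ω)) →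
      ∃ X : ADE, X.HasCoxeterNumber m ∧
        (∀ r r' : ZMod (2 * m), Ω r r' - Ω (-r) r' = X.omegaX m r r' - X.omegaX m (-r) r') ∧
        ∀ h : ZMod (2 * m) → ℍ → ℂ, IsJacobiForm k m (thetaSum m h 1) →
          thetaSum m h Ω = thetaSum m h (X.omegaX m) ∧
          thetaSum m h Ω = X.eichlerZagierX m (thetaSum m h 1)) := by
  constructor
  · intro X hX
    have hdvd := hX.levels_dvd
    refine ⟨fun a b => (X.oddEntry m a b).toNat, ?_, fun k hk h hJ => ⟨?_, fun τ z => ?_, ?_⟩⟩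
    · exact congrArg Int.toNat (hX.oddEntry_one_one hm)
    · rw [thetaSum_omegaX hdvd]
      exact IsJacobiForm.sum _ fun n hn => hJ.eichlerZagier (hdvd n hn)
    · have hodd := fun r => coeff_neg hk hJ r τ
      rw [sum_theta_coefficients (h := fun r => h r τ) hodd, thetaSum_eq]
      refine Finset.sum_congr rfl fun x _ => ?_
      rw [sum_mul_congr_of_odd hodd fun r x => (ADE.oddExt_eq_omegaX hdvd
        (fun a ha b hb => Int.toNat_of_nonneg (hX.oddEntry_nonneg ha hb)) r x).symm]
    · exact thetaSum_omegaX hdvd h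
  · intro k hk Ω H
    obtain ⟨c, hc, hΩ⟩ := exists_modularInvariant hm hk H
    obtain ⟨X, hX, hcX⟩ := hc.exists_ADE hm
    have hdvd := hX.levels_dvd
    have hΩX : ∀ r r' : ZMod (2 * m),
        Ω r r' - Ω (-r) r' = X.omegaX m r r' - X.omegaX m (-r) r' := fun r r' => by
      rw [hΩ, ADE.oddExt_eq_omegaX hdvd hcX]
    have heq : ∀ h : ZMod (2 * m) → ℍ → ℂ, IsJacobiForm k m (thetaSum m h 1) →
        thetaSum m h Ω = thetaSum m h (X.omegaX m) := by
      intro h hJ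
      ext τ z
      have hodd := fun r => coeff_neg hk hJ r τ
      rw [thetaSum_eq, thetaSum_eq]
      refine Finset.sum_congr rfl fun x _ => ?_
      rw [sum_mul_congr_of_odd hodd hΩX, sum_mul_congr_of_odd hodd fun _ _ => rfl]
    exact ⟨X, hX, hΩX, fun h hJ => ⟨heq h hJ, (heq h hJ).trans (thetaSum_omegaX hdvd h)⟩⟩
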